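/- **Setting.** Let $d$ be a dimension, $q>1$, $N_1>1$. Let $\omega=(\omega_{x,t})_{(x,t)\in\mathbb R^d\times\mathbb R}$ be a random field, defined on a probability space with probability measure $\mathbb P$, with values in a measurable space $\Omega_0$, such that * the law of $\omega$ on $\Omega_0^{\mathbb R^d\times\mathbb R}$ is invariant under the space-time shifts $(T_{y,s}\omega)_{x,t}=\omega_{x+y,t+s}$, and every measurable set that is invariant under all these shifts has probability $0$ or $1$; * for every $a\in\mathbb R$, $\sigma(\omega_{x,t}: x\in\mathbb R^d, t\le a)$ and $\sigma(\omega_{x,t}: x\in\mathbb R^d, t\ge a+1)$ are independent. Let $H:\mathbb R^d\times\Omega_0\to\mathbb R$ be measurable in its second variable and convex in its first, and suppose that its Legendre transform $L(v,a)=\sup_{p\in\mathbb R^d}(p\cdot v-H(p,a))$ is finite. Write $L_\omega(x,t,v)=L(v,\omega_{x,t})$. Suppose that almost surely, for every $R>0$, $L_\omega$ is bounded and uniformly continuous on $\mathbb R^d\times[-R,R]\times B(0,R)$. Let $\nu:\Omega_0^{\mathbb R^d}\to[1,\infty)$ be measurable, put $\nu_t=\nu((\omega_{x,t})_{x\in\mathbb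 R^d})$, assume that $(t,\omega)\mapsto\nu_t$ is jointly measurable, and suppose that for some constant $C$, almost surely, for all $x,y\in\mathbb R^d$, $t,s\in\mathbb R$, $v,w\in\mathbb R^d$, $$\tfrac1{N_1}|v|^q-\nu_t\le L_\omega(x,t,v)\le N_1|v|^q+\nu_t,$$ $$|L_\omega(x,t,v)-L_\omega(y,s,w)|\le C|v-w|\,(|v|^{q-1}+|w|^{q-1}+1)+\nu_s+\nu_t .$$ For $t>0$ let $$m(x,t)=\inf\Big\{\int_0^tL_\omega(\gamma(s),s,\dot\gamma(s))\,ds:\ \gamma\in \mathrm{AC}([0,t],\mathbb R^d),\ \gamma(0)=0,\ \gamma(t)=x\Big\},$$ and for $c_1>0$ let $\varphi(s)=\varphi_{c_1}(s)=\exp\big(c_1(\log s)^{1/\min(2,q)}\big)$, $s\ge1$. **Theorem.** There are a constant $c_1>0$ depending only on $d,q,N_1$, constants $K_p$ depending only on $d,q,N_1,p$, and a function $T=T_{d,q}$ depending only on $d,q$, such that for every field, $H$ and $\nu$ as above, every $x_0\in\mathbb R^d$ and every $t_0\ge2$: (a) If $\big\|\int_0^1\nu_r\,dr\big\|_{L^p(\mathbb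 P)}<C_0$ for some $p\ge2$, then $m(x_0,t_0)$ is integrable and for all $\lambda>0$ $$\mathbb P\Big(|m(x_0,t_0)-\mathbb E\,m(x_0,t_0)|\ge\lambda\, t_0^{1/2}\varphi(t_0)\big(\tfrac{|x_0|^q}{t_0^q}+C_0\log t_0\big)\Big)\le \frac{K_p}{\lambda^{p}}.$$ (b) If $\mathbb E\exp\big(c\int_0^1\nu_r\,dr\big)<C_0$ for some $c>0$, then $m(x_0,t_0)$ is integrable and for every $\lambda_0>0$, if $t_0\ge T(c,C_0,|x_0|/t_0,\lambda_0)$, then for all $\lambda\ge\lambda_0$ $$\mathbb P\Big(|m(x_0,t_0)-\mathbb E\,m(x_0,t_0)|\ge\lambda\, t_0^{1/2}\varphi(t_0)\big(\tfrac{|x_0|^q}{t_0^q}+c^{-1}\log t_0\big)\Big)< \exp\big(-c_1\lambda^{2/3}\big).$$ (c) If $\int_0^1\nu_r\,dr<C_0$ almost surely, then $m(x_0,t_0)$ is integrable and for all $\lambda>0$ $$\mathbb P\Big(|m(x_0,t_0)-\mathbb E\,m(x_0,t_0)|\ge\lambda\, t_0^{1/2}\varphi(t_0)\big(\tfrac{|x_0|^q}{t_0^q}+C_0\log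 t_0\big)\Big)\le 2\exp(-c_1\lambda^{2}).$$ -/

import Mathlib

open MeasureTheory ProbabilityTheory Set
open scoped ENNReal NNReal

noncomputable section

/-- Euclidean space `ℝ^d`. -/
abbrev Spc (d : ℕ) : Type := EuclideanSpace ℝ (Fin d)

/-- Space-time `ℝ^d × ℝ`. -/
abbrev SpTm (d : ℕ) : Type := Spc d × ℝ

section Environment

variable {Ω₀ Ω : Type*} [MeasurableSpace Ω₀] [MeasurableSpace Ω] {d : ℕ}

/-- The space-time shift `(T_{y,s} ω)_{x,t} = ω_{x+y,t+s}` of environments. -/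
def shift (z : SpTm d) (w : SpTm d → Ω₀) : SpTm d → Ω₀ := fun p => w (p + z)

/-- The law of the random field `ξ` on `Ω₀^(ℝ^d × ℝ)`, with the product σ-algebra. -/
def fieldLaw (P : Measure Ω) (ξ : SpTm d → Ω → Ω₀) : Measure (SpTm d → Ω₀) :=
  P.map (fun ω p => ξ p ω)

/-- The law of the field is invariant and ergodic under the space-time shifts. -/
structure StationaryErgodic (P : Measure Ω) (ξ : SpTm d → Ω → Ω₀) : Prop where
  stationary : ∀ z : SpTm d, MeasurePreserving (shift z) (fieldLaw P ξ) (fieldLaw P ξ)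
  ergodic : ∀ U : Set (SpTm d → Ω₀), MeasurableSet U → (∀ z : SpTm d, shift z ⁻¹' U = U) →
    fieldLaw P ξ U = 0 ∨ fieldLaw P ξ U = 1

/-- The σ-algebra on `Ω` generated by the field at the times in `A`. -/
abbrev timeSigma (ξ : SpTm d → Ω → Ω₀) (A : Set ℝ) : MeasurableSpace Ω :=
  ⨆ p ∈ {p : SpTm d | p.2 ∈ A}, MeasurableSpace.comap (ξ p) inferInstance

/-- Unit range of dependence in time. -/
def UnitRange (P : Measure Ω) (ξ : SpTm d → Ω → Ω₀) : Prop :=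
  ∀ a : ℝ, Indep (timeSigma ξ (Iic a)) (timeSigma ξ (Ici (a + 1))) P

/-- The Lagrangian `L(v, a) = sup_p (p · v - H(p, a))`, for a local state `a ∈ Ω₀`. -/
def lagr (H : Spc d → Ω₀ → ℝ) (v : Spc d) (a : Ω₀) : ℝ :=
  ⨆ p : Spc d, (inner ℝ p v - H p a)

/-- `L_ω(x, t, v) = L(v, ω_{x,t})`. -/
def lagrAt (ξ : SpTm d → Ω → Ω₀) (H : Spc d → Ω₀ → ℝ) (ω : Ω) (x : Spc d) (t : ℝ)
    (v : Spc d) : ℝ :=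
  lagr H v (ξ (x, t) ω)

/-- `ν_t(ω) = ν({ω_{x,t} : x ∈ ℝ^d})`. -/
def nuAt (ξ : SpTm d → Ω → Ω₀) (ν : (Spc d → Ω₀) → ℝ) (t : ℝ) (ω : Ω) : ℝ :=
  ν (fun x => ξ (x, t) ω)

/-- `∫_0^1 ν_r dr`, with values in `[0, ∞]`. -/
def nuInt (ξ : SpTm d → Ω → Ω₀) (ν : (Spc d → Ω₀) → ℝ) (ω : Ω) : ℝ≥0∞ :=
  ∫⁻ r in Icc (0 : ℝ) 1, ENNReal.ofReal (nuAt ξ ν r ω)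

/-- The standing assumptions on the random field, the Hamiltonian, and the bound `ν`. -/
structure StandingAssumptions (P : Measure Ω) (ξ : SpTm d → Ω → Ω₀) (H : Spc d → Ω₀ → ℝ)
    (ν : (Spc d → Ω₀) → ℝ) (q N₁ : ℝ) : Prop where
  measurable_field : ∀ p, Measurable (ξ p)
  stationaryErgodic : StationaryErgodic P ξ
  unitRange : UnitRange P ξ
  measurable_H : ∀ p, Measurable (H p)
  convex_H : ∀ a, ConvexOn ℝ univ (fun p => H p a)
  /-- The Lagrangian is real-valued. -/
  lagr_finite : ∀ v a, BddAbove (range fun p : Spc d => inner ℝ p v - H p a)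
  /-- Almost surely, `L_ω` is bounded and uniformly continuous on
  `ℝ^d × [-R, R] × B(0, R)`, for every `R > 0`. -/
  buc : ∀ᵐ ω ∂P, ∀ R : ℝ, 0 < R →
    UniformContinuousOn (fun z : Spc d × ℝ × Spc d => lagrAt ξ H ω z.1 z.2.1 z.2.2)
      (univ ×ˢ (Icc (-R) R ×ˢ Metric.ball 0 R)) ∧
    ∃ B : ℝ, ∀ x : Spc d, ∀ t ∈ Icc (-R) R, ∀ v ∈ Metric.ball (0 : Spc d) R,
      |lagrAt ξ H ω x t v| ≤ B
  measurable_nu : Measurable ν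
  one_le_nu : ∀ w, 1 ≤ ν w
  /-- Joint measurability of `(t, ω) ↦ ν_t(ω)`. -/
  measurable_nuAt : Measurable (fun z : ℝ × Ω => nuAt ξ ν z.1 z.2)
  growth : ∀ᵐ ω ∂P, ∀ (x : Spc d) (t : ℝ) (v : Spc d),
    1 / N₁ * ‖v‖ ^ q - nuAt ξ ν t ω ≤ lagrAt ξ H ω x t v ∧
      lagrAt ξ H ω x t v ≤ N₁ * ‖v‖ ^ q + nuAt ξ ν t ω
  regularity : ∃ C : ℝ, ∀ᵐ ω ∂P, ∀ (x : Spc d) (t : ℝ) (v y : Spc d) (s : ℝ) (w : Spc d),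
    |lagrAt ξ H ω x t v - lagrAt ξ H ω y s w| ≤
      C * ‖v - w‖ * (‖v‖ ^ (q - 1) + ‖w‖ ^ (q - 1) + 1) + nuAt ξ ν s ω + nuAt ξ ν t ω

/-- `m(x₁, t₁; x₂, t₂, ω)`: the infimum of the action over absolutely continuous curves from
`(x₁, t₁)` to `(x₂, t₂)`. Curves of infinite action (those along which the Lagrangian is not
integrable) do not compete. -/
def metricFull (ξ : SpTm d → Ω → Ω₀) (H : Spc d → Ω₀ → ℝ)
    (x₁ : Spc d) (t₁ : ℝ) (x₂ : Spc d) (t₂ : ℝ) (ω : Ω) : ℝ :=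
  sInf {A : ℝ | ∃ γ : ℝ → Spc d, AbsolutelyContinuousOnInterval γ t₁ t₂ ∧
    γ t₁ = x₁ ∧ γ t₂ = x₂ ∧
    IntervalIntegrable (fun s => lagrAt ξ H ω (γ s) s (deriv γ s)) volume t₁ t₂ ∧
    A = ∫ s in t₁..t₂, lagrAt ξ H ω (γ s) s (deriv γ s)}

/-- `m(x, t, ω) = m(0, 0; x, t, ω)`. -/
def metric (ξ : SpTm d → Ω → Ω₀) (H : Spc d → Ω₀ → ℝ) (x : Spc d) (t : ℝ) (ω : Ω) : ℝ :=
  metricFull ξ H 0 0 x t ω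

/-- The event `|m(x, t) - 𝔼 m(x, t)| ≥ a`. -/
def devEvent (P : Measure Ω) (ξ : SpTm d → Ω → Ω₀) (H : Spc d → Ω₀ → ℝ) (x : Spc d) (t : ℝ)
    (a : ℝ) : Set Ω :=
  {ω | a ≤ |metric ξ H x t ω - ∫ ω', metric ξ H x t ω' ∂P|}

end Environment

/-- `φ(s) = exp (c₁ (log s)^{1 / (2 ∧ q)})`. -/
def slowPhi (c₁ q s : ℝ) : ℝ := Real.exp (c₁ * Real.log s ^ (1 / min 2 q))

end

/-! Write `m` for the minimal action from `(0, 0)` to `(x, T)` and `L̄(v)` for the mean of the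
Lagrangian at velocity `v`. During the window `(k - 1, k + 1)` replace the random Lagrangian by
`L̄`. The new infimum `X k` depends only on the field before `k - 1` and after `k + 1`. Let `F k` be
generated by the field up to time `k - 1`. By unit range of dependence the part after `k + 1` is
independent of `F (k + 1)`, so `X k` has the same conditional expectation given `F (k + 1)` and
given `F k`. Hence the increment of the martingale closed by `m` is that of the martingale closed by
the error `Y k = m - X k` (`exists_incrementControl`).

The error is bounded without any knowledge of minimizers. At equal velocities the regularity
hypothesis compares the Lagrangian at two space-time points with error `ν_s + ν_t`, with no growth
in `v`. Averaging one point over integer times, by the strong law, puts the Lagrangian within `ν_t +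
𝔼 ν` of `L̄` (`abs_lagrAt_sub_lagrMean_le`). The action of every curve, and therefore the infimum,
changes by at most the integral of `ν` over the window plus `2 𝔼 ν`.

Thus `m - 𝔼 m` is a sum of about `T` martingale differences, controlled by unit-time integrals of
`ν`, all with the law of `∫_0^1 ν`. A Burkholder type inequality gives (a), truncation followed by
Azuma–Hoeffding gives (b), and Azuma–Hoeffding alone gives (c). The term `|x|^q / t^q` only enlarges
the threshold; `φ` matters in (b), where `(φ log t)^{2/3}` must beat `log t`.

Two measure-theoretic points need care. The infimum over curves is reduced to a countable family of
velocities dense in `L^q` (`sInf_action_eq_iInf`), and each action agrees almost surely with a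
variable measurable for the field at the times involved (`exists_measurable_eq_action`).
Stationarity of the time integrals of `ν` is recovered from finite-dimensional laws
(`map_lintegral_eq_of_fdd`). -/

/-! ### Pointwise second order expansion of `|x + y| ^ p`. -/

section MomentInequality

/-- The constant in the second order expansion of `|x + y| ^ p`. -/
noncomputable def rpowTaylorConst (p : ℝ) : ℝ := p ^ 2 * Real.exp p + 2 ^ p + p

lemma rpowTaylorConst_pos {p : ℝ} (hp : 2 ≤ p) : 0 < rpowTaylorConst p := by
  unfold rpowTaylorConst; positivity

lemma exp_le_one_add_add_sq_mul_exp_abs (x : ℝ) :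
    Real.exp x ≤ 1 + x + x ^ 2 * Real.exp |x| := by
  have h := Complex.norm_exp_sub_sum_le_norm_mul_exp (x : ℂ) 2
  have h2 : ‖Complex.exp x - (1 + x)‖ = |Real.exp x - (1 + x)| := by
    rw [← Complex.ofReal_exp, ← Real.norm_eq_abs, ← Complex.norm_real]; push_cast; rfl
  simp only [Finset.sum_range_succ, Finset.sum_range_zero, pow_zero, Nat.factorial_zero,
    Nat.cast_one, div_one, pow_one, Nat.factorial_one, zero_add, h2] at h
  have := (abs_le.1 h).2
  simp only [Complex.norm_real, Real.norm_eq_abs, sq_abs] at this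
  linarith

lemma one_add_rpow_le {p r : ℝ} (hp : 2 ≤ p) (hr : |r| ≤ 1) :
    (1 + r) ^ p ≤ 1 + p * r + p ^ 2 * Real.exp p * r ^ 2 := by
  have h0 : 0 ≤ 1 + r := by linarith [(abs_le.1 hr).1]
  have h1 : (1 + r) ^ p ≤ Real.exp (p * r) := by
    rw [mul_comm, Real.exp_mul]
    exact Real.rpow_le_rpow h0 (by linarith [Real.add_one_le_exp r]) (by linarith)
  have h2 := exp_le_one_add_add_sq_mul_exp_abs (p * r)
  have h3 : Real.exp |p * r| ≤ Real.exp p := by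
    apply Real.exp_le_exp.2
    rw [abs_mul, abs_of_nonneg (by linarith : 0 ≤ p)]
    nlinarith [abs_nonneg r]
  have h4 : (p * r) ^ 2 * Real.exp |p * r| ≤ (p * r) ^ 2 * Real.exp p := by gcongr
  nlinarith

/-- For `|y| ≤ |x|`, factor out `|x| ^ p` and expand `(1 + y / x) ^ p ≤ exp (p y / x)` to second
order. For `|y| > |x|`, every term is at most a multiple of `|y| ^ p`. The term linear in `y` is
kept exact because it has mean zero when `y` is a martingale difference. -/
lemma abs_add_rpow_le {p : ℝ} (hp : 2 ≤ p) (x y : ℝ) :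
    |x + y| ^ p ≤ |x| ^ p + p * (x * |x| ^ (p - 2)) * y +
      rpowTaylorConst p * (|x| ^ (p - 2) * y ^ 2 + |y| ^ p) := by
  have hp0 : 0 < p := by linarith
  have hy : 0 ≤ |y| ^ p := by positivity
  have hx2 : 0 ≤ |x| ^ (p - 2) := by positivity
  rcases le_or_gt |y| |x| with h | h
  · rcases eq_or_ne x 0 with rfl | hx
    · have : y = 0 := by simpa using h
      subst this
      simp [Real.zero_rpow hp0.ne']
    · have hxp : 0 < |x| := abs_pos.2 hx
      set r := y / x
      have hyr : y = r * x := by simp [r, hx]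
      have hr : |r| ≤ 1 := by
        rw [abs_div]; exact div_le_one_of_le₀ h hxp.le
      have h1 := one_add_rpow_le hp hr
      have e1 : |x + y| ^ p = |x| ^ p * (1 + r) ^ p := by
        rw [← Real.mul_rpow hxp.le (by linarith [(abs_le.1 hr).1]), hyr]
        congr 1
        rw [show x + r * x = x * (1 + r) by ring, abs_mul,
          abs_of_nonneg (by linarith [(abs_le.1 hr).1] : 0 ≤ 1 + r)]
      have e2 : |x| ^ (p - 2) * x ^ 2 = |x| ^ p := by
        rw [← sq_abs x, ← Real.rpow_natCast, ← Real.rpow_add hxp]; norm_num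
      have e3 : p * (x * |x| ^ (p - 2)) * y = |x| ^ p * (p * r) := by
        rw [← e2, hyr]; ring
      have e4 : |x| ^ (p - 2) * y ^ 2 = |x| ^ p * r ^ 2 := by
        rw [← e2, hyr]; ring
      rw [e1, e3, e4]
      have h5 : |x| ^ p * (1 + r) ^ p ≤ |x| ^ p * (1 + p * r + p ^ 2 * Real.exp p * r ^ 2) := by
        gcongr
      have h6 : p ^ 2 * Real.exp p ≤ rpowTaylorConst p := by
        unfold rpowTaylorConst
        have : (0 : ℝ) ≤ 2 ^ p := by positivity
        linarith
      have h7 : p ^ 2 * Real.exp p * (|x| ^ p * r ^ 2) ≤ rpowTaylorConst p * (|x| ^ p * r ^ 2) := by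
        gcongr
      have h8 : 0 ≤ rpowTaylorConst p * |y| ^ p :=
        mul_nonneg (rpowTaylorConst_pos hp).le hy
      nlinarith
  · have hy0 : 0 < |y| := (abs_nonneg x).trans_lt h
    have h1 : |x + y| ^ p ≤ 2 ^ p * |y| ^ p := by
      rw [← Real.mul_rpow (by norm_num) hy0.le]
      apply Real.rpow_le_rpow (abs_nonneg _) _ hp0.le
      linarith [abs_add_le x y]
    have h2 : |x| ^ (p - 2) * |x| * |y| ≤ |y| ^ p := by
      have : |y| ^ p = |y| ^ (p - 2) * |y| * |y| := by
        rw [mul_assoc, ← sq, ← Real.rpow_natCast, ← Real.rpow_add hy0]; norm_num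
      rw [this]
      have : |x| ^ (p - 2) ≤ |y| ^ (p - 2) :=
        Real.rpow_le_rpow (abs_nonneg _) h.le (by linarith)
      gcongr
    have h3 : -(|y| ^ p) ≤ (x * |x| ^ (p - 2)) * y := by
      have : |(x * |x| ^ (p - 2)) * y| ≤ |y| ^ p := by
        rw [abs_mul, abs_mul, abs_of_nonneg hx2]; linarith
      linarith [(abs_le.1 this).1]
    have h4 : p * (-(|y| ^ p)) ≤ p * ((x * |x| ^ (p - 2)) * y) := by gcongr
    have h5 : 0 ≤ rpowTaylorConst p * (|x| ^ (p - 2) * y ^ 2) :=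
      mul_nonneg (rpowTaylorConst_pos hp).le (by positivity)
    have h6 : (2 ^ p + p) * |y| ^ p ≤ rpowTaylorConst p * |y| ^ p := by
      apply mul_le_mul_of_nonneg_right _ hy
      unfold rpowTaylorConst
      have : 0 ≤ p ^ 2 * Real.exp p := by positivity
      linarith
    have h7 : 0 ≤ |x| ^ p := by positivity
    nlinarith

/-- Weighted Young inequality: either `N y ^ 2 ≤ x ^ 2`, and the first term dominates, or `|x| ≤ √N
|y|`, and the second does. -/
lemma abs_rpow_mul_sq_le {p N : ℝ} (hp : 2 ≤ p) (hN : 1 ≤ N) (x y : ℝ) :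
    |x| ^ (p - 2) * y ^ 2 ≤ |x| ^ p / N + N ^ ((p - 2) / 2) * |y| ^ p := by
  have hN0 : 0 < N := by linarith
  have hx2 : 0 ≤ |x| ^ (p - 2) := by positivity
  rcases le_or_gt (N * y ^ 2) (x ^ 2) with h | h
  · have h1 : |x| ^ (p - 2) * y ^ 2 ≤ |x| ^ p / N := by
      rcases eq_or_ne x 0 with rfl | hx
      · have : y ^ 2 ≤ 0 := by nlinarith [sq_nonneg y]
        have : y = 0 := by nlinarith [sq_nonneg y]
        subst this
        simp [Real.zero_rpow (by linarith : p ≠ 0)]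
      · have e2 : |x| ^ (p - 2) * x ^ 2 = |x| ^ p := by
          rw [← sq_abs x, ← Real.rpow_natCast, ← Real.rpow_add (abs_pos.2 hx)]; norm_num
        rw [le_div_iff₀ hN0, ← e2]
        nlinarith
    have : 0 ≤ N ^ ((p - 2) / 2) * |y| ^ p := by positivity
    linarith
  · have hy : y ≠ 0 := by
      rintro rfl
      nlinarith [sq_nonneg x]
    have e2 : |y| ^ (p - 2) * y ^ 2 = |y| ^ p := by
      rw [← sq_abs y, ← Real.rpow_natCast, ← Real.rpow_add (abs_pos.2 hy)]; norm_num
    have h1 : |x| ≤ N ^ ((1 : ℝ) / 2) * |y| := by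
      rw [← Real.sqrt_eq_rpow, ← Real.sqrt_sq_eq_abs y, ← Real.sqrt_mul hN0.le,
        ← Real.sqrt_sq_eq_abs x]
      exact Real.sqrt_le_sqrt h.le
    have h2 : |x| ^ (p - 2) ≤ N ^ ((p - 2) / 2) * |y| ^ (p - 2) := by
      calc |x| ^ (p - 2) ≤ (N ^ ((1 : ℝ) / 2) * |y|) ^ (p - 2) :=
            Real.rpow_le_rpow (abs_nonneg _) h1 (by linarith)
        _ = _ := by
            rw [Real.mul_rpow (by positivity) (abs_nonneg _), ← Real.rpow_mul hN0.le]
            congr 2; ring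
    have h3 : |x| ^ (p - 2) * y ^ 2 ≤ N ^ ((p - 2) / 2) * |y| ^ (p - 2) * y ^ 2 := by gcongr
    have : 0 ≤ |x| ^ p / N := by positivity
    rw [mul_assoc, e2] at h3
    linarith

/-- The parameter `N` trades growth of the old sum against the weight of the new term; for a sum of
`n` terms, `N = n` makes the accumulated growth bounded. -/
lemma abs_add_rpow_le_of_one_le {p N : ℝ} (hp : 2 ≤ p) (hN : 1 ≤ N) (x y : ℝ) :
    |x + y| ^ p ≤ (1 + rpowTaylorConst p / N) * |x| ^ p + p * ((x * |x| ^ (p - 2)) * y) +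
      2 * rpowTaylorConst p * N ^ ((p - 2) / 2) * |y| ^ p := by
  have h1 := abs_add_rpow_le hp x y
  have h2 := abs_rpow_mul_sq_le hp hN x y
  have hC := rpowTaylorConst_pos hp
  have h3 : 1 ≤ N ^ ((p - 2) / 2) := Real.one_le_rpow hN (by linarith)
  have h4 : 0 ≤ |y| ^ p := by positivity
  have h5 : |x| ^ (p - 2) * y ^ 2 + |y| ^ p ≤
      |x| ^ p / N + 2 * N ^ ((p - 2) / 2) * |y| ^ p := by nlinarith
  have h6 := mul_le_mul_of_nonneg_left h5 hC.le
  have h7 : rpowTaylorConst p * (|x| ^ p / N) = rpowTaylorConst p / N * |x| ^ p := by ring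
  nlinarith

end MomentInequality

/-! ### Azuma–Hoeffding and Burkholder type inequalities. -/

section MartingaleDifferences

variable {Ω : Type*} [mΩ : MeasurableSpace Ω]

/-- `D` is a sequence of integrable martingale differences for the filtration `F`: `D k` is
`F (k + 1)`-measurable, with vanishing conditional expectation given `F k`. -/
structure IsMartingaleDiff (P : Measure Ω) (F : ℕ → MeasurableSpace Ω) (D : ℕ → Ω → ℝ) : Prop where
  mono : Monotone F
  le : ∀ k, F k ≤ mΩ
  stronglyMeasurable : ∀ k, StronglyMeasurable[F (k + 1)] (D k)
  integrable : ∀ k, Integrable (D k) P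
  condExp_eq_zero : ∀ k, P[D k | F k] =ᵐ[P] 0

variable {P : Measure Ω} {F : ℕ → MeasurableSpace Ω} {D : ℕ → Ω → ℝ}

namespace IsMartingaleDiff

lemma stronglyMeasurable_sum (h : IsMartingaleDiff P F D) (n : ℕ) :
    StronglyMeasurable[F n] (fun ω => ∑ k ∈ Finset.range n, D k ω) := by
  refine Finset.stronglyMeasurable_fun_sum _ fun k hk => ?_
  exact (h.stronglyMeasurable k).mono (h.mono (Finset.mem_range.1 hk))

lemma neg (h : IsMartingaleDiff P F D) : IsMartingaleDiff P F (fun k ω => - D k ω) where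
  mono := h.mono
  le := h.le
  stronglyMeasurable k := (h.stronglyMeasurable k).neg
  integrable k := (h.integrable k).neg
  condExp_eq_zero k := by
    have := condExp_neg (μ := P) (D k) (F k)
    filter_upwards [this, h.condExp_eq_zero k] with ω a b
    change (P[-D k | F k]) ω = 0
    rw [a]; simp [b]

lemma ae_abs_sum_le (_ : IsMartingaleDiff P F D) {b : ℝ} (hD : ∀ k, ∀ᵐ ω ∂P, |D k ω| ≤ b) (n : ℕ) :
    ∀ᵐ ω ∂P, |∑ k ∈ Finset.range n, D k ω| ≤ n * b := by
  filter_upwards [ae_all_iff.2 hD] with ω hω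
  calc |∑ k ∈ Finset.range n, D k ω| ≤ ∑ k ∈ Finset.range n, |D k ω| :=
        Finset.abs_sum_le_sum_abs _ _
    _ ≤ ∑ k ∈ Finset.range n, b := Finset.sum_le_sum fun k _ => hω k
    _ = n * b := by simp

lemma memLp_sum (_ : IsMartingaleDiff P F D) {p : ℝ≥0∞} (hD : ∀ k, MemLp (D k) p P) (n : ℕ) :
    MemLp (fun ω => ∑ k ∈ Finset.range n, D k ω) p P :=
  memLp_finsetSum _ fun k _ => hD k

/-- The graph of `exp` lies below its chord over `[-s b, s b]`. The linear term disappears after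
conditioning, leaving `cosh (s b) ≤ exp (s² b² / 2)` per step. -/
lemma exp_mul_le_cosh_add {s b x : ℝ} (hb : 0 < b) (hx : |x| ≤ b) :
    Real.exp (s * x) ≤ Real.cosh (s * b) + Real.sinh (s * b) / b * x := by
  have hc := convexOn_exp.2
  have ha₁ : 0 ≤ (b - x) / (2 * b) := div_nonneg (by linarith [(abs_le.1 hx).2]) (by linarith)
  have ha₂ : 0 ≤ (b + x) / (2 * b) := div_nonneg (by linarith [(abs_le.1 hx).1]) (by linarith)
  have h := hc (mem_univ (-(s * b))) (mem_univ (s * b)) ha₁ ha₂ (by field_simp; ring)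
  have e : ((b - x) / (2 * b)) • (-(s * b)) + ((b + x) / (2 * b)) • (s * b) = s * x := by
    simp only [smul_eq_mul]; field_simp; ring
  rw [e] at h
  refine h.trans (le_of_eq ?_)
  rw [Real.cosh_eq, Real.sinh_eq]
  simp only [smul_eq_mul]
  field_simp
  ring

variable [IsProbabilityMeasure P]

lemma integral_mul_eq_zero (h : IsMartingaleDiff P F D) {k : ℕ} {g : Ω → ℝ}
    (hg : StronglyMeasurable[F k] g) (hi : Integrable (fun ω => g ω * D k ω) P) :
    ∫ ω, g ω * D k ω ∂P = 0 := by
  have h1 : P[g * D k | F k] =ᵐ[P] g * P[D k | F k] :=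
    condExp_mul_of_stronglyMeasurable_left hg hi (h.integrable k)
  have h2 : P[g * D k | F k] =ᵐ[P] 0 := by
    filter_upwards [h1, h.condExp_eq_zero k] with ω a b
    rw [a]; simp [b]
  have h3 := integral_condExp (h.le k) (f := g * D k) (μ := P)
  rw [integral_congr_ae h2] at h3
  simpa using h3.symm

lemma integrable_exp_sum (h : IsMartingaleDiff P F D) {b : ℝ}
    (hD : ∀ k, ∀ᵐ ω ∂P, |D k ω| ≤ b) (s : ℝ) (n : ℕ) :
    Integrable (fun ω => Real.exp (s * ∑ k ∈ Finset.range n, D k ω)) P := by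
  refine Integrable.of_bound (C := Real.exp (|s| * (n * b))) ?_ ?_
  · exact (Real.continuous_exp.comp_stronglyMeasurable
      (((h.stronglyMeasurable_sum n).mono (h.le n)).const_mul s)).aestronglyMeasurable
  · filter_upwards [h.ae_abs_sum_le hD n] with ω hω
    rw [Real.norm_eq_abs, Real.abs_exp]
    apply Real.exp_le_exp.2
    calc s * ∑ k ∈ Finset.range n, D k ω ≤ |s * ∑ k ∈ Finset.range n, D k ω| := le_abs_self _
      _ ≤ |s| * (n * b) := by rw [abs_mul]; gcongr

lemma integral_exp_sum_le (h : IsMartingaleDiff P F D) {b : ℝ} (hb : 0 < b)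
    (hD : ∀ k, ∀ᵐ ω ∂P, |D k ω| ≤ b) (s : ℝ) (n : ℕ) :
    ∫ ω, Real.exp (s * ∑ k ∈ Finset.range n, D k ω) ∂P ≤ Real.exp (n * b ^ 2 * s ^ 2 / 2) := by
  induction n with
  | zero => simp
  | succ n ih =>
    set S := fun ω => ∑ k ∈ Finset.range n, D k ω with hS
    have hi := h.integrable_exp_sum hD s n
    have hgm : StronglyMeasurable[F n] (fun ω => Real.exp (s * S ω)) :=
      Real.continuous_exp.comp_stronglyMeasurable ((h.stronglyMeasurable_sum n).const_mul s)
    have hgD : Integrable (fun ω => Real.exp (s * S ω) * D n ω) P :=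
      hi.mul_bdd (c := b) (h.integrable n).aestronglyMeasurable (hD n)
    have h0 := h.integral_mul_eq_zero hgm hgD
    calc ∫ ω, Real.exp (s * ∑ k ∈ Finset.range (n + 1), D k ω) ∂P
        ≤ ∫ ω, (Real.cosh (s * b) * Real.exp (s * S ω) +
            Real.sinh (s * b) / b * (Real.exp (s * S ω) * D n ω)) ∂P := by
          refine integral_mono_ae (h.integrable_exp_sum hD s (n + 1))
            ((hi.const_mul _).add (hgD.const_mul _)) ?_
          filter_upwards [hD n] with ω hω
          rw [Finset.sum_range_succ, mul_add, Real.exp_add]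
          have := exp_mul_le_cosh_add (s := s) hb hω
          have := mul_le_mul_of_nonneg_left this (Real.exp_pos (s * S ω)).le
          simp only [S] at this ⊢
          linarith
      _ = Real.cosh (s * b) * ∫ ω, Real.exp (s * S ω) ∂P := by
          rw [integral_add (hi.const_mul _) (hgD.const_mul _), integral_const_mul,
            integral_const_mul, h0]; ring
      _ ≤ Real.exp ((s * b) ^ 2 / 2) * Real.exp (n * b ^ 2 * s ^ 2 / 2) := by
          refine mul_le_mul (Real.cosh_le_exp_half_sq _) ih (integral_nonneg fun _ => ?_)
            (Real.exp_pos _).le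
          exact (Real.exp_pos _).le
      _ = _ := by
          rw [← Real.exp_add]; congr 1; push_cast; ring

lemma hasSubgaussianMGF_sum (h : IsMartingaleDiff P F D) {b : ℝ≥0} (hb : 0 < b)
    (hD : ∀ k, ∀ᵐ ω ∂P, |D k ω| ≤ b) (n : ℕ) :
    HasSubgaussianMGF (fun ω => ∑ k ∈ Finset.range n, D k ω) (n * b ^ 2) P where
  integrable_exp_mul s := h.integrable_exp_sum hD s n
  mgf_le s := by
    have := h.integral_exp_sum_le hb hD s n
    simpa [mgf] using this

/-- The Azuma–Hoeffding inequality. -/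
lemma measure_abs_sum_ge_le (h : IsMartingaleDiff P F D) {b : ℝ} (hb : 0 < b)
    (hD : ∀ k, ∀ᵐ ω ∂P, |D k ω| ≤ b) (n : ℕ) {A : ℝ} (hA : 0 ≤ A) :
    P.real {ω | A ≤ |∑ k ∈ Finset.range n, D k ω|} ≤ 2 * Real.exp (-A ^ 2 / (2 * n * b ^ 2)) := by
  lift b to ℝ≥0 using hb.le
  have h1 := (h.hasSubgaussianMGF_sum (by exact_mod_cast hb) hD n).measure_ge_le hA
  have h2 := (h.neg.hasSubgaussianMGF_sum (b := b) (by exact_mod_cast hb)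
    (by simpa using hD) n).measure_ge_le hA
  have h3 : {ω | A ≤ |∑ k ∈ Finset.range n, D k ω|} ⊆
      {ω | A ≤ ∑ k ∈ Finset.range n, D k ω} ∪ {ω | A ≤ ∑ k ∈ Finset.range n, -D k ω} := by
    intro ω hω
    simp only [mem_ofPred_eq, mem_union, Finset.sum_neg_distrib] at hω ⊢
    exact le_abs.1 hω
  refine (measureReal_mono h3).trans ((measureReal_union_le _ _).trans ?_)
  push_cast at h1 h2
  rw [← mul_assoc] at h1 h2
  linarith

/-- A discrete Grönwall argument: integrating the pointwise expansion multiplies the `p`-th moment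
by `1 + C / N` and adds a fixed amount at each step, since the linear term integrates to zero. -/
lemma integral_abs_sum_rpow_le_of_le (h : IsMartingaleDiff P F D) {p : ℝ} (hp : 2 ≤ p)
    (hL : ∀ k, MemLp (D k) (ENNReal.ofReal p) P) {B : ℝ}
    (hB : ∀ k, ∫ ω, |D k ω| ^ p ∂P ≤ B) {N : ℝ} (hN : 1 ≤ N) (n : ℕ) :
    ∫ ω, |∑ k ∈ Finset.range n, D k ω| ^ p ∂P ≤
      (1 + rpowTaylorConst p / N) ^ n *
        (n * (2 * rpowTaylorConst p * N ^ ((p - 2) / 2) * B)) := by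
  have hp0 : 0 < p := by linarith
  have hN0 : 0 < N := by linarith
  have hC := rpowTaylorConst_pos hp
  have hB0 : 0 ≤ B := le_trans (integral_nonneg fun ω => by positivity) (hB 0)
  have hint : ∀ f : Ω → ℝ, MemLp f (ENNReal.ofReal p) P → Integrable (fun ω => |f ω| ^ p) P := by
    intro f hf
    have := hf.integrable_norm_rpow (by simpa using hp0) ENNReal.ofReal_ne_top
    simpa [ENNReal.toReal_ofReal hp0.le] using this
  induction n with
  | zero => simp [Real.zero_rpow hp0.ne']
  | succ n ih =>
    set S := fun ω => ∑ k ∈ Finset.range n, D k ω with hS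
    set C := rpowTaylorConst p
    have hSm : StronglyMeasurable[F n] S := h.stronglyMeasurable_sum n
    have hgm : StronglyMeasurable[F n] (fun ω => S ω * |S ω| ^ (p - 2)) :=
      hSm.mul ((hSm.norm.measurable.pow_const (p - 2)).stronglyMeasurable)
    have hiS := hint S (h.memLp_sum hL n)
    have hiD := hint (D n) (hL n)
    -- Domination by `|S| ^ p + |D n| ^ p`: the product of powers is at most the `p`-th power of the
    -- larger of `|S|` and `|D n|`.
    have hgD : Integrable (fun ω => S ω * |S ω| ^ (p - 2) * D n ω) P := by
      refine (hiS.add hiD).mono' ((hgm.mono (h.le n)).aestronglyMeasurable.mul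
        (h.integrable n).aestronglyMeasurable) (Filter.Eventually.of_forall fun ω => ?_)
      simp only [Pi.add_apply, Real.norm_eq_abs, abs_mul]
      have hpow : ∀ z : ℝ, 0 ≤ z → z ^ (p - 2) * z * z = z ^ p := by
        intro z hz
        rcases hz.eq_or_lt with rfl | hz
        · simp [Real.zero_rpow hp0.ne']
        · rw [mul_assoc, ← sq, ← Real.rpow_natCast, ← Real.rpow_add hz]; norm_num
      set a := |S ω|
      set c := |D n ω|
      have ha : 0 ≤ a := abs_nonneg _
      have hc : 0 ≤ c := abs_nonneg _
      rw [abs_of_nonneg (by positivity : 0 ≤ a ^ (p - 2))]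
      have hap : 0 ≤ a ^ p := by positivity
      have hcp : 0 ≤ c ^ p := by positivity
      rcases le_total a c with hac | hac
      · have h1 : a ^ (p - 2) ≤ c ^ (p - 2) := Real.rpow_le_rpow ha hac (by linarith)
        have : a * a ^ (p - 2) * c ≤ c * c ^ (p - 2) * c := by gcongr
        linarith [hpow c hc]
      · have : a * a ^ (p - 2) * c ≤ a * a ^ (p - 2) * a := by gcongr
        linarith [hpow a ha]
    have h0 := h.integral_mul_eq_zero hgm hgD
    have hstep : ∫ ω, |∑ k ∈ Finset.range (n + 1), D k ω| ^ p ∂P ≤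
        (1 + C / N) * ∫ ω, |S ω| ^ p ∂P + 2 * C * N ^ ((p - 2) / 2) * B := by
      calc ∫ ω, |∑ k ∈ Finset.range (n + 1), D k ω| ^ p ∂P
          ≤ ∫ ω, ((1 + C / N) * |S ω| ^ p + p * (S ω * |S ω| ^ (p - 2) * D n ω) +
            2 * C * N ^ ((p - 2) / 2) * |D n ω| ^ p) ∂P := by
            refine integral_mono_ae (hint _ (h.memLp_sum hL (n + 1)))
              (((hiS.const_mul _).add (hgD.const_mul _)).add (hiD.const_mul _))
              (Filter.Eventually.of_forall fun ω => ?_)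
            simp only [Finset.sum_range_succ]
            exact abs_add_rpow_le_of_one_le hp hN (S ω) (D n ω)
        _ = (1 + C / N) * ∫ ω, |S ω| ^ p ∂P +
            2 * C * N ^ ((p - 2) / 2) * ∫ ω, |D n ω| ^ p ∂P := by
            rw [integral_add (f := fun ω => (1 + C / N) * |S ω| ^ p +
                p * (S ω * |S ω| ^ (p - 2) * D n ω))
                ((hiS.const_mul _).add (hgD.const_mul _)) (hiD.const_mul _),
              integral_add (hiS.const_mul _) (hgD.const_mul _), integral_const_mul,
              integral_const_mul, integral_const_mul, h0]; ring
        _ ≤ _ := by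
            gcongr
            exact hB n
    set Q := 2 * C * N ^ ((p - 2) / 2) * B
    have hQ : 0 ≤ Q := by positivity
    have h1 : 1 ≤ 1 + C / N := by have : 0 ≤ C / N := by positivity
                                  linarith
    have hpow1 : 1 ≤ (1 + C / N) ^ (n + 1) := one_le_pow₀ h1
    calc _ ≤ _ := hstep
      _ ≤ (1 + C / N) * ((1 + C / N) ^ n * (n * Q)) + Q := by gcongr
      _ ≤ (1 + C / N) * ((1 + C / N) ^ n * (n * Q)) + (1 + C / N) ^ (n + 1) * Q := by
          nlinarith
      _ = _ := by push_cast; ring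

/-- A Burkholder type moment inequality for sums of martingale differences. -/
lemma integral_abs_sum_rpow_le (h : IsMartingaleDiff P F D) {p : ℝ} (hp : 2 ≤ p)
    (hL : ∀ k, MemLp (D k) (ENNReal.ofReal p) P) {B : ℝ}
    (hB : ∀ k, ∫ ω, |D k ω| ^ p ∂P ≤ B) {n : ℕ} (hn : 0 < n) :
    ∫ ω, |∑ k ∈ Finset.range n, D k ω| ^ p ∂P ≤
      2 * rpowTaylorConst p * Real.exp (rpowTaylorConst p) * (n : ℝ) ^ (p / 2) * B := by
  have hn1 : (1 : ℝ) ≤ n := by exact_mod_cast hn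
  have hn0 : (0 : ℝ) < n := by linarith
  have hB0 : 0 ≤ B := le_trans (integral_nonneg fun ω => by positivity) (hB 0)
  have hC := rpowTaylorConst_pos hp
  -- With `N = n` the growth factor is `(1 + C / n) ^ n ≤ exp C`, while `n * n ^ ((p - 2) / 2)` is
  -- the expected `n ^ (p / 2)`.
  refine (h.integral_abs_sum_rpow_le_of_le hp hL hB hn1 n).trans ?_
  set C := rpowTaylorConst p
  have h1 : (1 + C / n) ^ n ≤ Real.exp C := by
    calc (1 + C / n) ^ n ≤ Real.exp (C / n) ^ n := by
          gcongr; linarith [Real.add_one_le_exp (C / n)]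
      _ = Real.exp C := by rw [← Real.exp_nat_mul]; congr 1; field_simp
  have h2 : (n : ℝ) * (n : ℝ) ^ ((p - 2) / 2) = (n : ℝ) ^ (p / 2) := by
    rw [show p / 2 = 1 + (p - 2) / 2 by ring, Real.rpow_add hn0, Real.rpow_one]
  calc _ ≤ Real.exp C * (n * (2 * C * (n : ℝ) ^ ((p - 2) / 2) * B)) := by gcongr
    _ = 2 * C * Real.exp C * (n * (n : ℝ) ^ ((p - 2) / 2)) * B := by ring
    _ = _ := by rw [h2]

end IsMartingaleDiff

end MartingaleDifferences

/-! ### Concentration from control of the martingale increments. -/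

section LocalApproximation

variable {Ω : Type*} [mΩ : MeasurableSpace Ω]

/-- Along the filtration `F`, the error `Y k` captures the whole increment
`P[X | F (k + 1)] - P[X | F k]` of the martingale closed by `X`; moreover `X` is `F n`-measurable
and independent of `F 0` in the mean. -/
structure IncrementControl (P : Measure Ω) (F : ℕ → MeasurableSpace Ω) (X : Ω → ℝ)
    (Y : ℕ → Ω → ℝ) (n : ℕ) : Prop where
  mono : Monotone F
  le : ∀ k, F k ≤ mΩ
  integrable : Integrable X P
  integrable_error : ∀ k, Integrable (Y k) P
  condExp_sub_error : ∀ k, P[X - Y k | F (k + 1)] =ᵐ[P] P[X - Y k | F k]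
  condExp_zero : P[X | F 0] =ᵐ[P] fun _ => ∫ ω, X ω ∂P
  condExp_last : P[X | F n] =ᵐ[P] X

/-- The increments of the martingales closed by `Y k`. -/
noncomputable def condExpIncrement (P : Measure Ω) (F : ℕ → MeasurableSpace Ω) (Y : ℕ → Ω → ℝ)
    (k : ℕ) (ω : Ω) : ℝ :=
  (P[Y k | F (k + 1)]) ω - (P[Y k | F k]) ω

variable {P : Measure Ω} {F : ℕ → MeasurableSpace Ω} {X : Ω → ℝ}
  {Y : ℕ → Ω → ℝ} {n : ℕ}

lemma memLp_condExpIncrement {p : ℝ≥0∞} (hp : 1 ≤ p) {k : ℕ} (h : MemLp (Y k) p P) :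
    MemLp (condExpIncrement P F Y k) p P :=
  (h.condExp (m := F (k + 1)) hp).sub (h.condExp (m := F k) hp)

lemma eLpNorm_condExpIncrement_le {p : ℝ≥0∞} (hp : 1 ≤ p) (hle : ∀ k, F k ≤ mΩ) (k : ℕ) :
    eLpNorm (condExpIncrement P F Y k) p P ≤ 2 * eLpNorm (Y k) p P := by
  have h : eLpNorm (P[Y k | F (k + 1)] - P[Y k | F k]) p P ≤ _ :=
    eLpNorm_sub_le (stronglyMeasurable_condExp.mono (hle (k + 1))).aestronglyMeasurable
      (stronglyMeasurable_condExp.mono (hle k)).aestronglyMeasurable hp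
  refine h.trans ?_
  rw [two_mul]
  exact add_le_add (eLpNorm_condExp_le_eLpNorm _ hp) (eLpNorm_condExp_le_eLpNorm _ hp)

lemma ae_abs_condExpIncrement_le {b : ℝ} {k : ℕ} (h : ∀ᵐ ω ∂P, |Y k ω| ≤ b) :
    ∀ᵐ ω ∂P, |condExpIncrement P F Y k ω| ≤ 2 * b := by
  filter_upwards [ae_bdd_abs_condExp_of_ae_bdd_abs (m := F (k + 1)) h,
    ae_bdd_abs_condExp_of_ae_bdd_abs (m := F k) h] with ω h1 h2
  unfold condExpIncrement
  rw [two_mul]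
  exact (abs_sub _ _).trans (add_le_add h1 h2)

variable [IsProbabilityMeasure P]

lemma isMartingaleDiff_condExpIncrement (hF : Monotone F) (hle : ∀ k, F k ≤ mΩ)
    (Y : ℕ → Ω → ℝ) : IsMartingaleDiff P F (condExpIncrement P F Y) where
  mono := hF
  le := hle
  stronglyMeasurable k :=
    stronglyMeasurable_condExp.sub (stronglyMeasurable_condExp.mono (hF (Nat.le_succ k)))
  integrable k := integrable_condExp.sub integrable_condExp
  condExp_eq_zero k := by
    have h1 : P[P[Y k | F (k + 1)] - P[Y k | F k] | F k] =ᵐ[P] _ :=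
      condExp_sub integrable_condExp integrable_condExp (F k)
    have h2 := condExp_condExp_of_le (μ := P) (f := Y k) (hF (Nat.le_succ k)) (hle (k + 1))
    have h3 := condExp_condExp_of_le (μ := P) (f := Y k) (le_refl (F k)) (hle k)
    filter_upwards [h1, h2, h3] with ω a b c
    change (P[P[Y k | F (k + 1)] - P[Y k | F k] | F k]) ω = 0
    rw [a, Pi.sub_apply, b, c, sub_self]

namespace IncrementControl

-- Since `X - Y k` has the same projection on `F k` and on `F (k + 1)`, the increments of the
-- martingales closed by `X` and by `Y k` coincide. They telescope from `𝔼 X` to `X`.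
omit [IsProbabilityMeasure P] in
lemma sum_condExpIncrement (h : IncrementControl P F X Y n) :
    (fun ω => ∑ k ∈ Finset.range n, condExpIncrement P F Y k ω) =ᵐ[P]
      fun ω => X ω - ∫ ω, X ω ∂P := by
  have h1 : ∀ k, ∀ᵐ ω ∂P, condExpIncrement P F Y k ω =
      (P[X | F (k + 1)]) ω - (P[X | F k]) ω := by
    intro k
    filter_upwards [condExp_sub h.integrable (h.integrable_error k) (F (k + 1)),
      condExp_sub h.integrable (h.integrable_error k) (F k), h.condExp_sub_error k] with ω a b c
    rw [a, b] at c
    simp only [Pi.sub_apply] at c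
    unfold condExpIncrement
    linarith
  filter_upwards [ae_all_iff.2 h1, h.condExp_zero, h.condExp_last] with ω a b c
  rw [Finset.sum_congr rfl fun k _ => a k, Finset.sum_range_sub (fun k => (P[X | F k]) ω), b, c]

omit [IsProbabilityMeasure P] in
lemma measure_congr_sum (h : IncrementControl P F X Y n) (A : ℝ) :
    P.real {ω | A ≤ |X ω - ∫ ω, X ω ∂P|} =
      P.real {ω | A ≤ |∑ k ∈ Finset.range n, condExpIncrement P F Y k ω|} := by
  refine measureReal_congr ?_
  filter_upwards [h.sum_condExpIncrement] with ω hω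
  apply propext
  change A ≤ |X ω - ∫ ω, X ω ∂P| ↔ A ≤ |∑ k ∈ Finset.range n, condExpIncrement P F Y k ω|
  rw [hω]

/-- Concentration with bounded errors. -/
lemma measure_ge_le_of_bounded (h : IncrementControl P F X Y n) {b : ℝ} (hb : 0 < b)
    (hY : ∀ k, ∀ᵐ ω ∂P, |Y k ω| ≤ b) {A : ℝ} (hA : 0 ≤ A) :
    P.real {ω | A ≤ |X ω - ∫ ω, X ω ∂P|} ≤ 2 * Real.exp (-A ^ 2 / (2 * n * (2 * b) ^ 2)) := by
  rw [h.measure_congr_sum]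
  exact (isMartingaleDiff_condExpIncrement h.mono h.le Y).measure_abs_sum_ge_le (by linarith)
    (fun k => ae_abs_condExpIncrement_le (hY k)) n hA

/-- Concentration with errors bounded in `L^p`. -/
lemma measure_ge_le_of_moment (h : IncrementControl P F X Y n) {p b : ℝ} (hp : 2 ≤ p)
    (hb : 0 ≤ b) (hY : ∀ k, eLpNorm (Y k) (ENNReal.ofReal p) P ≤ ENNReal.ofReal b)
    (hn : 0 < n) {A : ℝ} (hA : 0 < A) :
    P.real {ω | A ≤ |X ω - ∫ ω, X ω ∂P|} ≤
      2 * rpowTaylorConst p * Real.exp (rpowTaylorConst p) * (n : ℝ) ^ (p / 2) * (2 * b) ^ p /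
        A ^ p := by
  rw [h.measure_congr_sum]
  have hp0 : 0 < p := by linarith
  have hp1 : 1 ≤ ENNReal.ofReal p := ENNReal.one_le_ofReal.2 (by linarith)
  have hM := isMartingaleDiff_condExpIncrement (P := P) h.mono h.le Y
  have hL : ∀ k, MemLp (condExpIncrement P F Y k) (ENNReal.ofReal p) P := fun k =>
    memLp_condExpIncrement hp1 ⟨(h.integrable_error k).aestronglyMeasurable,
      (hY k).trans_lt ENNReal.ofReal_lt_top⟩
  have hB : ∀ k, ∫ ω, |condExpIncrement P F Y k ω| ^ p ∂P ≤ (2 * b) ^ p := by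
    intro k
    have h1 : eLpNorm (condExpIncrement P F Y k) (ENNReal.ofReal p) P ≤ ENNReal.ofReal (2 * b) := by
      refine (eLpNorm_condExpIncrement_le hp1 h.le k).trans ?_
      rw [ENNReal.ofReal_mul (by norm_num)]
      gcongr
      · simp
      · exact hY k
    rw [(hL k).eLpNorm_eq_integral_rpow_norm (by simpa using hp0) ENNReal.ofReal_ne_top,
      ENNReal.toReal_ofReal hp0.le, ENNReal.ofReal_le_ofReal_iff (by linarith)] at h1
    have h2 := Real.rpow_le_rpow (Real.rpow_nonneg (integral_nonneg fun ω => by positivity) _)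
      h1 hp0.le
    rwa [← Real.rpow_mul (integral_nonneg fun ω => by positivity), inv_mul_cancel₀ hp0.ne',
      Real.rpow_one] at h2
  have hmain := hM.integral_abs_sum_rpow_le hp hL hB hn
  set S := fun ω => ∑ k ∈ Finset.range n, condExpIncrement P F Y k ω
  have hS : MemLp S (ENNReal.ofReal p) P := hM.memLp_sum hL n
  have hint : Integrable (fun ω => |S ω| ^ p) P := by
    have := hS.integrable_norm_rpow (by simpa using hp0) ENNReal.ofReal_ne_top
    simpa [ENNReal.toReal_ofReal hp0.le] using this
  have hmk := mul_meas_ge_le_integral_of_nonneg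
    (Filter.Eventually.of_forall fun ω => by positivity) hint (A ^ p)
  have hset : {ω | A ≤ |S ω|} = {ω | A ^ p ≤ |S ω| ^ p} := by
    ext ω
    exact (Real.rpow_le_rpow_iff hA.le (abs_nonneg _) hp0).symm
  change P.real {ω | A ≤ |S ω|} ≤ _
  rw [hset, le_div_iff₀ (by positivity), mul_comm]
  exact hmk.trans hmain

/-- Concentration by truncation of the errors. -/
lemma measure_ge_le_of_truncation (h : IncrementControl P F X Y n) {a δ : ℝ} (ha : 0 < a)
    (hY : ∀ k, ∫ ω, {ω | a < |Y k ω|}.indicator (fun ω => |Y k ω|) ω ∂P ≤ δ)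
    {A : ℝ} (hA : 0 < A) :
    P.real {ω | A ≤ |X ω - ∫ ω, X ω ∂P|} ≤
      2 * Real.exp (-(A / 2) ^ 2 / (2 * n * (2 * a) ^ 2)) + 2 / A * (n * (2 * δ)) := by
  rw [h.measure_congr_sum]
  classical
  -- Each error is cut at level `a`, and each part has its own martingale increments. The bounded
  -- part must account for `A / 2` and is handled by Azuma–Hoeffding; for the large part, summing
  -- absolute values and applying Markov's inequality is enough.
  let Y₁ : ℕ → Ω → ℝ := fun k ω => if a < |Y k ω| then 0 else Y k ω
  let Y₂ : ℕ → Ω → ℝ := fun k ω => if a < |Y k ω| then Y k ω else 0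
  have hmeas : ∀ k, NullMeasurableSet {ω | a < |Y k ω|} P := fun k =>
    nullMeasurableSet_lt aemeasurable_const
      (continuous_abs.comp_aestronglyMeasurable (h.integrable_error k).1).aemeasurable
  have hi₂ : ∀ k, Integrable (Y₂ k) P := by
    intro k
    have : Y₂ k = {ω | a < |Y k ω|}.indicator (Y k) := by
      ext ω; simp [Y₂, indicator]
    rw [this]
    exact (h.integrable_error k).indicator₀ (hmeas k)
  have hsum : ∀ k, Y k = Y₁ k + Y₂ k := by
    intro k; ext ω
    by_cases hω : a < |Y k ω| <;> simp [Y₁, Y₂, hω]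
  have hi₁ : ∀ k, Integrable (Y₁ k) P := by
    intro k
    have : Y₁ k = Y k - Y₂ k := by rw [hsum k]; simp
    rw [this]
    exact (h.integrable_error k).sub (hi₂ k)
  have hb₁ : ∀ k, ∀ᵐ ω ∂P, |Y₁ k ω| ≤ a := by
    intro k
    refine Filter.Eventually.of_forall fun ω => ?_
    by_cases hω : a < |Y k ω|
    · simp [Y₁, hω, ha.le]
    · simpa [Y₁, hω] using not_lt.1 hω
  have hsplit : ∀ k, ∀ᵐ ω ∂P, condExpIncrement P F Y k ω =
      condExpIncrement P F Y₁ k ω + condExpIncrement P F Y₂ k ω := by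
    intro k
    filter_upwards [condExp_add (hi₁ k) (hi₂ k) (F (k + 1)), condExp_add (hi₁ k) (hi₂ k) (F k)]
      with ω h1 h2
    unfold condExpIncrement
    rw [hsum k, h1, h2]
    simp only [Pi.add_apply]
    ring
  have hM₁ := isMartingaleDiff_condExpIncrement (P := P) h.mono h.le Y₁
  have hM₂ := isMartingaleDiff_condExpIncrement (P := P) h.mono h.le Y₂
  have hP₁ := hM₁.measure_abs_sum_ge_le (b := 2 * a) (by linarith)
    (fun k => ae_abs_condExpIncrement_le (hb₁ k)) n (A := A / 2) (by linarith)
  set S₂ := fun ω => ∑ k ∈ Finset.range n, |condExpIncrement P F Y₂ k ω|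
  have hiS : Integrable S₂ P := integrable_finsetSum _ fun k _ => (hM₂.integrable k).abs
  have hS₂ : ∫ ω, S₂ ω ∂P ≤ n * (2 * δ) := by
    rw [integral_finsetSum _ fun k _ => (hM₂.integrable k).abs]
    calc _ ≤ ∑ k ∈ Finset.range n, 2 * δ := Finset.sum_le_sum fun k _ => ?_
      _ = n * (2 * δ) := by simp
    have hY₂ : ∫ ω, |Y₂ k ω| ∂P ≤ δ := by
      refine le_trans (le_of_eq (integral_congr_ae (Filter.Eventually.of_forall fun ω => ?_))) (hY k)
      by_cases hω : a < |Y k ω| <;> simp [Y₂, indicator, hω]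
    calc ∫ ω, |condExpIncrement P F Y₂ k ω| ∂P
        ≤ ∫ ω, (|(P[Y₂ k | F (k + 1)]) ω| + |(P[Y₂ k | F k]) ω|) ∂P :=
          integral_mono (hM₂.integrable k).abs (integrable_condExp.abs.add integrable_condExp.abs)
            fun ω => abs_sub _ _
      _ = ∫ ω, |(P[Y₂ k | F (k + 1)]) ω| ∂P + ∫ ω, |(P[Y₂ k | F k]) ω| ∂P :=
          integral_add integrable_condExp.abs integrable_condExp.abs
      _ ≤ ∫ ω, |Y₂ k ω| ∂P + ∫ ω, |Y₂ k ω| ∂P :=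
          add_le_add (integral_abs_condExp_le _) (integral_abs_condExp_le _)
      _ ≤ 2 * δ := by linarith
  have hP₂ : P.real {ω | A / 2 ≤ S₂ ω} ≤ 2 / A * (n * (2 * δ)) := by
    have := mul_meas_ge_le_integral_of_nonneg
      (Filter.Eventually.of_forall fun ω => Finset.sum_nonneg fun k _ => abs_nonneg _) hiS (A / 2)
    have h1 : A / 2 * P.real {ω | A / 2 ≤ S₂ ω} ≤ n * (2 * δ) := this.trans hS₂
    calc P.real {ω | A / 2 ≤ S₂ ω} = 2 / A * (A / 2 * P.real {ω | A / 2 ≤ S₂ ω}) := by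
          field_simp
      _ ≤ _ := by gcongr
  refine le_trans ?_ (add_le_add hP₁ hP₂)
  refine le_trans ?_ (measureReal_union_le _ _)
  refine ENNReal.toReal_mono (measure_ne_top _ _) (measure_mono_ae ?_)
  filter_upwards [ae_all_iff.2 hsplit] with ω hω hA'
  change A ≤ |∑ k ∈ Finset.range n, condExpIncrement P F Y k ω| at hA'
  rw [Finset.sum_congr rfl fun k _ => hω k, Finset.sum_add_distrib] at hA'
  by_contra hcon
  have hcon' : ¬ (A / 2 ≤ |∑ k ∈ Finset.range n, condExpIncrement P F Y₁ k ω| ∨ A / 2 ≤ S₂ ω) :=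
    hcon
  push Not at hcon'
  have h1 := abs_add_le (∑ k ∈ Finset.range n, condExpIncrement P F Y₁ k ω)
    (∑ k ∈ Finset.range n, condExpIncrement P F Y₂ k ω)
  have h2 : |∑ k ∈ Finset.range n, condExpIncrement P F Y₂ k ω| ≤ S₂ ω :=
    Finset.abs_sum_le_sum_abs _ _
  linarith [hcon'.1, hcon'.2]

end IncrementControl

end LocalApproximation

/-! ### Conditional expectation with an independent argument. -/

section IndependentArgument

variable {Ω α β : Type*} {F F' G : MeasurableSpace Ω} [mΩ : MeasurableSpace Ω]
  [MeasurableSpace α] [MeasurableSpace β] {P : Measure Ω} [IsProbabilityMeasure P]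

/-- Conditional expectation of a function of an `F`-measurable variable `a` and a variable `b`
independent of `F`: the variable `b` is integrated out. -/
lemma condExp_comp_eq_integral (hF : F ≤ mΩ) (hG : G ≤ mΩ) (hFG : Indep F G P)
    {a : Ω → α} {b : Ω → β} (ha : Measurable[F] a) (hb : Measurable[G] b)
    {f : α × β → ℝ} (hf : Measurable f) (hi : Integrable (fun ω => f (a ω, b ω)) P) :
    P[fun ω => f (a ω, b ω) | F] =ᵐ[P] fun ω => ∫ y, f (a ω, y) ∂(P.map b) := by
  have ha' : Measurable a := ha.mono hF le_rfl
  have hb' : Measurable b := hb.mono hG le_rfl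
  have : IsProbabilityMeasure (P.map b) := Measure.isProbabilityMeasure_map hb'.aemeasurable
  have : IsProbabilityMeasure (P.map a) := Measure.isProbabilityMeasure_map ha'.aemeasurable
  have hind : ∀ {γ : Type _} [MeasurableSpace γ] {a' : Ω → γ}, Measurable[F] a' →
      P.map (fun ω => (a' ω, b ω)) = (P.map a').prod (P.map b) := by
    intro γ _ a' hm
    rw [← indepFun_iff_map_prod_eq_prod_map_map (hm.mono hF le_rfl).aemeasurable hb'.aemeasurable,
      IndepFun_iff_Indep]
    exact indep_of_indep_of_le_left (indep_of_indep_of_le_right hFG hb.comap_le) hm.comap_le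
  have hh : StronglyMeasurable fun x => ∫ y, f (x, y) ∂(P.map b) :=
    hf.stronglyMeasurable.integral_prod_right'
  have hiprod : Integrable f ((P.map a).prod (P.map b)) := by
    rw [← hind ha]
    exact (integrable_map_measure hf.aestronglyMeasurable
      (ha'.prodMk hb').aemeasurable).2 hi
  have hih : Integrable (fun ω => ∫ y, f (a ω, y) ∂(P.map b)) P :=
    (integrable_map_measure hh.aestronglyMeasurable ha'.aemeasurable).1 hiprod.integral_prod_left
  symm
  refine ae_eq_condExp_of_forall_setIntegral_eq hF hi (fun s _ _ => hih.integrableOn) ?_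
    (hh.comp_measurable ha).aestronglyMeasurable
  intro s hs _
  -- To test against `s ∈ F`, carry its indicator along with `a`: the pair is still `F`-measurable,
  -- so its joint law with `b` is a product and Fubini applies.
  let a' : Ω → ℝ × α := fun ω => (s.indicator 1 ω, a ω)
  have hm : Measurable[F] a' :=
    Measurable.prodMk ((measurable_const (a := (1 : ℝ))).indicator hs) ha
  have hm' : Measurable a' := hm.mono hF le_rfl
  have : IsProbabilityMeasure (P.map a') := Measure.isProbabilityMeasure_map hm'.aemeasurable
  have hk : Measurable fun z : (ℝ × α) × β => z.1.1 * f (z.1.2, z.2) := by fun_prop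
  have e1 : ∫ ω in s, f (a ω, b ω) ∂P = ∫ ω, (a' ω).1 * f ((a' ω).2, b ω) ∂P := by
    rw [← integral_indicator (hF s hs)]
    refine integral_congr_ae (Filter.Eventually.of_forall fun ω => ?_)
    by_cases hω : ω ∈ s <;> simp [a', hω]
  have e2 : ∫ ω in s, (∫ y, f (a ω, y) ∂(P.map b)) ∂P =
      ∫ ω, (a' ω).1 * (∫ y, f ((a' ω).2, y) ∂(P.map b)) ∂P := by
    rw [← integral_indicator (hF s hs)]
    refine integral_congr_ae (Filter.Eventually.of_forall fun ω => ?_)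
    by_cases hω : ω ∈ s <;> simp [a', hω]
  have hik : Integrable (fun z : (ℝ × α) × β => z.1.1 * f (z.1.2, z.2))
      ((P.map a').prod (P.map b)) := by
    rw [← hind hm, integrable_map_measure hk.aestronglyMeasurable
      (hm'.prodMk hb').aemeasurable]
    refine hi.mono (hk.comp (hm'.prodMk hb')).aestronglyMeasurable
      (Filter.Eventually.of_forall fun ω => ?_)
    by_cases hω : ω ∈ s <;> simp [a', hω]
  rw [e1, e2]
  have e3 : ∫ ω, (a' ω).1 * f ((a' ω).2, b ω) ∂P =
      ∫ z, z.1.1 * f (z.1.2, z.2) ∂(P.map fun ω => (a' ω, b ω)) :=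
    (integral_map (hm'.prodMk hb').aemeasurable hk.aestronglyMeasurable).symm
  have hmk : StronglyMeasurable fun x : ℝ × α => ∫ y, x.1 * f (x.2, y) ∂(P.map b) :=
    hk.stronglyMeasurable.integral_prod_right'
  rw [e3, hind hm, integral_prod _ hik, integral_map hm'.aemeasurable hmk.aestronglyMeasurable]
  simp_rw [integral_const_mul]

/-- Enlarging the conditioning `σ`-algebra does not change the conditional expectation of a
function of an `F'`-measurable variable and a variable independent of `F ≥ F'`. -/
lemma condExp_comp_eq_condExp (hF : F ≤ mΩ) (hG : G ≤ mΩ) (hF' : F' ≤ F) (hFG : Indep F G P)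
    {a : Ω → α} {b : Ω → β} (ha : Measurable[F'] a) (hb : Measurable[G] b)
    {f : α × β → ℝ} (hf : Measurable f) (hi : Integrable (fun ω => f (a ω, b ω)) P) :
    P[fun ω => f (a ω, b ω) | F] =ᵐ[P] P[fun ω => f (a ω, b ω) | F'] :=
  (condExp_comp_eq_integral hF hG hFG (ha.mono hF' le_rfl) hb hf hi).trans
    (condExp_comp_eq_integral (hF'.trans hF) hG (indep_of_indep_of_le_left hFG hF') ha hb hf
      hi).symm

end IndependentArgument

/-! ### Laws of time integrals from finite-dimensional laws. -/

section EqualMoments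

/-- Two bounded random variables with the same moments have the same law. -/
lemma map_eq_of_forall_integral_pow_eq {Ω : Type*} [MeasurableSpace Ω] {P : Measure Ω}
    [IsProbabilityMeasure P] {Z Z' : Ω → ℝ} (hZ : Measurable Z) (hZ' : Measurable Z') {M : ℝ}
    (hM : ∀ ω, Z ω ∈ Icc 0 M) (hM' : ∀ ω, Z' ω ∈ Icc 0 M)
    (h : ∀ j : ℕ, ∫ ω, Z ω ^ j ∂P = ∫ ω, Z' ω ^ j ∂P) : P.map Z = P.map Z' := by
  have : IsProbabilityMeasure (P.map Z) := Measure.isProbabilityMeasure_map hZ.aemeasurable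
  have : IsProbabilityMeasure (P.map Z') := Measure.isProbabilityMeasure_map hZ'.aemeasurable
  have hib : ∀ {W : Ω → ℝ}, Measurable W → (∀ ω, W ω ∈ Icc 0 M) → ∀ f : ℝ → ℝ, Continuous f →
      Integrable (fun ω => f (W ω)) P := by
    intro W hW hWM f hf
    obtain ⟨C, hC⟩ := isCompact_Icc.exists_bound_of_continuousOn (s := Icc 0 M) hf.continuousOn
    exact Integrable.of_bound (hf.measurable.comp hW).aestronglyMeasurable C
      (Filter.Eventually.of_forall fun ω => hC _ (hWM ω))
  have hpoly : ∀ p : Polynomial ℝ, ∫ ω, p.eval (Z ω) ∂P = ∫ ω, p.eval (Z' ω) ∂P := by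
    intro p
    simp_rw [Polynomial.eval_eq_sum_range]
    rw [integral_finsetSum _ fun i _ => hib hZ hM (fun x => p.coeff i * x ^ i) (by fun_prop),
      integral_finsetSum _ fun i _ => hib hZ' hM' (fun x => p.coeff i * x ^ i) (by fun_prop)]
    simp_rw [integral_const_mul, h]
  refine ext_of_forall_integral_eq_of_IsFiniteMeasure fun f => ?_
  rw [integral_map hZ.aemeasurable f.continuous.aestronglyMeasurable,
    integral_map hZ'.aemeasurable f.continuous.aestronglyMeasurable]
  refine eq_of_forall_dist_le fun ε hε => ?_
  -- Weierstrass approximation on `[0, M]`: equal moments give equal integrals of polynomials, hence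
  -- of bounded continuous functions.
  obtain ⟨p, hp⟩ := exists_polynomial_near_of_continuousOn 0 M f f.continuous.continuousOn
    (ε / 2) (by linarith)
  have hclose : ∀ {W : Ω → ℝ}, Measurable W → (∀ ω, W ω ∈ Icc 0 M) →
      |∫ ω, p.eval (W ω) ∂P - ∫ ω, f (W ω) ∂P| ≤ ε / 2 := by
    intro W hW hWM
    rw [← integral_sub (hib hW hWM (fun x => p.eval x) p.continuous) (hib hW hWM f f.continuous)]
    have := norm_integral_le_of_norm_le_const (μ := P) (C := ε / 2)
      (f := fun ω => p.eval (W ω) - f (W ω))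
      (Filter.Eventually.of_forall fun ω => (hp _ (hWM ω)).le)
    simpa using this
  have h1 := abs_le.1 (hclose hZ hM)
  have h2 := abs_le.1 (hclose hZ' hM')
  rw [hpoly p] at h1
  rw [Real.dist_eq, abs_le]
  constructor <;> linarith [h1.1, h1.2, h2.1, h2.2]

/-- Powers of the time integral of a bounded process, as multiple integrals. -/
lemma integral_integral_pow_eq {Ω : Type*} [MeasurableSpace Ω] {P : Measure Ω}
    [IsProbabilityMeasure P] {μ : Measure ℝ} [IsProbabilityMeasure μ] {f : ℝ → Ω → ℝ}
    (hf : Measurable (Function.uncurry f)) {M : ℝ} (hM : ∀ r ω, |f r ω| ≤ M) (j : ℕ) :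
    ∫ ω, (∫ r, f r ω ∂μ) ^ j ∂P =
      ∫ r : Fin j → ℝ, ∫ ω, ∏ i, f (r i) ω ∂P ∂(Measure.pi fun _ => μ) := by
  have h1 : ∀ ω, (∫ r, f r ω ∂μ) ^ j =
      ∫ r : Fin j → ℝ, ∏ i, f (r i) ω ∂(Measure.pi fun _ => μ) := by
    intro ω
    rw [integral_fintype_prod_eq_prod (fun _ => fun r => f r ω)]
    simp
  simp_rw [h1]
  rw [integral_integral_swap]
  refine Integrable.of_bound (C := M ^ j) ?_ (Filter.Eventually.of_forall fun z => ?_)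
  · refine (Finset.measurable_fun_prod _ fun i _ => ?_).aestronglyMeasurable
    exact hf.comp (f := fun z : Ω × (Fin j → ℝ) => (z.2 i, z.1)) (by fun_prop)
  · simp only [Function.uncurry, Real.norm_eq_abs, Finset.abs_prod]
    calc ∏ i : Fin j, |f (z.2 i) z.1| ≤ ∏ _i : Fin j, M :=
          Finset.prod_le_prod (fun _ _ => abs_nonneg _) fun i _ => hM _ _
      _ = M ^ j := by simp

/-- If the finite-dimensional laws of two measurable nonnegative processes agree, then so do the
laws of their time integrals. -/
lemma map_lintegral_eq_of_fdd {Ω : Type*} [MeasurableSpace Ω] {P : Measure Ω}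
    [IsProbabilityMeasure P] {μ : Measure ℝ} [IsProbabilityMeasure μ] {f g : ℝ → Ω → ℝ}
    (hf : Measurable (Function.uncurry f)) (hg : Measurable (Function.uncurry g))
    (hf0 : ∀ r ω, 0 ≤ f r ω) (hg0 : ∀ r ω, 0 ≤ g r ω)
    (h : ∀ (j : ℕ) (r : Fin j → ℝ), P.map (fun ω i => f (r i) ω) = P.map (fun ω i => g (r i) ω)) :
    P.map (fun ω => ∫⁻ r, ENNReal.ofReal (f r ω) ∂μ) =
      P.map (fun ω => ∫⁻ r, ENNReal.ofReal (g r ω) ∂μ) := by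
  have hmeas : ∀ {f : ℝ → Ω → ℝ}, Measurable (Function.uncurry f) →
      Measurable fun ω => ∫⁻ r, ENNReal.ofReal (f r ω) ∂μ := fun {f} hf =>
    Measurable.lintegral_prod_left' (f := fun z : ℝ × Ω => ENNReal.ofReal (f z.1 z.2))
      hf.ennreal_ofReal
  have htr : ∀ {f : ℝ → Ω → ℝ}, Measurable (Function.uncurry f) → ∀ M : ℕ,
      Measurable (Function.uncurry fun r ω => min (f r ω) M) := fun hf M => hf.min measurable_const
  have hsm : ∀ {f : ℝ → Ω → ℝ}, Measurable (Function.uncurry f) →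
      Measurable fun ω => ∫ r, f r ω ∂μ := fun {f} hf =>
    (hf.stronglyMeasurable.integral_prod_left' (μ := μ)).measurable
  have hb : ∀ {f : ℝ → Ω → ℝ}, (∀ r ω, 0 ≤ f r ω) → ∀ (M : ℕ) r ω, |min (f r ω) M| ≤ M := by
    intro f hf M r ω
    rw [abs_of_nonneg (le_min (hf r ω) (Nat.cast_nonneg M))]
    exact min_le_right _ _
  -- After truncation at `M` the time integrals are bounded, so their laws are determined by
  -- moments, and the `j`-th moment is an average of `j`-point functions of the process.
  have hmap : ∀ M : ℕ, P.map (fun ω => ∫ r, min (f r ω) M ∂μ) =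
      P.map (fun ω => ∫ r, min (g r ω) M ∂μ) := by
    intro M
    have hmem : ∀ {f : ℝ → Ω → ℝ}, (∀ r ω, 0 ≤ f r ω) → ∀ ω, ∫ r, min (f r ω) M ∂μ ∈ Icc (0 : ℝ) M := by
      intro f hf ω
      refine ⟨integral_nonneg fun r => le_min (hf r ω) (Nat.cast_nonneg M), ?_⟩
      have := norm_integral_le_of_norm_le_const (μ := μ) (C := M) (f := fun r => min (f r ω) M)
        (Filter.Eventually.of_forall fun r => hb hf M r ω)
      simp only [probReal_univ, mul_one] at this
      exact (le_abs_self _).trans this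
    refine map_eq_of_forall_integral_pow_eq (M := M) (hsm (htr hf M)) (hsm (htr hg M))
      (hmem hf0) (hmem hg0) fun j => ?_
    rw [integral_integral_pow_eq (htr hf M) (hb hf0 M), integral_integral_pow_eq (htr hg M)
      (hb hg0 M)]
    congr 1 with r
    have hk : Measurable fun x : Fin j → ℝ => ∏ i, min (x i) (M : ℝ) := by fun_prop
    have hfr : Measurable fun ω (i : Fin j) => f (r i) ω :=
      measurable_pi_lambda _ fun i => hf.of_uncurry_left
    have hgr : Measurable fun ω (i : Fin j) => g (r i) ω :=
      measurable_pi_lambda _ fun i => hg.of_uncurry_left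
    have e := h j r
    calc ∫ ω, ∏ i, min (f (r i) ω) (M : ℝ) ∂P
        = ∫ x, ∏ i, min (x i) (M : ℝ) ∂(P.map fun ω i => f (r i) ω) :=
          (integral_map hfr.aemeasurable hk.aestronglyMeasurable).symm
      _ = ∫ x, ∏ i, min (x i) (M : ℝ) ∂(P.map fun ω i => g (r i) ω) := by rw [e]
      _ = _ := integral_map hgr.aemeasurable hk.aestronglyMeasurable
  have hmapE : ∀ M : ℕ, P.map (fun ω => ∫⁻ r, ENNReal.ofReal (min (f r ω) M) ∂μ) =
      P.map (fun ω => ∫⁻ r, ENNReal.ofReal (min (g r ω) M) ∂μ) := by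
    intro M
    have key : ∀ {f : ℝ → Ω → ℝ}, Measurable (Function.uncurry f) → (∀ r ω, 0 ≤ f r ω) →
        P.map (fun ω => ∫⁻ r, ENNReal.ofReal (min (f r ω) M) ∂μ) =
          (P.map (fun ω => ∫ r, min (f r ω) M ∂μ)).map ENNReal.ofReal := by
      intro f hf hf0
      rw [Measure.map_map ENNReal.measurable_ofReal (hsm (htr hf M))]
      congr 1 with ω
      refine (ofReal_integral_eq_lintegral_ofReal ?_ ?_).symm
      · exact Integrable.of_bound (htr hf M).of_uncurry_right.aestronglyMeasurable M
          (Filter.Eventually.of_forall fun r => hb hf0 M r ω)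
      · exact Filter.Eventually.of_forall fun r => le_min (hf0 r ω) (Nat.cast_nonneg M)
    rw [key hf hf0, key hg hg0, hmap M]
  -- The truncated integrals increase to the full one, so the events that they are at most `a`
  -- decrease to the corresponding event for the full integral.
  have hlim : ∀ {f : ℝ → Ω → ℝ}, Measurable (Function.uncurry f) → ∀ a : ℝ≥0∞,
      P.map (fun ω => ∫⁻ r, ENNReal.ofReal (f r ω) ∂μ) (Iic a) =
        ⨅ M : ℕ, P.map (fun ω => ∫⁻ r, ENNReal.ofReal (min (f r ω) M) ∂μ) (Iic a) := by
    intro f hf a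
    have hsup : ∀ ω, ∫⁻ r, ENNReal.ofReal (f r ω) ∂μ =
        ⨆ M : ℕ, ∫⁻ r, ENNReal.ofReal (min (f r ω) M) ∂μ := by
      intro ω
      rw [← lintegral_iSup]
      · congr 1 with r
        refine le_antisymm ?_ (iSup_le fun M => ENNReal.ofReal_le_ofReal (min_le_left _ _))
        obtain ⟨M, hM⟩ := exists_nat_ge (f r ω)
        exact le_iSup_of_le M (by rw [min_eq_left hM])
      · exact fun M => (htr hf M).of_uncurry_right.ennreal_ofReal
      · intro M N hMN r
        exact ENNReal.ofReal_le_ofReal (min_le_min_left _ (by exact_mod_cast hMN))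
    rw [Measure.map_apply (hmeas hf) measurableSet_Iic]
    have hset : (fun ω => ∫⁻ r, ENNReal.ofReal (f r ω) ∂μ) ⁻¹' Iic a =
        ⋂ M : ℕ, (fun ω => ∫⁻ r, ENNReal.ofReal (min (f r ω) M) ∂μ) ⁻¹' Iic a := by
      ext ω
      simp only [mem_preimage, mem_Iic, mem_iInter, hsup ω, iSup_le_iff]
    rw [hset, Antitone.measure_iInter]
    · congr 1 with M
      rw [Measure.map_apply (hmeas (htr hf M)) measurableSet_Iic]
    · intro M N hMN ω hω
      change _ ≤ a at hω
      change _ ≤ a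
      refine le_trans ?_ hω
      exact lintegral_mono fun r =>
        ENNReal.ofReal_le_ofReal (min_le_min_left _ (by exact_mod_cast hMN))
    · exact fun M => ((hmeas (htr hf M)) measurableSet_Iic).nullMeasurableSet
    · exact ⟨0, measure_ne_top _ _⟩
  have : IsProbabilityMeasure (P.map fun ω => ∫⁻ r, ENNReal.ofReal (f r ω) ∂μ) :=
    Measure.isProbabilityMeasure_map (hmeas hf).aemeasurable
  refine Measure.ext_of_Iic _ _ fun a => ?_
  rw [hlim hf, hlim hg]
  simp_rw [hmapE]

end EqualMoments

/-! ### The action as a functional of the velocity in `L^q`. -/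

section Action

open Filter Topology

variable {d : ℕ} {q N T : ℝ}

/-- A continuous Lagrangian with growth of order `q` in the velocity, up to a time-dependent
integrable error. -/
structure GrowthLagrangian (q N T : ℝ) (𝓛 : Spc d → ℝ → Spc d → ℝ) (n : ℝ → ℝ) : Prop where
  pos : 0 < N
  continuous : Continuous fun z : Spc d × ℝ × Spc d => 𝓛 z.1 z.2.1 z.2.2
  lower : ∀ x t v, 1 / N * ‖v‖ ^ q - n t ≤ 𝓛 x t v
  upper : ∀ x t v, 𝓛 x t v ≤ N * ‖v‖ ^ q + n t
  integrable : IntegrableOn n (Ioc 0 T)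

/-- The curve started from the origin with velocity `u`. -/
noncomputable def primitive (u : ℝ → Spc d) (s : ℝ) : Spc d := ∫ r in (0 : ℝ)..s, u r

/-- The action on `(0, T]` of the curve started from the origin with velocity `u`. -/
noncomputable def pathAction (T : ℝ) (𝓛 : Spc d → ℝ → Spc d → ℝ) (u : ℝ → Spc d) : ℝ :=
  ∫ s in Ioc 0 T, 𝓛 (primitive u s) s (u s)

/-- Velocities of class `L^q` of the curves from `(0, 0)` to `(x, T)`. -/
structure IsVelocity (q T : ℝ) (x : Spc d) (u : ℝ → Spc d) : Prop where
  measurable : Measurable u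
  memLp : MemLp u (ENNReal.ofReal q) (volume.restrict (Ioc 0 T))
  primitive_eq : primitive u T = x

namespace IsVelocity

variable {x : Spc d} {u : ℝ → Spc d}

lemma integrableOn (h : IsVelocity q T x u) (hq : 1 < q) : IntegrableOn u (Ioc 0 T) :=
  h.memLp.integrable (ENNReal.one_le_ofReal.2 hq.le)

lemma intervalIntegrable (h : IsVelocity q T x u) (hq : 1 < q) (hT : 0 < T) :
    IntervalIntegrable u volume 0 T :=
  (intervalIntegrable_iff_integrableOn_Ioc_of_le hT.le).2 (h.integrableOn hq)

lemma integrableOn_rpow (h : IsVelocity q T x u) (hq : 1 < q) :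
    IntegrableOn (fun s => ‖u s‖ ^ q) (Ioc 0 T) := by
  have := h.memLp.integrable_norm_rpow (by simpa using by linarith) ENNReal.ofReal_ne_top
  rwa [ENNReal.toReal_ofReal (by linarith)] at this

lemma continuousOn_primitive (h : IsVelocity q T x u) (hq : 1 < q) (hT : 0 < T) :
    ContinuousOn (primitive u) (Icc 0 T) := by
  have := intervalIntegral.continuousOn_primitive_interval (a := 0) (b := T) (μ := volume)
    (f := u) (by rw [uIcc_of_le hT.le, integrableOn_Icc_iff_integrableOn_Ioc]; exact h.integrableOn hq)
  rwa [uIcc_of_le hT.le] at this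

lemma aestronglyMeasurable_primitive (h : IsVelocity q T x u) (hq : 1 < q) (hT : 0 < T) :
    AEStronglyMeasurable (primitive u) (volume.restrict (Ioc 0 T)) :=
  ((h.continuousOn_primitive hq hT).mono Ioc_subset_Icc_self).aestronglyMeasurable
    measurableSet_Ioc

end IsVelocity

namespace GrowthLagrangian

variable {𝓛 : Spc d → ℝ → Spc d → ℝ} {n : ℝ → ℝ} {x : Spc d} {u : ℝ → Spc d}

lemma abs_lagrangian_le (h : GrowthLagrangian q N T 𝓛 n) (x : Spc d) (t : ℝ) (v : Spc d) :
    |𝓛 x t v| ≤ N * ‖v‖ ^ q + n t := by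
  have h1 := h.lower x t v
  have h2 := h.pos
  have h3 : 0 ≤ 1 / N * ‖v‖ ^ q := by positivity
  have h4 : 0 ≤ N * ‖v‖ ^ q := by positivity
  exact abs_le.2 ⟨by linarith, h.upper x t v⟩

lemma aestronglyMeasurable (h : GrowthLagrangian q N T 𝓛 n) {γ v : ℝ → Spc d} {μ : Measure ℝ}
    (hγ : AEStronglyMeasurable γ μ) (hv : AEStronglyMeasurable v μ) :
    AEStronglyMeasurable (fun s => 𝓛 (γ s) s (v s)) μ :=
  h.continuous.comp_aestronglyMeasurable
    (hγ.prodMk (aestronglyMeasurable_id.prodMk hv))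

lemma integrableOn_bound (h : GrowthLagrangian q N T 𝓛 n) (hq : 1 < q) (hu : IsVelocity q T x u) :
    IntegrableOn (fun s => N * ‖u s‖ ^ q + n s) (Ioc 0 T) :=
  ((hu.integrableOn_rpow hq).const_mul N).add h.integrable

lemma integrableOn (h : GrowthLagrangian q N T 𝓛 n) (hq : 1 < q) (hT : 0 < T)
    (hu : IsVelocity q T x u) :
    IntegrableOn (fun s => 𝓛 (primitive u s) s (u s)) (Ioc 0 T) :=
  (h.integrableOn_bound hq hu).mono' (h.aestronglyMeasurable
    (hu.aestronglyMeasurable_primitive hq hT) hu.measurable.aestronglyMeasurable)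
    (Eventually.of_forall fun _ => h.abs_lagrangian_le _ _ _)

lemma neg_integral_le_pathAction (h : GrowthLagrangian q N T 𝓛 n) (hq : 1 < q) (hT : 0 < T)
    (hu : IsVelocity q T x u) : - ∫ s in Ioc 0 T, n s ≤ pathAction T 𝓛 u := by
  rw [← integral_neg]
  refine integral_mono h.integrable.neg (h.integrableOn hq hT hu) ?_
  intro s
  have h1 := h.lower (primitive u s) s (u s)
  have h2 := h.pos
  have h3 : 0 ≤ 1 / N * ‖u s‖ ^ q := by positivity
  linarith

end GrowthLagrangian

lemma tendsto_integral_norm_rpow {μ : Measure ℝ} [IsFiniteMeasure μ] (hq : 1 < q)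
    {u : ℕ → ℝ → Spc d} {v : ℝ → Spc d} (hu : ∀ i, MemLp (u i) (ENNReal.ofReal q) μ)
    (hv : MemLp v (ENNReal.ofReal q) μ)
    (h : Tendsto (fun i => eLpNorm (u i - v) (ENNReal.ofReal q) μ) atTop (𝓝 0)) :
    Tendsto (fun i => ∫ s, ‖u i s‖ ^ q ∂μ) atTop (𝓝 (∫ s, ‖v s‖ ^ q ∂μ)) := by
  have hq0 : 0 < q := by linarith
  have : Fact (1 ≤ ENNReal.ofReal q) := ⟨ENNReal.one_le_ofReal.2 hq.le⟩
  have h1 : Tendsto (fun i => (hu i).toLp (u i)) atTop (𝓝 (hv.toLp v)) :=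
    (Lp.tendsto_Lp_iff_tendsto_eLpNorm'' u hu v hv).2 h
  have h2 := (h1.norm).rpow_const (p := q) (Or.inr hq0.le)
  have key : ∀ {w : ℝ → Spc d} (hw : MemLp w (ENNReal.ofReal q) μ),
      ‖hw.toLp w‖ ^ q = ∫ s, ‖w s‖ ^ q ∂μ := by
    intro w hw
    rw [Lp.norm_toLp, hw.eLpNorm_eq_integral_rpow_norm (by simpa using hq0) ENNReal.ofReal_ne_top,
      ENNReal.toReal_ofReal hq0.le, ENNReal.toReal_ofReal
        (Real.rpow_nonneg (integral_nonneg fun ω => by positivity) _),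
      ← Real.rpow_mul (integral_nonneg fun ω => by positivity), inv_mul_cancel₀ hq0.ne',
      Real.rpow_one]
  simpa only [key] using h2

/-- Upper semicontinuity of the action along sequences of velocities converging in `L^q`. -/
lemma GrowthLagrangian.exists_pathAction_le {𝓛 : Spc d → ℝ → Spc d → ℝ} {n : ℝ → ℝ}
    (h : GrowthLagrangian q N T 𝓛 n) (hq : 1 < q) (hT : 0 < T) {x : Spc d}
    {u : ℕ → ℝ → Spc d} {v : ℝ → Spc d} (hu : ∀ i, IsVelocity q T x (u i))
    (hv : IsVelocity q T x v)
    (hlim : Tendsto (fun i => eLpNorm (u i - v) (ENNReal.ofReal q) (volume.restrict (Ioc 0 T)))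
      atTop (𝓝 0)) {ε : ℝ} (hε : 0 < ε) : ∃ i, pathAction T 𝓛 (u i) ≤ pathAction T 𝓛 v + ε := by
  set μ := volume.restrict (Ioc 0 T)
  have hq0 : 0 < q := by linarith
  have hq1 : 1 ≤ ENNReal.ofReal q := ENNReal.one_le_ofReal.2 hq.le
  by_contra! hcon
  -- Arguing by contradiction, the lower bound on the actions holds for all indices, so one may pass
  -- to a subsequence along which the velocities converge almost everywhere.
  obtain ⟨φ, hφ, hae⟩ := (tendstoInMeasure_of_tendsto_eLpNorm (μ := μ) (by simpa using hq0)
    (fun i => (hu i).memLp.1) hv.memLp.1 hlim).exists_seq_tendsto_ae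
  have hlim' : Tendsto (fun i => eLpNorm (u (φ i) - v) (ENNReal.ofReal q) μ) atTop (𝓝 0) :=
    hlim.comp hφ.tendsto_atTop
  have hL1 : Tendsto (fun i => eLpNorm (u (φ i) - v) 1 μ) atTop (𝓝 0) := by
    have hc : μ univ ^ (1 / (1 : ℝ≥0∞).toReal - 1 / (ENNReal.ofReal q).toReal) ≠ ∞ := by
      refine ENNReal.rpow_ne_top_of_nonneg ?_ (measure_ne_top _ _)
      rw [ENNReal.toReal_ofReal hq0.le]
      simp only [ENNReal.toReal_one, div_one, sub_nonneg]
      rw [div_le_one hq0]; exact hq.le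
    have := ENNReal.Tendsto.mul_const hlim' (Or.inr hc)
    rw [zero_mul] at this
    refine tendsto_of_tendsto_of_tendsto_of_le_of_le tendsto_const_nhds this (fun _ => zero_le)
      fun i => eLpNorm_le_eLpNorm_mul_rpow_measure_univ hq1 ((hu (φ i)).memLp.1.sub hv.memLp.1)
  have hprim : ∀ s ∈ Ioc 0 T, Tendsto (fun i => primitive (u (φ i)) s) atTop (𝓝 (primitive v s)) := by
    intro s hs
    have := tendsto_setIntegral_of_L1' (μ := μ) v (hv.integrableOn hq).1
      (Eventually.of_forall fun i => (hu (φ i)).integrableOn hq) hL1 (Ioc 0 s)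
    simp only [primitive, intervalIntegral.integral_of_le hs.1.le]
    simpa only [μ, Measure.restrict_restrict measurableSet_Ioc,
      inter_eq_left.2 (Ioc_subset_Ioc_right hs.2)] using this
  -- The gap in the upper growth bound is nonnegative. Fatou's lemma for it, with convergence of `∫
  -- ‖u‖ ^ q`, gives upper semicontinuity of the action.
  let g : (ℝ → Spc d) → ℝ → ℝ := fun w s => N * ‖w s‖ ^ q + n s - 𝓛 (primitive w s) s (w s)
  have hg0 : ∀ w s, 0 ≤ g w s := fun w s => sub_nonneg.2 (h.upper _ _ _)
  have hgi : ∀ {w}, IsVelocity q T x w → Integrable (g w) μ := fun hw =>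
    (h.integrableOn_bound hq hw).sub (h.integrableOn hq hT hw)
  have hgint : ∀ {w}, IsVelocity q T x w → ∫ s, g w s ∂μ =
      N * ∫ s, ‖w s‖ ^ q ∂μ + ∫ s, n s ∂μ - pathAction T 𝓛 w := by
    intro w hw
    have h1 : ∫ s, g w s ∂μ = ∫ s, (N * ‖w s‖ ^ q + n s) ∂μ - pathAction T 𝓛 w :=
      integral_sub (h.integrableOn_bound hq hw) (h.integrableOn hq hT hw)
    rw [h1, integral_add ((hw.integrableOn_rpow hq).const_mul N) h.integrable, integral_const_mul]
  have hgl : ∀ᵐ s ∂μ, Tendsto (fun i => g (u (φ i)) s) atTop (𝓝 (g v s)) := by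
    filter_upwards [hae, ae_restrict_mem measurableSet_Ioc] with s hs hsT
    refine (((hs.norm.rpow_const (Or.inr hq0.le)).const_mul N).add_const (n s)).sub ?_
    have := (h.continuous.tendsto (primitive v s, s, v s)).comp
      ((hprim s hsT).prodMk_nhds ((tendsto_const_nhds (x := s)).prodMk_nhds hs))
    exact this
  set β := pathAction T 𝓛 v + ε
  have hpow := (tendsto_integral_norm_rpow hq (fun i => (hu i).memLp) hv.memLp hlim).comp
    hφ.tendsto_atTop
  have hup : Tendsto (fun i => N * ∫ s, ‖u (φ i) s‖ ^ q ∂μ + ∫ s, n s ∂μ - β) atTop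
      (𝓝 (N * ∫ s, ‖v s‖ ^ q ∂μ + ∫ s, n s ∂μ - β)) :=
    ((hpow.const_mul N).add_const _).sub_const _
  have hle : ∀ i, ∫ s, g (u (φ i)) s ∂μ ≤ N * ∫ s, ‖u (φ i) s‖ ^ q ∂μ + ∫ s, n s ∂μ - β := by
    intro i
    rw [hgint (hu (φ i))]
    linarith [hcon (φ i)]
  have hnn : 0 ≤ N * ∫ s, ‖v s‖ ^ q ∂μ + ∫ s, n s ∂μ - β :=
    ge_of_tendsto' hup fun i => (integral_nonneg (hg0 _)).trans (hle i)
  have hfatou : ENNReal.ofReal (∫ s, g v s ∂μ) ≤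
      ENNReal.ofReal (N * ∫ s, ‖v s‖ ^ q ∂μ + ∫ s, n s ∂μ - β) := by
    rw [ofReal_integral_eq_lintegral_ofReal (hgi hv) (Eventually.of_forall (hg0 v))]
    calc ∫⁻ s, ENNReal.ofReal (g v s) ∂μ
        = ∫⁻ s, liminf (fun i => ENNReal.ofReal (g (u (φ i)) s)) atTop ∂μ := by
          refine lintegral_congr_ae ?_
          filter_upwards [hgl] with s hs
          exact ((ENNReal.continuous_ofReal.tendsto _).comp hs).liminf_eq.symm
      _ ≤ liminf (fun i => ∫⁻ s, ENNReal.ofReal (g (u (φ i)) s) ∂μ) atTop :=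
          lintegral_liminf_le' fun i => (hgi (hu (φ i))).1.aemeasurable.ennreal_ofReal
      _ ≤ liminf (fun i => ENNReal.ofReal
            (N * ∫ s, ‖u (φ i) s‖ ^ q ∂μ + ∫ s, n s ∂μ - β)) atTop := by
          refine liminf_le_liminf (Eventually.of_forall fun i => ?_)
          rw [← ofReal_integral_eq_lintegral_ofReal (hgi (hu (φ i))) (Eventually.of_forall (hg0 _))]
          exact ENNReal.ofReal_le_ofReal (hle i)
      _ = _ := ((ENNReal.continuous_ofReal.tendsto _).comp hup).liminf_eq
  rw [ENNReal.ofReal_le_ofReal_iff hnn, hgint hv] at hfatou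
  linarith

/-- There is a countable family of velocities that is dense in `L^q`. -/
lemma exists_dense_velocities (hq : 1 < q) (hT : 0 < T) (x : Spc d) :
    ∃ u : ℕ → ℝ → Spc d, (∀ i, IsVelocity q T x (u i)) ∧ ∀ v, IsVelocity q T x v →
      ∃ φ : ℕ → ℕ, Tendsto (fun i => eLpNorm (u (φ i) - v) (ENNReal.ofReal q)
        (volume.restrict (Ioc 0 T))) atTop (𝓝 0) := by
  set μ := volume.restrict (Ioc 0 T)
  have : Fact (1 ≤ ENNReal.ofReal q) := ⟨ENNReal.one_le_ofReal.2 hq.le⟩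
  have : Fact (ENNReal.ofReal q ≠ ∞) := ⟨ENNReal.ofReal_ne_top⟩
  -- Separability passes to subsets of `L^q`, so the dense sequence can be taken inside the endpoint
  -- constraint.
  let S : Set (Lp (Spc d) (ENNReal.ofReal q) μ) := {f | primitive f T = x}
  have hmk : ∀ {v : ℝ → Spc d} (hv : IsVelocity q T x v), hv.memLp.toLp v ∈ S := by
    intro v hv
    change primitive _ T = x
    refine Eq.trans ?_ hv.primitive_eq
    simp only [primitive, intervalIntegral.integral_of_le hT.le]
    exact integral_congr_ae hv.memLp.coeFn_toLp
  have hconst : IsVelocity q T x fun _ => T⁻¹ • x :=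
    ⟨measurable_const, memLp_const _, by simp [primitive, smul_smul, hT.ne']⟩
  have : Nonempty S := ⟨⟨_, hmk hconst⟩⟩
  obtain ⟨f, hf⟩ := TopologicalSpace.exists_dense_seq S
  refine ⟨fun i => f i, fun i => ⟨(Lp.stronglyMeasurable _).measurable, Lp.memLp _, (f i).2⟩, ?_⟩
  intro v hv
  have hcl := mem_closure_iff_seq_limit.1 (hf.closure_range ▸ mem_univ (⟨_, hmk hv⟩ : S))
  obtain ⟨w, hw, hwlim⟩ := hcl
  choose φ hφ using hw
  refine ⟨φ, ?_⟩
  have h1 : Tendsto (fun i => ((f (φ i) : S) : Lp (Spc d) (ENNReal.ofReal q) μ)) atTop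
      (𝓝 (hv.memLp.toLp v)) := by
    have := (continuous_subtype_val.tendsto _).comp hwlim
    refine this.congr fun i => ?_
    simp [← hφ i]
  rw [Lp.tendsto_Lp_iff_tendsto_eLpNorm'] at h1
  refine h1.congr fun i => eLpNorm_congr_ae ?_
  filter_upwards [hv.memLp.coeFn_toLp] with s hs
  simp [hs]

end Action

/-! ### Absolutely continuous curves and their velocities. -/

section Curves

open Filter Topology

variable {d : ℕ} {q N T : ℝ}

lemma AbsolutelyContinuousOnInterval.lipschitz_comp {X Y : Type*} [PseudoMetricSpace X]
    [PseudoMetricSpace Y] {f : ℝ → X} {a b : ℝ} (hf : AbsolutelyContinuousOnInterval f a b)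
    {g : X → Y} (hg : LipschitzWith 1 g) : AbsolutelyContinuousOnInterval (g ∘ f) a b := by
  refine squeeze_zero (fun E => Finset.sum_nonneg fun _ _ => dist_nonneg) (fun E => ?_) hf
  refine Finset.sum_le_sum fun i _ => ?_
  simpa using hg.dist_le_mul (f (E.2 i).1) (f (E.2 i).2)

lemma AbsolutelyContinuousOnInterval.coord {γ : ℝ → Spc d} {a b : ℝ}
    (h : AbsolutelyContinuousOnInterval γ a b) (i : Fin d) :
    AbsolutelyContinuousOnInterval (fun s => γ s i) a b :=
  h.lipschitz_comp (g := fun y : Spc d => y i)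
    (LipschitzWith.of_dist_le_mul fun y z => by
      simpa [dist_eq_norm] using PiLp.norm_apply_le (y - z) i)

lemma absolutelyContinuousOnInterval_of_coord {γ : ℝ → Spc d} {a b : ℝ}
    (h : ∀ i, AbsolutelyContinuousOnInterval (fun s => γ s i) a b) :
    AbsolutelyContinuousOnInterval γ a b := by
  have hsum := tendsto_finsetSum Finset.univ fun i (_ : i ∈ Finset.univ) => h i
  rw [Finset.sum_const_zero] at hsum
  refine squeeze_zero (fun E => Finset.sum_nonneg fun _ _ => dist_nonneg) (fun E => ?_) hsum
  rw [Finset.sum_comm]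
  refine Finset.sum_le_sum fun k _ => ?_
  rw [EuclideanSpace.dist_eq]
  refine Real.sqrt_le_iff.2 ⟨Finset.sum_nonneg fun _ _ => dist_nonneg, ?_⟩
  exact Finset.sum_sq_le_sq_sum_of_nonneg fun _ _ => dist_nonneg

lemma AbsolutelyContinuousOnInterval.ae_differentiableAt_euclidean {γ : ℝ → Spc d} {a b : ℝ}
    (h : AbsolutelyContinuousOnInterval γ a b) :
    ∀ᵐ s, s ∈ uIcc a b → DifferentiableAt ℝ γ s := by
  filter_upwards [ae_all_iff.2 fun i => (h.coord i).ae_differentiableAt] with s hs hab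
  exact differentiableAt_euclidean.2 fun i => hs i hab

/-- The fundamental theorem of calculus for absolutely continuous curves in Euclidean space. -/
lemma AbsolutelyContinuousOnInterval.integral_deriv_eq_sub_euclidean {γ : ℝ → Spc d} {a b : ℝ}
    (h : AbsolutelyContinuousOnInterval γ a b) (hi : IntervalIntegrable (deriv γ) volume a b) :
    ∫ s in a..b, deriv γ s = γ b - γ a := by
  ext i
  have h1 : (∫ s in a..b, deriv γ s) i = ∫ s in a..b, deriv γ s i :=
    ((EuclideanSpace.proj i : Spc d →L[ℝ] ℝ).intervalIntegral_comp_comm hi).symm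
  rw [h1, PiLp.sub_apply, ← (h.coord i).integral_deriv_eq_sub]
  refine intervalIntegral.integral_congr_ae ?_
  filter_upwards [h.ae_differentiableAt_euclidean] with s hs hab
  exact ((EuclideanSpace.proj i : Spc d →L[ℝ] ℝ).hasFDerivAt.comp_hasDerivAt s
    (hs (uIoc_subset_uIcc hab)).hasDerivAt).deriv.symm

lemma IsVelocity.absolutelyContinuousOnInterval {x : Spc d} {u : ℝ → Spc d}
    (h : IsVelocity q T x u) (hq : 1 < q) (hT : 0 < T) :
    AbsolutelyContinuousOnInterval (primitive u) 0 T := by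
  refine absolutelyContinuousOnInterval_of_coord fun i => ?_
  have hii := h.intervalIntegrable hq hT
  have hi : IntervalIntegrable (fun s => u s i) volume 0 T :=
    ⟨(EuclideanSpace.proj i : Spc d →L[ℝ] ℝ).integrable_comp hii.1,
      (EuclideanSpace.proj i : Spc d →L[ℝ] ℝ).integrable_comp hii.2⟩
  have hac := hi.absolutelyContinuousOnInterval_intervalIntegral (c := 0) (by simp)
  have heq : EqOn (fun s => primitive u s i) (fun s => ∫ r in (0 : ℝ)..s, u r i) (uIcc 0 T) := by
    intro s hs
    exact ((EuclideanSpace.proj i : Spc d →L[ℝ] ℝ).intervalIntegral_comp_comm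
      (hii.mono_set (uIcc_subset_uIcc_left hs))).symm
  rw [absolutelyContinuousOnInterval_iff] at hac ⊢
  intro ε hε
  obtain ⟨δ, hδ, hE⟩ := hac ε hε
  refine ⟨δ, hδ, fun E hE1 hE2 => ?_⟩
  refine lt_of_eq_of_lt (Finset.sum_congr rfl fun k hk => ?_) (hE E hE1 hE2)
  have hmem := hE1.1 k hk
  exact congrArg₂ dist (heq hmem.1) (heq hmem.2)

namespace GrowthLagrangian

variable {𝓛 : Spc d → ℝ → Spc d → ℝ} {n : ℝ → ℝ} {x : Spc d}

/-- The actions of the absolutely continuous curves from `(0, 0)` to `(x, T)` with integrable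
Lagrangian are the actions of the velocities of class `L^q`. -/
lemma setOf_action_eq (h : GrowthLagrangian q N T 𝓛 n) (hq : 1 < q) (hT : 0 < T) :
    {A : ℝ | ∃ γ : ℝ → Spc d, AbsolutelyContinuousOnInterval γ 0 T ∧ γ 0 = 0 ∧ γ T = x ∧
      IntervalIntegrable (fun s => 𝓛 (γ s) s (deriv γ s)) volume 0 T ∧
      A = ∫ s in (0 : ℝ)..T, 𝓛 (γ s) s (deriv γ s)} =
    pathAction T 𝓛 '' {u | IsVelocity q T x u} := by
  have hq0 : 0 < q := by linarith
  ext A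
  constructor
  · rintro ⟨γ, hγ, hγ0, hγT, hint, rfl⟩
    have hint' : IntegrableOn (fun s => 𝓛 (γ s) s (deriv γ s)) (Ioc 0 T) :=
      (intervalIntegrable_iff_integrableOn_Ioc_of_le hT.le).1 hint
    have hm : Measurable (deriv γ) := measurable_deriv γ
    -- The lower growth bound makes `‖γ'‖ ^ q` at most `N (𝓛 + n)`: finite action forces an `L^q`
    -- velocity.
    have hpow : Integrable (fun s => ‖deriv γ s‖ ^ q) (volume.restrict (Ioc 0 T)) := by
      refine ((hint'.add h.integrable).const_mul N).mono'
        (hm.norm.pow_const q).aestronglyMeasurable (Eventually.of_forall fun s => ?_)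
      have h1 := h.lower (γ s) s (deriv γ s)
      have h2 := h.pos
      rw [Real.norm_eq_abs, abs_of_nonneg (by positivity)]
      simp only [Pi.add_apply]
      have h3 : N * (1 / N * ‖deriv γ s‖ ^ q) ≤
          N * (𝓛 (γ s) s (deriv γ s) + n s) := by gcongr; linarith
      rwa [← mul_assoc, mul_one_div_cancel h2.ne', one_mul] at h3
    have hLp : MemLp (deriv γ) (ENNReal.ofReal q) (volume.restrict (Ioc 0 T)) := by
      rw [← integrable_norm_rpow_iff hm.aestronglyMeasurable (by simpa using hq0)
        ENNReal.ofReal_ne_top, ENNReal.toReal_ofReal hq0.le]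
      exact hpow
    have hii : IntervalIntegrable (deriv γ) volume 0 T :=
      (intervalIntegrable_iff_integrableOn_Ioc_of_le hT.le).2
        (hLp.integrable (ENNReal.one_le_ofReal.2 hq.le))
    have hprim : ∀ s ∈ Icc 0 T, primitive (deriv γ) s = γ s := by
      intro s hs
      have hsub : uIcc 0 s ⊆ uIcc 0 T := uIcc_subset_uIcc_left (by rwa [uIcc_of_le hT.le])
      have := (hγ.mono hsub).integral_deriv_eq_sub_euclidean (hii.mono_set hsub)
      rw [hγ0, sub_zero] at this
      exact this
    refine ⟨deriv γ, ⟨hm, hLp, by rw [hprim T ⟨hT.le, le_rfl⟩, hγT]⟩, ?_⟩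
    rw [pathAction, intervalIntegral.integral_of_le hT.le]
    exact setIntegral_congr_fun measurableSet_Ioc fun s hs => by
      simp only [hprim s (Ioc_subset_Icc_self hs)]
  · rintro ⟨u, hu, rfl⟩
    have hu : IsVelocity q T x u := hu
    -- Lebesgue differentiation. The derivative may differ from `u` on a null set, which the action
    -- does not see.
    have hder : ∀ᵐ s ∂(volume.restrict (Ioc 0 T)), deriv (primitive u) s = u s := by
      rw [ae_restrict_iff' measurableSet_Ioc]
      filter_upwards [(hu.intervalIntegrable hq hT).ae_hasDerivAt_integral] with s hs hsT
      exact (hs (by rw [uIcc_of_le hT.le]; exact Ioc_subset_Icc_self hsT) 0 (by simp)).deriv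
    have hcongr : (fun s => 𝓛 (primitive u s) s (u s)) =ᵐ[volume.restrict (Ioc 0 T)]
        fun s => 𝓛 (primitive u s) s (deriv (primitive u) s) := by
      filter_upwards [hder] with s hs
      rw [hs]
    refine ⟨primitive u, hu.absolutelyContinuousOnInterval hq hT, by simp [primitive],
      hu.primitive_eq, ?_, ?_⟩
    · rw [intervalIntegrable_iff_integrableOn_Ioc_of_le hT.le]
      exact (h.integrableOn hq hT hu).congr hcongr
    · rw [pathAction, intervalIntegral.integral_of_le hT.le]
      exact integral_congr_ae hcongr

lemma bddBelow_range_pathAction (h : GrowthLagrangian q N T 𝓛 n) (hq : 1 < q) (hT : 0 < T)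
    {u : ℕ → ℝ → Spc d} (hu : ∀ i, IsVelocity q T x (u i)) :
    BddBelow (range fun i => pathAction T 𝓛 (u i)) :=
  ⟨- ∫ s in Ioc 0 T, n s, by rintro _ ⟨i, rfl⟩; exact h.neg_integral_le_pathAction hq hT (hu i)⟩

/-- The minimal action is the infimum over a dense countable family of velocities. -/
lemma sInf_action_eq_iInf (h : GrowthLagrangian q N T 𝓛 n) (hq : 1 < q) (hT : 0 < T)
    {u : ℕ → ℝ → Spc d} (hu : ∀ i, IsVelocity q T x (u i))
    (hdense : ∀ v, IsVelocity q T x v → ∃ φ : ℕ → ℕ, Tendsto (fun i =>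
      eLpNorm (u (φ i) - v) (ENNReal.ofReal q) (volume.restrict (Ioc 0 T))) atTop (𝓝 0)) :
    sInf {A : ℝ | ∃ γ : ℝ → Spc d, AbsolutelyContinuousOnInterval γ 0 T ∧ γ 0 = 0 ∧ γ T = x ∧
      IntervalIntegrable (fun s => 𝓛 (γ s) s (deriv γ s)) volume 0 T ∧
      A = ∫ s in (0 : ℝ)..T, 𝓛 (γ s) s (deriv γ s)} = ⨅ i, pathAction T 𝓛 (u i) := by
  rw [h.setOf_action_eq hq hT]
  apply le_antisymm
  · refine le_ciInf fun i => csInf_le ⟨- ∫ s in Ioc 0 T, n s, ?_⟩ ⟨u i, hu i, rfl⟩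
    rintro _ ⟨v, hv, rfl⟩
    exact h.neg_integral_le_pathAction hq hT hv
  · refine le_csInf ⟨_, u 0, hu 0, rfl⟩ ?_
    rintro _ ⟨v, hv, rfl⟩
    refine le_of_forall_pos_le_add fun ε hε => ?_
    obtain ⟨φ, hφ⟩ := hdense v hv
    obtain ⟨i, hi⟩ := h.exists_pathAction_le hq hT (fun i => hu (φ i)) hv hφ hε
    exact (ciInf_le (h.bddBelow_range_pathAction hq hT hu) (φ i)).trans hi

end GrowthLagrangian

end Curves

/-! ### Stationarity, integrability, and comparison of the Lagrangian with its mean. -/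

section Field

open Filter Topology

variable {Ω₀ Ω : Type*} [MeasurableSpace Ω₀] [mΩ : MeasurableSpace Ω] {d : ℕ}
  {P : Measure Ω} {ξ : SpTm d → Ω → Ω₀} {H : Spc d → Ω₀ → ℝ} {ν : (Spc d → Ω₀) → ℝ} {q N₁ : ℝ}

/-- `∫_s^{s+1} ν_r dr`, with values in `[0, ∞]`. -/
noncomputable def nuIntAt (ξ : SpTm d → Ω → Ω₀) (ν : (Spc d → Ω₀) → ℝ) (s : ℝ) (ω : Ω) : ℝ≥0∞ :=
  ∫⁻ r in Icc (0 : ℝ) 1, ENNReal.ofReal (nuAt ξ ν (s + r) ω)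

/-- The mean of `ν_t`. -/
noncomputable def nuMean (P : Measure Ω) (ξ : SpTm d → Ω → Ω₀) (ν : (Spc d → Ω₀) → ℝ) : ℝ :=
  ∫ ω, nuAt ξ ν 0 ω ∂P

/-- The mean Lagrangian. -/
noncomputable def lagrMean (P : Measure Ω) (ξ : SpTm d → Ω → Ω₀) (H : Spc d → Ω₀ → ℝ) (v : Spc d) :
    ℝ :=
  ∫ ω, lagrAt ξ H ω 0 0 v ∂P

lemma timeSigma_le (hξ : ∀ p, Measurable (ξ p)) (A : Set ℝ) : timeSigma ξ A ≤ mΩ :=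
  iSup₂_le fun p _ => (hξ p).comap_le

omit mΩ in
lemma timeSigma_mono (ξ : SpTm d → Ω → Ω₀) {A B : Set ℝ} (h : A ⊆ B) :
    timeSigma ξ A ≤ timeSigma ξ B :=
  biSup_mono fun _ hp => h hp

omit mΩ in
lemma measurable_timeSigma (ξ : SpTm d → Ω → Ω₀) {A : Set ℝ} {p : SpTm d} (hp : p.2 ∈ A) :
    Measurable[timeSigma ξ A] (ξ p) :=
  measurable_iff_comap_le.2 (le_iSup₂_of_le (f := fun (p : SpTm d)
    (_ : p ∈ {p : SpTm d | p.2 ∈ A}) => MeasurableSpace.comap (ξ p) inferInstance) p hp le_rfl)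

omit [MeasurableSpace Ω₀] mΩ in
lemma nuInt_eq_nuIntAt (ξ : SpTm d → Ω → Ω₀) (ν : (Spc d → Ω₀) → ℝ) :
    nuInt ξ ν = nuIntAt ξ ν 0 := by
  ext ω; simp [nuInt, nuIntAt]

namespace StandingAssumptions

variable (S : StandingAssumptions P ξ H ν q N₁)

include S

/-- A finite convex function on `ℝ^d` is continuous, so the supremum over `p` may be taken over a
countable dense set. -/
lemma measurable_lagr (v : Spc d) : Measurable (lagr H v) := by
  refine measurable_of_Iic fun c => ?_
  obtain ⟨D, hDc, hD⟩ := TopologicalSpace.exists_countable_dense (Spc d)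
  have : lagr H v ⁻¹' Iic c = ⋂ p ∈ D, {a | inner ℝ p v - H p a ≤ c} := by
    ext a
    simp only [mem_preimage, mem_Iic, mem_iInter, mem_ofPred_eq]
    constructor
    · intro h p _
      exact (le_ciSup (S.lagr_finite v a) p).trans h
    · intro h
      have hcont : Continuous fun p : Spc d => inner ℝ p v - H p a := by
        have h1 : Continuous fun p : Spc d => H p a :=
          continuousOn_univ.1 ((S.convex_H a).continuousOn isOpen_univ)
        fun_prop
      have hcl : IsClosed {p : Spc d | inner ℝ p v - H p a ≤ c} :=
        isClosed_le hcont continuous_const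
      have huniv : {p : Spc d | inner ℝ p v - H p a ≤ c} = univ :=
        hcl.closure_eq ▸ (hD.mono (fun p hp => h p hp)).closure_eq
      exact ciSup_le fun p => by
        have : p ∈ {p : Spc d | inner ℝ p v - H p a ≤ c} := huniv ▸ mem_univ p
        exact this
  rw [this]
  exact MeasurableSet.biInter hDc fun p _ =>
    measurableSet_le (measurable_const.sub (S.measurable_H p)) measurable_const

lemma measurable_timeSigma_lagrAt {A : Set ℝ} {t : ℝ} (ht : t ∈ A) (x v : Spc d) :
    Measurable[timeSigma ξ A] fun ω => lagrAt ξ H ω x t v :=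
  (S.measurable_lagr v).comp (measurable_timeSigma ξ (p := (x, t)) ht)

lemma measurable_timeSigma_nuAt {A : Set ℝ} {t : ℝ} (ht : t ∈ A) :
    Measurable[timeSigma ξ A] fun ω => nuAt ξ ν t ω :=
  S.measurable_nu.comp
    (@measurable_pi_lambda _ _ _ (timeSigma ξ A) _ _ fun x =>
      measurable_timeSigma ξ (p := (x, t)) ht)

lemma measurable_lagrAt (x : Spc d) (t : ℝ) (v : Spc d) : Measurable fun ω => lagrAt ξ H ω x t v :=
  (S.measurable_lagr v).comp (S.measurable_field _)

lemma measurable_nuAt_right (t : ℝ) : Measurable fun ω => nuAt ξ ν t ω :=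
  S.measurable_nuAt.of_uncurry_left (f := fun t ω => nuAt ξ ν t ω)

lemma one_le_nuAt (t : ℝ) (ω : Ω) : 1 ≤ nuAt ξ ν t ω := S.one_le_nu _

lemma map_comp_shift {β : Type*} [MeasurableSpace β] {Φ : (SpTm d → Ω₀) → β} (hΦ : Measurable Φ)
    (z : SpTm d) : P.map (fun ω => Φ (shift z fun p => ξ p ω)) = P.map (fun ω => Φ fun p => ξ p ω) := by
  have hfield : Measurable fun ω (p : SpTm d) => ξ p ω := measurable_pi_lambda _ S.measurable_field
  have hs := S.stationaryErgodic.stationary z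
  have h1 : P.map (fun ω => Φ (shift z fun p => ξ p ω)) =
      ((fieldLaw P ξ).map (shift z)).map Φ := by
    rw [fieldLaw, Measure.map_map hs.measurable hfield,
      Measure.map_map hΦ (hs.measurable.comp hfield)]
    rfl
  rw [h1, hs.map_eq, fieldLaw, Measure.map_map hΦ hfield]
  rfl

lemma map_nuAt_fdd (s : ℝ) {j : ℕ} (r : Fin j → ℝ) :
    P.map (fun ω i => nuAt ξ ν (s + r i) ω) = P.map (fun ω i => nuAt ξ ν (r i) ω) := by
  have hΦ : Measurable fun (w : SpTm d → Ω₀) (i : Fin j) => ν fun x => w (x, r i) :=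
    measurable_pi_lambda _ fun i => S.measurable_nu.comp
      (measurable_pi_lambda _ fun x => measurable_pi_apply _)
  have := S.map_comp_shift hΦ (0, s)
  simpa [shift, nuAt, add_comm] using this

/-- Joint measurability of `ν_t` is assumed on `ℝ × Ω`, not on the space of environments, so the
time integral is not known to be a measurable functional of the field to which the shift applies
directly. Equality of finite-dimensional laws suffices instead. -/
lemma map_nuIntAt [IsProbabilityMeasure P] (s : ℝ) :
    P.map (nuIntAt ξ ν s) = P.map (nuInt ξ ν) := by
  have : IsProbabilityMeasure (volume.restrict (Icc (0 : ℝ) 1)) := ⟨by simp⟩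
  refine map_lintegral_eq_of_fdd (f := fun r ω => nuAt ξ ν (s + r) ω) (g := fun r ω => nuAt ξ ν r ω)
    ?_ S.measurable_nuAt (fun r ω => zero_le_one.trans (S.one_le_nuAt _ ω))
    (fun r ω => zero_le_one.trans (S.one_le_nuAt _ ω)) fun j r => S.map_nuAt_fdd s r
  exact S.measurable_nuAt.comp (f := fun z : ℝ × Ω => (s + z.1, z.2)) (by fun_prop)

lemma measurable_nuIntAt (s : ℝ) : Measurable (nuIntAt ξ ν s) := by
  refine Measurable.lintegral_prod_left' (f := fun z : ℝ × Ω => ENNReal.ofReal (nuAt ξ ν (s + z.1) z.2)) ?_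
  exact (S.measurable_nuAt.comp (f := fun z : ℝ × Ω => (s + z.1, z.2)) (by fun_prop)).ennreal_ofReal

lemma measurable_nuInt : Measurable (nuInt ξ ν) := by
  rw [nuInt_eq_nuIntAt]; exact S.measurable_nuIntAt 0

lemma map_nuAt (t : ℝ) : P.map (nuAt ξ ν t) = P.map (nuAt ξ ν 0) := by
  have hΦ : Measurable fun w : SpTm d → Ω₀ => ν fun x => w (x, 0) :=
    S.measurable_nu.comp (measurable_pi_lambda _ fun x => measurable_pi_apply _)
  have h := S.map_comp_shift hΦ (0, t)
  simp only [shift, Prod.mk_add_mk, add_zero, zero_add] at h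
  exact h

lemma lintegral_nuAt (t : ℝ) :
    ∫⁻ ω, ENNReal.ofReal (nuAt ξ ν t ω) ∂P = ∫⁻ ω, ENNReal.ofReal (nuAt ξ ν 0 ω) ∂P := by
  have e : ∀ s, ∫⁻ ω, ENNReal.ofReal (nuAt ξ ν s ω) ∂P = ∫⁻ y, ENNReal.ofReal y ∂(P.map (nuAt ξ ν s)) :=
    fun s => (lintegral_map ENNReal.measurable_ofReal (S.measurable_nuAt_right s)).symm
  rw [e, e, S.map_nuAt]

lemma lintegral_setLIntegral_nuAt [SFinite P] (A : Set ℝ) :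
    ∫⁻ ω, (∫⁻ r in A, ENNReal.ofReal (nuAt ξ ν r ω)) ∂P =
      volume A * ∫⁻ ω, ENNReal.ofReal (nuAt ξ ν 0 ω) ∂P := by
  rw [lintegral_lintegral_swap]
  · simp_rw [S.lintegral_nuAt]
    simp [mul_comm]
  · exact (S.measurable_nuAt.ennreal_ofReal.comp measurable_swap).aemeasurable

lemma lintegral_nuInt [SFinite P] :
    ∫⁻ ω, nuInt ξ ν ω ∂P = ∫⁻ ω, ENNReal.ofReal (nuAt ξ ν 0 ω) ∂P := by
  simp only [nuInt]
  rw [S.lintegral_setLIntegral_nuAt]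
  simp

variable [IsProbabilityMeasure P] (hfin : ∫⁻ ω, nuInt ξ ν ω ∂P ≠ ∞)

include hfin

lemma integrable_nuAt (t : ℝ) : Integrable (nuAt ξ ν t) P := by
  refine ⟨(S.measurable_nuAt_right t).aestronglyMeasurable, ?_⟩
  rw [hasFiniteIntegral_iff_ofReal (Eventually.of_forall fun ω => zero_le_one.trans (S.one_le_nuAt _ ω)),
    S.lintegral_nuAt, ← S.lintegral_nuInt]
  exact hfin.lt_top

lemma ofReal_nuMean : ENNReal.ofReal (nuMean P ξ ν) = ∫⁻ ω, nuInt ξ ν ω ∂P := by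
  rw [S.lintegral_nuInt]
  exact ofReal_integral_eq_lintegral_ofReal (S.integrable_nuAt hfin 0)
    (Eventually.of_forall fun ω => zero_le_one.trans (S.one_le_nuAt _ ω))

lemma one_le_nuMean : 1 ≤ nuMean P ξ ν := by
  have := integral_mono (integrable_const 1) (S.integrable_nuAt hfin 0) (S.one_le_nuAt 0)
  simpa [nuMean] using this

lemma ae_integrableOn_nuAt {A : Set ℝ} (hA : volume A ≠ ∞) :
    ∀ᵐ ω ∂P, IntegrableOn (fun t => nuAt ξ ν t ω) A := by
  have h : ∫⁻ ω, (∫⁻ r in A, ENNReal.ofReal (nuAt ξ ν r ω)) ∂P ≠ ∞ := by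
    rw [S.lintegral_setLIntegral_nuAt, ← S.lintegral_nuInt]
    exact ENNReal.mul_ne_top hA hfin
  have hm : Measurable fun ω => ∫⁻ r in A, ENNReal.ofReal (nuAt ξ ν r ω) :=
    S.measurable_nuAt.ennreal_ofReal.lintegral_prod_left'
  filter_upwards [ae_lt_top hm h] with ω hω
  refine ⟨(S.measurable_nuAt.of_uncurry_right
    (f := fun t ω => nuAt ξ ν t ω)).aestronglyMeasurable, ?_⟩
  rwa [hasFiniteIntegral_iff_ofReal
    (Eventually.of_forall fun t => zero_le_one.trans (S.one_le_nuAt _ ω))]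

omit hfin [IsProbabilityMeasure P] in
lemma abs_lagrAt_le (hN : 1 < N₁) : ∀ᵐ ω ∂P, ∀ x t v,
    |lagrAt ξ H ω x t v| ≤ N₁ * ‖v‖ ^ q + nuAt ξ ν t ω := by
  filter_upwards [S.growth] with ω hω x t v
  have h1 := hω x t v
  have h3 : 0 ≤ 1 / N₁ * ‖v‖ ^ q := by positivity
  have h4 : 0 ≤ N₁ * ‖v‖ ^ q := by positivity
  exact abs_le.2 ⟨by linarith, h1.2⟩

lemma integrable_lagrAt (hN : 1 < N₁) (x : Spc d) (t : ℝ) (v : Spc d) :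
    Integrable (fun ω => lagrAt ξ H ω x t v) P := by
  refine ((integrable_const (N₁ * ‖v‖ ^ q)).add (S.integrable_nuAt hfin t)).mono'
    (S.measurable_lagrAt x t v).aestronglyMeasurable ?_
  filter_upwards [S.abs_lagrAt_le hN] with ω hω using hω x t v

omit hfin [IsProbabilityMeasure P] in
lemma ae_continuous_lagrAt : ∀ᵐ ω ∂P,
    Continuous fun z : Spc d × ℝ × Spc d => lagrAt ξ H ω z.1 z.2.1 z.2.2 := by
  filter_upwards [S.buc] with ω hω
  rw [continuous_iff_continuousAt]
  rintro ⟨x, t, v⟩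
  set R := |t| + ‖v‖ + 1
  have hR : 0 < R := by positivity
  refine (hω R hR).1.continuousOn.continuousAt ?_
  refine prod_mem_nhds univ_mem (prod_mem_nhds (Icc_mem_nhds ?_ ?_) ?_)
  · linarith [neg_abs_le t, norm_nonneg v]
  · linarith [le_abs_self t, norm_nonneg v]
  · refine Metric.isOpen_ball.mem_nhds ?_
    rw [mem_ball_zero_iff]
    linarith [abs_nonneg t]

lemma continuous_lagrMean (hq : 1 < q) (hN : 1 < N₁) : Continuous (lagrMean P ξ H) := by
  rw [continuous_iff_continuousAt]
  intro v
  have hcont : ContinuousAt (fun w : Spc d => N₁ * ‖w‖ ^ q) v :=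
    (((continuous_norm.rpow_const fun _ => Or.inr (by linarith)).const_mul N₁ :
      Continuous fun w : Spc d => N₁ * ‖w‖ ^ q)).continuousAt
  have hev : ∀ᶠ w in 𝓝 v, N₁ * ‖w‖ ^ q < N₁ * ‖v‖ ^ q + 1 :=
    hcont.eventually_lt_const (by linarith)
  refine continuousAt_of_dominated (bound := fun ω => N₁ * ‖v‖ ^ q + 1 + nuAt ξ ν 0 ω)
    (Eventually.of_forall fun w => (S.measurable_lagrAt 0 0 w).aestronglyMeasurable) ?_
    ((integrable_const _).add (S.integrable_nuAt hfin 0)) ?_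
  · filter_upwards [hev] with w hw
    filter_upwards [S.abs_lagrAt_le hN] with ω hω
    exact (hω 0 0 w).trans (by linarith)
  · filter_upwards [S.ae_continuous_lagrAt] with ω hω
    exact (hω.comp (f := fun w => ((0 : Spc d), (0 : ℝ), w)) (by fun_prop)).continuousAt

lemma abs_lagrMean_le (hN : 1 < N₁) (v : Spc d) :
    |lagrMean P ξ H v| ≤ N₁ * ‖v‖ ^ q + nuMean P ξ ν := by
  have h1 : ‖lagrMean P ξ H v‖ ≤ ∫ ω, (N₁ * ‖v‖ ^ q + nuAt ξ ν 0 ω) ∂P := by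
    refine norm_integral_le_of_norm_le ((integrable_const _).add (S.integrable_nuAt hfin 0)) ?_
    filter_upwards [S.abs_lagrAt_le hN] with ω hω using hω 0 0 v
  rw [integral_add (integrable_const _) (S.integrable_nuAt hfin 0)] at h1
  simpa [nuMean] using h1

omit hfin [IsProbabilityMeasure P] in
/-- A law of large numbers for observables of the field at integer times. -/
lemma ae_tendsto_average {β : ℝ → Ω → ℝ} (hm : ∀ t, Measurable[timeSigma ξ {t}] (β t))
    (hlaw : ∀ t, P.map (β t) = P.map (β 0)) (hi : Integrable (β 0) P) :
    ∀ᵐ ω ∂P, Tendsto (fun n : ℕ => (∑ i ∈ Finset.range n, β i ω) / n) atTop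
      (𝓝 (∫ ω, β 0 ω ∂P)) := by
  have hm' : ∀ t, Measurable (β t) := fun t =>
    (hm t).mono (timeSigma_le S.measurable_field _) le_rfl
  -- Distinct integer times are at least one apart, so unit range gives pairwise independence, which
  -- is all the strong law needs.
  have hlt : ∀ i j : ℕ, i < j → IndepFun (β i) (β j) P := by
    intro i j hij
    rw [IndepFun_iff_Indep]
    have hij' : (i : ℝ) + 1 ≤ j := by exact_mod_cast hij
    refine indep_of_indep_of_le_left (indep_of_indep_of_le_right (S.unitRange (i : ℝ)) ?_) ?_
    · exact (hm j).comap_le.trans (timeSigma_mono ξ (by simpa using hij'))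
    · exact (hm i).comap_le.trans (timeSigma_mono ξ (by simp))
  have := strong_law_ae_real (μ := P) (fun i : ℕ => β i) (by simpa using hi) ?_ ?_
  · simpa using this
  · intro i j hij
    rcases lt_or_gt_of_ne hij with h | h
    · exact hlt i j h
    · exact (hlt j i h).symm
  · intro i
    exact ⟨(hm' _).aemeasurable, (hm' _).aemeasurable, by rw [hlaw]; simp [hlaw]⟩

/-- The Lagrangian stays close to its mean. -/
lemma abs_lagrAt_sub_lagrMean_le (hq : 1 < q) (hN : 1 < N₁) : ∀ᵐ ω ∂P, ∀ x t v,
    |lagrAt ξ H ω x t v - lagrMean P ξ H v| ≤ nuAt ξ ν t ω + nuMean P ξ ν := by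
  obtain ⟨D, hDc, hD⟩ := TopologicalSpace.exists_countable_dense (Spc d)
  obtain ⟨C, hC⟩ := S.regularity
  have hν : ∀ᵐ ω ∂P, Tendsto (fun n : ℕ => (∑ i ∈ Finset.range n, nuAt ξ ν i ω) / n) atTop
      (𝓝 (nuMean P ξ ν)) := by
    refine S.ae_tendsto_average (β := nuAt ξ ν) (fun t => S.measurable_timeSigma_nuAt (mem_singleton t))
      S.map_nuAt (S.integrable_nuAt hfin 0)
  have hL : ∀ᵐ ω ∂P, ∀ v ∈ D, Tendsto (fun n : ℕ =>
      (∑ i ∈ Finset.range n, lagrAt ξ H ω 0 i v) / n) atTop (𝓝 (lagrMean P ξ H v)) := by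
    rw [ae_ball_iff hDc]
    intro v _
    refine S.ae_tendsto_average (β := fun t ω => lagrAt ξ H ω 0 t v)
      (fun t => S.measurable_timeSigma_lagrAt (mem_singleton t) 0 v) (fun t => ?_)
      (S.integrable_lagrAt hfin hN 0 0 v)
    have hΦ : Measurable fun w : SpTm d → Ω₀ => lagr H v (w (0, 0)) :=
      (S.measurable_lagr v).comp (measurable_pi_apply _)
    have h := S.map_comp_shift hΦ (0, t)
    simpa [shift, lagrAt] using h
  filter_upwards [hν, hL, hC, S.ae_continuous_lagrAt] with ω hν hL hC hcont x t
  -- The null set of the strong law depends on `v`; a countable dense set of velocities is treated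
  -- first and continuity in `v` covers the rest, for all `x` and `t` at once.
  have hclosed : IsClosed {v | |lagrAt ξ H ω x t v - lagrMean P ξ H v| ≤
      nuAt ξ ν t ω + nuMean P ξ ν} := by
    refine isClosed_le ?_ continuous_const
    refine (Continuous.sub ?_ (S.continuous_lagrMean hfin hq hN)).abs
    exact hcont.comp (f := fun v => (x, t, v)) (by fun_prop)
  have hsub : D ⊆ {v | |lagrAt ξ H ω x t v - lagrMean P ξ H v| ≤
      nuAt ξ ν t ω + nuMean P ξ ν} := by
    intro v hv
    refine le_of_tendsto_of_tendsto ((tendsto_const_nhds (x := lagrAt ξ H ω x t v)).sub (hL v hv)).abs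
      (hν.const_add (nuAt ξ ν t ω)) ?_
    filter_upwards [eventually_gt_atTop 0] with n hn
    have hn0 : (0 : ℝ) < n := by exact_mod_cast hn
    have h1 : ∀ i ∈ Finset.range n, |lagrAt ξ H ω x t v - lagrAt ξ H ω 0 i v| ≤
        nuAt ξ ν t ω + nuAt ξ ν i ω := by
      intro i _
      -- With equal velocities the term with the constant `C` vanishes, leaving only the two values
      -- of `ν`.
      have := hC x t v 0 i v
      simp only [sub_self, norm_zero, mul_zero, zero_mul, zero_add] at this
      linarith
    have h2 : |∑ i ∈ Finset.range n, (lagrAt ξ H ω x t v - lagrAt ξ H ω 0 i v)| ≤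
        ∑ i ∈ Finset.range n, (nuAt ξ ν t ω + nuAt ξ ν i ω) :=
      (Finset.abs_sum_le_sum_abs _ _).trans (Finset.sum_le_sum h1)
    simp only [Finset.sum_sub_distrib, Finset.sum_add_distrib, Finset.sum_const,
      Finset.card_range, nsmul_eq_mul] at h2
    have e1 : lagrAt ξ H ω x t v - (∑ i ∈ Finset.range n, lagrAt ξ H ω 0 i v) / n =
        (n * lagrAt ξ H ω x t v - ∑ i ∈ Finset.range n, lagrAt ξ H ω 0 i v) / n := by
      field_simp
    have e2 : nuAt ξ ν t ω + (∑ i ∈ Finset.range n, nuAt ξ ν i ω) / n =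
        (n * nuAt ξ ν t ω + ∑ i ∈ Finset.range n, nuAt ξ ν i ω) / n := by
      field_simp
    rw [e1, e2, abs_div, abs_of_pos hn0]
    gcongr
  intro v
  have : v ∈ {v | |lagrAt ξ H ω x t v - lagrMean P ξ H v| ≤ nuAt ξ ν t ω + nuMean P ξ ν} :=
    hclosed.closure_subset_iff.2 hsub (hD v)
  exact this

end StandingAssumptions

end Field

/-! ### Measurability of actions with respect to the field at given times. -/

section Measurability

open Filter Topology

/-- A measurable substitute for the integral of a parametrized family along a measurable path `z`
with values in `W`: only the measurability of `Φ p` for `p ∈ W` is needed. -/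
lemma measurable_integral_limsup_approxOn {Ω' X : Type*} [MeasurableSpace Ω']
    [PseudoEMetricSpace X] [MeasurableSpace X] [OpensMeasurableSpace X]
    {Φ : X → Ω' → ℝ} {W : Set X} [TopologicalSpace.SeparableSpace W] {y₀ : X} (h₀ : y₀ ∈ W)
    (hΦ : ∀ p ∈ W, Measurable (Φ p)) {z : ℝ → X} (hz : Measurable z) (μ : Measure ℝ) [SFinite μ] :
    Measurable fun ω => ∫ s, limsup (fun n => Φ (SimpleFunc.approxOn z hz W y₀ h₀ n s) ω) atTop ∂μ := by
  classical
  have hjoint : ∀ n, Measurable fun p : ℝ × Ω' =>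
      Φ (SimpleFunc.approxOn z hz W y₀ h₀ n p.1) p.2 := by
    intro n
    let f : SimpleFunc (ℝ × Ω') X :=
      (SimpleFunc.approxOn z hz W y₀ h₀ n).comp Prod.fst measurable_fst
    -- The simple approximations take values in `W` only, so redefining the family as zero elsewhere
    -- changes nothing and makes every branch measurable.
    let g : X → ℝ × Ω' → ℝ := fun b p => if b ∈ W then Φ b p.2 else 0
    have hg : ∀ b, Measurable (g b) := by
      intro b
      by_cases hb : b ∈ W
      · simp only [g, hb, if_true]
        exact (hΦ b hb).comp measurable_snd
      · simp [g, hb]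
    have := SimpleFunc.measurable_bind f g hg
    convert this using 2 with p
    simp [g, f, SimpleFunc.approxOn_mem hz h₀ n p.1]
  exact (Measurable.limsup hjoint).stronglyMeasurable.integral_prod_left'.measurable

variable {Ω₀ Ω : Type*} [MeasurableSpace Ω₀] [mΩ : MeasurableSpace Ω] {d : ℕ}
  {P : Measure Ω} {ξ : SpTm d → Ω → Ω₀} {H : Spc d → Ω₀ → ℝ} {ν : (Spc d → Ω₀) → ℝ} {q N₁ T : ℝ}

namespace StandingAssumptions

variable (S : StandingAssumptions P ξ H ν q N₁)

include S

/-- The Lagrangian is continuous along the path only almost surely. The upper limit along simple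
approximations of the path at times in `A` is measurable everywhere and equals the integrand
wherever continuity holds. -/
lemma exists_measurable_eq_integral {A : Set ℝ} {z : ℝ → Spc d × ℝ × Spc d} (hz : Measurable z)
    (hzA : ∀ s, (z s).2.1 ∈ A) (μ : Measure ℝ) [SFinite μ] :
    ∃ g : Ω → ℝ, Measurable[timeSigma ξ A] g ∧
      ∀ᵐ ω ∂P, ∫ s, lagrAt ξ H ω (z s).1 (z s).2.1 (z s).2.2 ∂μ = g ω := by
  let W : Set (Spc d × ℝ × Spc d) := {p | p.2.1 ∈ A}
  let Φ : Spc d × ℝ × Spc d → Ω → ℝ := fun p ω => lagrAt ξ H ω p.1 p.2.1 p.2.2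
  have hm := @measurable_integral_limsup_approxOn Ω _ (timeSigma ξ A) _ _ _ Φ W _ (z 0) (hzA 0)
    (fun p hp => S.measurable_timeSigma_lagrAt hp p.1 p.2.2) z hz μ _
  refine ⟨_, hm, ?_⟩
  filter_upwards [S.ae_continuous_lagrAt] with ω hω
  congr 1 with s
  have hlim := SimpleFunc.tendsto_approxOn hz (s := W) (hzA 0) (x := s) (subset_closure (hzA s))
  exact ((hω.tendsto (z s)).comp hlim).limsup_eq.symm

/-- The action over a set of times is, up to a null set, measurable with respect to the field at
those times. -/
lemma exists_measurable_eq_action (hq : 1 < q) (hT : 0 < T) {x : Spc d} {u : ℝ → Spc d}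
    (hu : IsVelocity q T x u) {A B : Set ℝ} (hB : MeasurableSet B) (hBT : B ⊆ Ioc 0 T)
    (hBA : B ⊆ A) :
    ∃ g : Ω → ℝ, Measurable[timeSigma ξ A] g ∧
      ∀ᵐ ω ∂P, ∫ s in B, lagrAt ξ H ω (primitive u s) s (u s) = g ω := by
  classical
  rcases B.eq_empty_or_nonempty with rfl | ⟨s₀, hs₀⟩
  · exact ⟨fun _ => 0, measurable_const, by simp⟩
  -- Outside `B` the time coordinate is frozen at a point of `B`, so that only times in `A` are ever
  -- observed.
  let z : ℝ → Spc d × ℝ × Spc d := fun s =>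
    (B.piecewise (primitive u) (fun _ => 0) s, B.piecewise id (fun _ => s₀) s, u s)
  have hz : Measurable z := by
    refine Measurable.prodMk ?_ (Measurable.prodMk ?_ hu.measurable)
    · exact ContinuousOn.measurable_piecewise ((hu.continuousOn_primitive hq hT).mono
        (hBT.trans Ioc_subset_Icc_self)) continuousOn_const hB
    · exact ContinuousOn.measurable_piecewise continuousOn_id continuousOn_const hB
  have hzA : ∀ s, (z s).2.1 ∈ A := by
    intro s
    by_cases hs : s ∈ B
    · simpa [z, hs] using hBA hs
    · simpa [z, hs] using hBA hs₀
  obtain ⟨g, hg, hgeq⟩ := S.exists_measurable_eq_integral hz hzA (volume.restrict B)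
  refine ⟨g, hg, ?_⟩
  filter_upwards [hgeq] with ω hω
  rw [← hω]
  exact setIntegral_congr_fun hB fun s hs => by simp [z, hs]

lemma ae_growthLagrangian [IsProbabilityMeasure P] (hfin : ∫⁻ ω, nuInt ξ ν ω ∂P ≠ ∞) (hN : 1 < N₁)
    (T : ℝ) : ∀ᵐ ω ∂P, GrowthLagrangian q N₁ T (lagrAt ξ H ω) fun t => nuAt ξ ν t ω := by
  filter_upwards [S.ae_continuous_lagrAt, S.growth,
    S.ae_integrableOn_nuAt hfin (A := Ioc 0 T) (by simp)] with ω h1 h2 h3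
  exact ⟨by linarith, h1, fun x t v => (h2 x t v).1, fun x t v => (h2 x t v).2, h3⟩

end StandingAssumptions

end Measurability

/-! ### Countable form of the minimal action and integrals of `ν` over windows. -/

section Localization

open Filter Topology

/-- Bounds uniform over curves pass to the infimum, so no regularity or localization of minimizers
is needed. -/
lemma abs_ciInf_sub_ciInf_le {ι : Type*} [Nonempty ι] {a b : ι → ℝ} {e : ℝ}
    (ha : BddBelow (range a)) (h : ∀ i, |a i - b i| ≤ e) : |(⨅ i, a i) - ⨅ i, b i| ≤ e := by
  obtain ⟨c, hc⟩ := ha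
  have hb : BddBelow (range b) := ⟨c - e, by
    rintro _ ⟨i, rfl⟩
    have h1 := hc ⟨i, rfl⟩
    have h2 := (abs_le.1 (h i)).2
    linarith⟩
  rw [abs_le]
  constructor
  · have : (⨅ i, b i) - e ≤ ⨅ i, a i := le_ciInf fun i => by
      linarith [ciInf_le hb i, (abs_le.1 (h i)).1]
    linarith
  · have : (⨅ i, a i) - e ≤ ⨅ i, b i := le_ciInf fun i => by
      linarith [ciInf_le ⟨c, hc⟩ i, (abs_le.1 (h i)).2]
    linarith

variable {Ω₀ Ω : Type*} [MeasurableSpace Ω₀] [mΩ : MeasurableSpace Ω] {d : ℕ}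
  {P : Measure Ω} [IsProbabilityMeasure P] {ξ : SpTm d → Ω → Ω₀} {H : Spc d → Ω₀ → ℝ}
  {ν : (Spc d → Ω₀) → ℝ} {q N₁ T : ℝ}

namespace StandingAssumptions

variable (S : StandingAssumptions P ξ H ν q N₁) (hfin : ∫⁻ ω, nuInt ξ ν ω ∂P ≠ ∞)

include S hfin

lemma ae_metric_eq (hq : 1 < q) (hN : 1 < N₁) (hT : 0 < T) {x : Spc d} {u : ℕ → ℝ → Spc d}
    (hu : ∀ i, IsVelocity q T x (u i))
    (hdense : ∀ v, IsVelocity q T x v → ∃ φ : ℕ → ℕ, Tendsto (fun i =>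
      eLpNorm (u (φ i) - v) (ENNReal.ofReal q) (volume.restrict (Ioc 0 T))) atTop (𝓝 0)) :
    ∀ᵐ ω ∂P, metric ξ H x T ω = ⨅ i, pathAction T (lagrAt ξ H ω) (u i) := by
  filter_upwards [S.ae_growthLagrangian hfin hN T] with ω hω
  exact hω.sInf_action_eq_iInf hq hT hu hdense

lemma nuIntAt_lt_top (s : ℝ) : ∀ᵐ ω ∂P, nuIntAt ξ ν s ω < ∞ := by
  refine ae_lt_top (S.measurable_nuIntAt s) ?_
  have e : ∀ t, ∫⁻ ω, nuIntAt ξ ν t ω ∂P = ∫⁻ y, y ∂(P.map (nuIntAt ξ ν t)) :=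
    fun t => (lintegral_map measurable_id (S.measurable_nuIntAt t)).symm
  rw [e, S.map_nuIntAt]
  exact (lintegral_map measurable_id S.measurable_nuInt).trans_ne hfin

omit S hfin [IsProbabilityMeasure P] [MeasurableSpace Ω₀] mΩ in
lemma setLIntegral_nuAt_eq (s : ℝ) (ω : Ω) :
    ∫⁻ r in Icc s (s + 1), ENNReal.ofReal (nuAt ξ ν r ω) = nuIntAt ξ ν s ω := by
  have h := (measurePreserving_add_left volume s).setLIntegral_comp_preimage_emb
    (measurableEmbedding_addLeft s) (fun r => ENNReal.ofReal (nuAt ξ ν r ω)) (Icc s (s + 1))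
  rw [← h, nuIntAt]
  congr 2
  ext r
  simp

/-- The time integral of `ν_t` over a part of `[s - 1, s + 1]`. -/
lemma ae_setIntegral_nuAt_le (s : ℝ) : ∀ᵐ ω ∂P, ∀ B ⊆ Icc (s - 1) (s + 1),
    ∫ r in B, nuAt ξ ν r ω ≤ (nuIntAt ξ ν (s - 1) ω).toReal + (nuIntAt ξ ν s ω).toReal := by
  filter_upwards [S.nuIntAt_lt_top hfin (s - 1), S.nuIntAt_lt_top hfin s] with ω h1 h2 B hB
  have hm : AEStronglyMeasurable (fun r => nuAt ξ ν r ω) (volume.restrict B) :=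
    (S.measurable_nuAt.of_uncurry_right (f := fun t ω => nuAt ξ ν t ω)).aestronglyMeasurable
  rw [integral_eq_lintegral_of_nonneg_ae (Eventually.of_forall fun r =>
    zero_le_one.trans (S.one_le_nuAt r ω)) hm, ← ENNReal.toReal_add h1.ne h2.ne]
  refine ENNReal.toReal_mono (ENNReal.add_ne_top.2 ⟨h1.ne, h2.ne⟩) ?_
  rw [← setLIntegral_nuAt_eq, ← setLIntegral_nuAt_eq]
  refine (lintegral_mono_set (t := Icc (s - 1) (s - 1 + 1) ∪ Icc s (s + 1)) ?_).trans
    (lintegral_union_le _ _ _)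
  intro r hr
  have := hB hr
  simp only [mem_union, mem_Icc] at this ⊢
  rcases le_total r s with h | h
  · left; constructor <;> linarith [this.1]
  · right; exact ⟨h, this.2⟩

lemma integrableOn_lagrMean (hq : 1 < q) (hN : 1 < N₁) {x : Spc d} {u : ℝ → Spc d}
    (hu : IsVelocity q T x u) : IntegrableOn (fun s => lagrMean P ξ H (u s)) (Ioc 0 T) := by
  refine (((hu.integrableOn_rpow hq).const_mul N₁).add (integrable_const (nuMean P ξ ν))).mono'
    ((S.continuous_lagrMean hfin hq hN).comp_aestronglyMeasurable
      hu.measurable.aestronglyMeasurable) (Eventually.of_forall fun s => ?_)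
  exact S.abs_lagrMean_le hfin hN (u s)

end StandingAssumptions

end Localization

/-! ### Resampling-free martingale decomposition of the minimal action. -/

section IncrementControlOfMetric

open Filter Topology

variable {Ω₀ Ω : Type*} [MeasurableSpace Ω₀] [mΩ : MeasurableSpace Ω] {d : ℕ}
  {P : Measure Ω} [IsProbabilityMeasure P] {ξ : SpTm d → Ω → Ω₀} {H : Spc d → Ω₀ → ℝ}
  {ν : (Spc d → Ω₀) → ℝ} {q N₁ T : ℝ}

namespace StandingAssumptions

variable (S : StandingAssumptions P ξ H ν q N₁) (hfin : ∫⁻ ω, nuInt ξ ν ω ∂P ≠ ∞)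

include S hfin

lemma integrable_nuIntAt (s : ℝ) : Integrable (fun ω => (nuIntAt ξ ν s ω).toReal) P := by
  refine integrable_toReal_of_lintegral_ne_top (S.measurable_nuIntAt s).aemeasurable ?_
  have e : ∀ t, ∫⁻ ω, nuIntAt ξ ν t ω ∂P = ∫⁻ y, y ∂(P.map (nuIntAt ξ ν t)) :=
    fun t => (lintegral_map measurable_id (S.measurable_nuIntAt t)).symm
  rw [e, S.map_nuIntAt]
  exact (lintegral_map measurable_id S.measurable_nuInt).trans_ne hfin

/-- The minimal action up to time `T` is, up to a null set, measurable with respect to the field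
at the times in `(0, T]`. -/
lemma exists_measurable_eq_metric (hq : 1 < q) (hN : 1 < N₁) (hT : 0 < T) (x : Spc d) {A : Set ℝ}
    (hA : Ioc 0 T ⊆ A) : ∃ g : Ω → ℝ, Measurable[timeSigma ξ A] g ∧ metric ξ H x T =ᵐ[P] g := by
  obtain ⟨u, hu, hdense⟩ := exists_dense_velocities hq hT x
  choose g hg hgeq using fun i =>
    S.exists_measurable_eq_action hq hT (hu i) measurableSet_Ioc subset_rfl hA
  refine ⟨fun ω => ⨅ i, g i ω, Measurable.iInf hg, ?_⟩
  filter_upwards [S.ae_metric_eq hfin hq hN hT hu hdense, ae_all_iff.2 hgeq] with ω h1 h2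
  rw [h1]
  exact iInf_congr fun i => h2 i

/-- The action is at least minus the integral of `ν`, and at most the cost of one test curve, which
is again a constant plus that integral. -/
lemma integrable_metric (hq : 1 < q) (hN : 1 < N₁) (hT : 0 < T) (x : Spc d) :
    Integrable (metric ξ H x T) P := by
  obtain ⟨g, hg, hgeq⟩ := S.exists_measurable_eq_metric hfin hq hN hT x (subset_univ _)
  obtain ⟨u, hu, hdense⟩ := exists_dense_velocities hq hT x
  have hm : AEStronglyMeasurable (metric ξ H x T) P :=
    ((hg.mono (timeSigma_le S.measurable_field _) le_rfl).aestronglyMeasurable).congr hgeq.symm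
  have hint : Integrable (fun ω => ∫ t in Ioc 0 T, nuAt ξ ν t ω) P := by
    have h0 : ∀ ω, ∫ t in Ioc 0 T, nuAt ξ ν t ω =
        (∫⁻ t in Ioc 0 T, ENNReal.ofReal (nuAt ξ ν t ω)).toReal := fun ω =>
      integral_eq_lintegral_of_nonneg_ae (Eventually.of_forall fun r =>
        zero_le_one.trans (S.one_le_nuAt r ω))
        (S.measurable_nuAt.of_uncurry_right (f := fun t ω => nuAt ξ ν t ω)).aestronglyMeasurable
    simp_rw [h0]
    refine integrable_toReal_of_lintegral_ne_top
      (S.measurable_nuAt.ennreal_ofReal.lintegral_prod_left').aemeasurable ?_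
    rw [S.lintegral_setLIntegral_nuAt, ← S.lintegral_nuInt]
    exact ENNReal.mul_ne_top (by simp) hfin
  refine ((integrable_const (N₁ * ∫ s in Ioc 0 T, ‖u 0 s‖ ^ q)).add hint).mono' hm ?_
  filter_upwards [S.ae_metric_eq hfin hq hN hT hu hdense, S.ae_growthLagrangian hfin hN T]
    with ω h1 h2
  have hb := h2.bddBelow_range_pathAction hq hT hu
  have hlow : -∫ s in Ioc 0 T, nuAt ξ ν s ω ≤ metric ξ H x T ω := by
    rw [h1]; exact le_ciInf fun i => h2.neg_integral_le_pathAction hq hT (hu i)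
  have hup : metric ξ H x T ω ≤
      N₁ * (∫ s in Ioc 0 T, ‖u 0 s‖ ^ q) + ∫ s in Ioc 0 T, nuAt ξ ν s ω := by
    rw [h1, ← integral_const_mul, ← integral_add (((hu 0).integrableOn_rpow hq).const_mul N₁)
      h2.integrable]
    refine (ciInf_le hb 0).trans ?_
    exact integral_mono (h2.integrableOn hq hT (hu 0)) (h2.integrableOn_bound hq (hu 0))
      fun s => h2.upper _ _ _
  have hpos : 0 ≤ N₁ * ∫ s in Ioc 0 T, ‖u 0 s‖ ^ q :=
    mul_nonneg (by linarith) (integral_nonneg fun s => by positivity)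
  simp only [Pi.add_apply]
  exact abs_le.2 ⟨by linarith, hup⟩

/-- The effect on the action of replacing the Lagrangian by its mean during `B`. -/
lemma ae_abs_pathAction_sub_le (hq : 1 < q) (hN : 1 < N₁) (hT : 0 < T) {x : Spc d}
    {u : ℝ → Spc d} (hu : IsVelocity q T x u) (k : ℝ) : ∀ᵐ ω ∂P,
    |pathAction T (lagrAt ξ H ω) u - ((∫ s in Ioc 0 T ∩ Iic (k - 1), lagrAt ξ H ω (primitive u s) s (u s)) +
        (∫ s in Ioc 0 T ∩ Ici (k + 1), lagrAt ξ H ω (primitive u s) s (u s)) +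
        ∫ s in Ioc 0 T ∩ Ioo (k - 1) (k + 1), lagrMean P ξ H (u s))| ≤
      (nuIntAt ξ ν (k - 1) ω).toReal + (nuIntAt ξ ν k ω).toReal + 2 * nuMean P ξ ν := by
  filter_upwards [S.ae_growthLagrangian hfin hN T, S.abs_lagrAt_sub_lagrMean_le hfin hq hN,
    S.ae_setIntegral_nuAt_le hfin k] with ω h1 h2 h3
  set B := Ioc 0 T ∩ Ioo (k - 1) (k + 1)
  have hBT : B ⊆ Ioc 0 T := inter_subset_left
  have hBk : B ⊆ Ioo (k - 1) (k + 1) := inter_subset_right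
  have hB : MeasurableSet B := measurableSet_Ioc.inter measurableSet_Ioo
  have hi := h1.integrableOn hq hT hu
  have hsplit : pathAction T (lagrAt ξ H ω) u =
      (∫ s in Ioc 0 T ∩ Iic (k - 1), lagrAt ξ H ω (primitive u s) s (u s)) +
        (∫ s in Ioc 0 T ∩ Ici (k + 1), lagrAt ξ H ω (primitive u s) s (u s)) +
        ∫ s in B, lagrAt ξ H ω (primitive u s) s (u s) := by
    have e1 := integral_inter_add_sdiff (μ := volume) (s := Ioc 0 T) (t := Iic (k - 1))
      measurableSet_Iic hi
    have e2 := integral_inter_add_sdiff (μ := volume) (s := Ioc 0 T \ Iic (k - 1)) (t := Ici (k + 1))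
      measurableSet_Ici (hi.mono_set sdiff_subset)
    have s1 : (Ioc 0 T \ Iic (k - 1)) ∩ Ici (k + 1) = Ioc 0 T ∩ Ici (k + 1) := by
      ext s
      simp only [mem_inter_iff, Set.mem_sdiff, mem_Iic, mem_Ici, not_le]
      constructor
      · rintro ⟨⟨a, _⟩, b⟩; exact ⟨a, b⟩
      · rintro ⟨a, b⟩; exact ⟨⟨a, by linarith⟩, b⟩
    have s2 : (Ioc 0 T \ Iic (k - 1)) \ Ici (k + 1) = B := by
      ext s
      simp only [B, mem_inter_iff, Set.mem_sdiff, mem_Iic, mem_Ici, not_le, mem_Ioo, and_assoc]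
    rw [s1, s2] at e2
    rw [pathAction, ← e1, ← e2, add_assoc]
  have hiν : IntegrableOn (fun s => nuAt ξ ν s ω) B := h1.integrable.mono_set hBT
  have hvol : volume B ≤ 2 := by
    refine (measure_mono hBk).trans ?_
    rw [Real.volume_Ioo]
    norm_num [show k + 1 - (k - 1) = 2 by ring]
  have hvol' : volume B ≠ ∞ := (hvol.trans_lt (by norm_num)).ne
  have hic : IntegrableOn (fun _ : ℝ => nuMean P ξ ν) B := integrableOn_const hvol'
  -- The replacement error does not involve the velocity, hence is the same for all curves.
  have hmain : |(∫ s in B, lagrAt ξ H ω (primitive u s) s (u s)) -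
      ∫ s in B, lagrMean P ξ H (u s)| ≤ ∫ s in B, (nuAt ξ ν s ω + nuMean P ξ ν) := by
    rw [← integral_sub (hi.mono_set hBT)
      ((S.integrableOn_lagrMean hfin hq hN hu).mono_set hBT), ← Real.norm_eq_abs]
    exact norm_integral_le_of_norm_le (hiν.add hic) 
      (Eventually.of_forall fun s => h2 (primitive u s) s (u s))
  have hconst : ∫ s in B, nuMean P ξ ν ≤ 2 * nuMean P ξ ν := by
    rw [setIntegral_const, smul_eq_mul]
    have hn : 0 ≤ nuMean P ξ ν := zero_le_one.trans (S.one_le_nuMean hfin)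
    have : volume.real B ≤ 2 := by
      have := ENNReal.toReal_mono (by norm_num) hvol
      simpa [Measure.real] using this
    gcongr
  rw [integral_add hiν hic] at hmain
  have h4 := h3 B (hBk.trans Ioo_subset_Icc_self)
  rw [hsplit, add_sub_add_left_eq_sub]
  linarith

/-- The increments of the martingale closed by the minimal action are controlled by the integrals
of `ν_t` over time intervals of unit length. -/
theorem exists_incrementControl (hq : 1 < q) (hN : 1 < N₁) (hT : 0 < T) (x : Spc d) :
    ∃ (F : ℕ → MeasurableSpace Ω) (Y : ℕ → Ω → ℝ),
      IncrementControl P F (metric ξ H x T) Y (⌈T⌉₊ + 1) ∧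
      ∀ k : ℕ, ∀ᵐ ω ∂P, |Y k ω| ≤ (nuIntAt ξ ν (k - 1) ω).toReal + (nuIntAt ξ ν k ω).toReal +
        2 * nuMean P ξ ν := by
  obtain ⟨u, hu, hdense⟩ := exists_dense_velocities hq hT x
  choose g₁ hg₁ hg₁eq using fun (k : ℕ) i => S.exists_measurable_eq_action hq hT (hu i)
    (A := Iic ((k : ℝ) - 1)) (B := Ioc 0 T ∩ Iic ((k : ℝ) - 1))
    (measurableSet_Ioc.inter measurableSet_Iic) inter_subset_left inter_subset_right
  choose g₂ hg₂ hg₂eq using fun (k : ℕ) i => S.exists_measurable_eq_action hq hT (hu i)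
    (A := Ici ((k : ℝ) + 1)) (B := Ioc 0 T ∩ Ici ((k : ℝ) + 1))
    (measurableSet_Ioc.inter measurableSet_Ici) inter_subset_left inter_subset_right
  -- Contribution of the window. The mean Lagrangian depends on the velocity alone, so this is
  -- deterministic and the past and future actions are separate arguments of `f k`.
  let c : ℕ → ℕ → ℝ := fun k i =>
    ∫ s in Ioc 0 T ∩ Ioo ((k : ℝ) - 1) (k + 1), lagrMean P ξ H (u i s)
  let f : ℕ → (ℕ → ℝ) × (ℕ → ℝ) → ℝ := fun k z => ⨅ i, (z.1 i + z.2 i + c k i)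
  have hf : ∀ k, Measurable (f k) := fun k => Measurable.iInf fun i => by fun_prop
  let X : ℕ → Ω → ℝ := fun k ω => f k (fun i => g₁ k i ω, fun i => g₂ k i ω)
  -- The window for `k` is `(k - 1, k + 1)`: its past is exactly `F k`, while `F (k + 1)` stops at
  -- time `k`, one unit before its future starts.
  let F : ℕ → MeasurableSpace Ω := fun k => timeSigma ξ (Iic ((k : ℝ) - 1))
  have hFle : ∀ k, F k ≤ mΩ := fun k => timeSigma_le S.measurable_field _
  have hF : Monotone F := fun k l hkl => timeSigma_mono ξ (Iic_subset_Iic.2 (by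
    have : (k : ℝ) ≤ l := by exact_mod_cast hkl
    linarith))
  have hGle : ∀ A, timeSigma ξ A ≤ mΩ := timeSigma_le S.measurable_field
  have ha : ∀ k, Measurable[F k] fun ω i => g₁ k i ω := fun k =>
    @measurable_pi_lambda _ _ _ (F k) _ _ fun i => hg₁ k i
  have hb : ∀ k : ℕ, Measurable[timeSigma ξ (Ici ((k : ℝ) + 1))] fun ω i => g₂ k i ω := fun k =>
    @measurable_pi_lambda _ _ _ (timeSigma ξ (Ici ((k : ℝ) + 1))) _ _ fun i => hg₂ k i
  have hXm : ∀ k, Measurable (X k) := fun k =>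
    (hf k).comp (((ha k).mono (hFle k) le_rfl).prodMk ((hb k).mono (hGle _) le_rfl))
  have hYbound : ∀ k : ℕ, ∀ᵐ ω ∂P, |metric ξ H x T ω - X k ω| ≤
      (nuIntAt ξ ν (k - 1) ω).toReal + (nuIntAt ξ ν k ω).toReal + 2 * nuMean P ξ ν := by
    intro k
    filter_upwards [S.ae_metric_eq hfin hq hN hT hu hdense, S.ae_growthLagrangian hfin hN T,
      ae_all_iff.2 fun i => S.ae_abs_pathAction_sub_le hfin hq hN hT (hu i) k,
      ae_all_iff.2 (hg₁eq k), ae_all_iff.2 (hg₂eq k)] with ω h1 h2 h3 h4 h5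
    rw [h1]
    refine abs_ciInf_sub_ciInf_le (h2.bddBelow_range_pathAction hq hT hu) fun i => ?_
    have := h3 i
    rw [h4 i, h5 i] at this
    exact this
  have hint := S.integrable_metric hfin hq hN hT x
  have hYi : ∀ k, Integrable (fun ω => metric ξ H x T ω - X k ω) P := fun k =>
    (((S.integrable_nuIntAt hfin _).add (S.integrable_nuIntAt hfin _)).add
      (integrable_const _)).mono' (hint.1.sub (hXm k).aestronglyMeasurable) (hYbound k)
  have hXi : ∀ k, Integrable (X k) P := fun k =>
    (hint.sub (hYi k)).congr (Eventually.of_forall fun ω => by simp)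
  refine ⟨F, fun k ω => metric ξ H x T ω - X k ω, ⟨hF, hFle, hint, hYi, ?_, ?_, ?_⟩, hYbound⟩
  · intro k
    have e : (metric ξ H x T - fun ω => metric ξ H x T ω - X k ω) = X k := by
      ext ω; simp
    rw [e]
    have hind : Indep (F (k + 1)) (timeSigma ξ (Ici ((k : ℝ) + 1))) P := by
      have := S.unitRange (k : ℝ)
      simpa [F] using this
    exact condExp_comp_eq_condExp (hFle (k + 1)) (hGle _) (hF (Nat.le_succ k)) hind (ha k) (hb k)
      (hf k) (hXi k)
  · obtain ⟨g, hg, hgeq⟩ := S.exists_measurable_eq_metric hfin hq hN hT x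
      (A := Ici 0) (fun s hs => hs.1.le)
    -- `F 0` stops at time `-1`, and the action sees only times from `0` on.
    have hind : Indep (timeSigma ξ (Ici 0)) (F 0) P := by
      have := (S.unitRange (-1 : ℝ)).symm
      simpa [F] using this
    refine (condExp_congr_ae hgeq).trans ((condExp_indep_eq (hGle _) (hFle 0)
      hg.stronglyMeasurable hind).trans (Eventually.of_forall fun ω => ?_))
    exact (integral_congr_ae hgeq).symm
  -- The final index `⌈T⌉₊ + 1` gives the field up to time `⌈T⌉₊ ≥ T`, which determines the action.
  · obtain ⟨g, hg, hgeq⟩ := S.exists_measurable_eq_metric hfin hq hN hT x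
      (A := Iic (((⌈T⌉₊ + 1 : ℕ) : ℝ) - 1)) (fun s hs => by
        rw [mem_Iic]; push_cast; linarith [hs.2, Nat.le_ceil T])
    exact condExp_of_aestronglyMeasurable' (hFle _)
      (AEStronglyMeasurable.congr (hg.stronglyMeasurable.aestronglyMeasurable) hgeq.symm) hint

end StandingAssumptions

end IncrementControlOfMetric

/-! ### Growth of `φ`, and the moment and bounded cases. -/

section Tails

open Filter Topology

lemma one_le_slowPhi {c₁ q s : ℝ} (hc : 0 ≤ c₁) (hs : 1 ≤ s) : 1 ≤ slowPhi c₁ q s :=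
  Real.one_le_exp (mul_nonneg hc (Real.rpow_nonneg (Real.log_nonneg hs) _))

/-- The function `s ↦ (φ(s) log s)^{2/3}` beats `log s`. -/
lemma eventually_log_lt_slowPhi {c₁ q : ℝ} (hc : 0 < c₁) (hq : 1 < q) (K : ℝ) :
    ∀ᶠ t in atTop, K * Real.log t ≤ (slowPhi c₁ q t * Real.log t) ^ (2 / 3 : ℝ) := by
  have h1 : Tendsto (fun t : ℝ => √(Real.log t)) atTop atTop :=
    Real.tendsto_sqrt_atTop.comp Real.tendsto_log_atTop
  -- Put `y = √(log t)`. Since `1 / min 2 q ≥ 1 / 2`, `φ(t) ≥ exp (c₁ y)` for large `t`, and `exp (2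
  -- c₁ y / 3)` beats any multiple of `y ^ 2 = log t`.
  have h2 := (tendsto_exp_mul_div_rpow_atTop 2 (2 / 3 * c₁) (by positivity)).comp h1
  filter_upwards [h2.eventually_ge_atTop K, eventually_ge_atTop (Real.exp 1)] with t hK ht
  have hL : 1 ≤ Real.log t := by
    rw [Real.le_log_iff_exp_le (by linarith [Real.exp_pos 1])]; exact ht
  have hL0 : 0 < Real.log t := by linarith
  simp only [Function.comp_apply, Real.rpow_ofNat, Real.sq_sqrt hL0.le] at hK
  rw [le_div_iff₀ hL0] at hK
  refine hK.trans ?_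
  have hθ : (1 / 2 : ℝ) ≤ 1 / min 2 q :=
    one_div_le_one_div_of_le (lt_min (by norm_num) (by linarith)) (min_le_left _ _)
  have h3 : √(Real.log t) ≤ Real.log t ^ (1 / min 2 q) := by
    rw [Real.sqrt_eq_rpow]; exact Real.rpow_le_rpow_of_exponent_le hL hθ
  have h4 : Real.exp (c₁ * √(Real.log t)) ≤ slowPhi c₁ q t * Real.log t := by
    have : Real.exp (c₁ * √(Real.log t)) ≤ slowPhi c₁ q t := by
      unfold slowPhi; gcongr
    have h5 : 0 ≤ slowPhi c₁ q t := (Real.exp_pos _).le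
    nlinarith
  calc Real.exp (2 / 3 * c₁ * √(Real.log t)) = Real.exp (c₁ * √(Real.log t)) ^ (2 / 3 : ℝ) := by
        rw [← Real.exp_mul]; congr 1; ring
    _ ≤ _ := by gcongr

/-- The growth condition on the time scale in the case of exponential moments. -/
lemma eventually_truncation_scale {c₁ q : ℝ} (hc : 0 < c₁) (hq : 1 < q) {l D : ℝ} (hl : 0 < l)
    (hD : 0 ≤ D) : ∀ᶠ t in atTop, 1 ≤ (slowPhi c₁ q t * Real.log t) ^ (2 / 3 : ℝ) ∧
      2 + 32 * √t * D < Real.exp (l * (slowPhi c₁ q t * Real.log t) ^ (2 / 3 : ℝ) / 100) := by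
  have hlogD : 0 ≤ Real.log (2 + 32 * D) := Real.log_nonneg (by linarith)
  -- The left side is at most `(2 + 32 D) t`; the multiple of `log t` is chosen so that the exponent
  -- exceeds the logarithm of this.
  filter_upwards [eventually_log_lt_slowPhi hc hq (100 / l * (Real.log (2 + 32 * D) + 2)),
    eventually_log_lt_slowPhi hc hq 1, eventually_ge_atTop (Real.exp 1)] with t h1 h2 ht
  have ht1 : 1 ≤ t := (Real.one_le_exp (by norm_num)).trans ht
  have hL : 1 ≤ Real.log t := by
    rw [Real.le_log_iff_exp_le (by linarith [Real.exp_pos 1])]; exact ht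
  set r := (slowPhi c₁ q t * Real.log t) ^ (2 / 3 : ℝ)
  refine ⟨by linarith, ?_⟩
  have h3 : 2 + 32 * √t * D ≤ (2 + 32 * D) * t := by
    have : √t ≤ t := (Real.sqrt_le_left (by linarith)).2 (by nlinarith)
    nlinarith
  refine h3.trans_lt ?_
  rw [← Real.exp_log (show 0 < (2 + 32 * D) * t by positivity), Real.log_mul (by positivity)
    (by positivity), Real.exp_lt_exp]
  have h4 : l * (100 / l * (Real.log (2 + 32 * D) + 2) * Real.log t) ≤ l * r := by gcongr
  have h5 : l * (100 / l * (Real.log (2 + 32 * D) + 2) * Real.log t) =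
      100 * ((Real.log (2 + 32 * D) + 2) * Real.log t) := by field_simp
  rw [h5] at h4
  nlinarith

variable {Ω₀ Ω : Type*} [MeasurableSpace Ω₀] [mΩ : MeasurableSpace Ω] {d : ℕ}
  {P : Measure Ω} [IsProbabilityMeasure P] {ξ : SpTm d → Ω → Ω₀} {H : Spc d → Ω₀ → ℝ}
  {ν : (Spc d → Ω₀) → ℝ} {q N₁ t : ℝ}

omit [MeasurableSpace Ω₀] in
lemma devEvent_anti (P : Measure Ω) (ξ : SpTm d → Ω → Ω₀) (H : Spc d → Ω₀ → ℝ) (x : Spc d) (t : ℝ)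
    {a b : ℝ} (h : a ≤ b) : devEvent P ξ H x t b ⊆ devEvent P ξ H x t a :=
  fun _ hω => h.trans hω

lemma ceil_add_one_le (ht : 2 ≤ t) : ((⌈t⌉₊ + 1 : ℕ) : ℝ) ≤ 2 * t := by
  have := Nat.ceil_lt_add_one (show 0 ≤ t by linarith)
  push_cast
  linarith

namespace StandingAssumptions

variable (S : StandingAssumptions P ξ H ν q N₁)

include S

lemma lintegral_comp_nuIntAt {φ : ℝ≥0∞ → ℝ≥0∞} (hφ : Measurable φ) (s : ℝ) :
    ∫⁻ ω, φ (nuIntAt ξ ν s ω) ∂P = ∫⁻ ω, φ (nuInt ξ ν ω) ∂P := by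
  rw [← lintegral_map hφ (S.measurable_nuIntAt s), S.map_nuIntAt,
    lintegral_map hφ S.measurable_nuInt]

lemma eLpNorm_nuIntAt_le {p : ℝ} (hp : 2 ≤ p) (s : ℝ) :
    eLpNorm (fun ω => (nuIntAt ξ ν s ω).toReal) (ENNReal.ofReal p) P ≤
      eLpNorm (nuInt ξ ν) (ENNReal.ofReal p) P := by
  have hp0 : 0 < p := by linarith
  have h0 : ENNReal.ofReal p ≠ 0 := by simpa using hp0
  rw [eLpNorm_eq_lintegral_rpow_enorm_toReal h0 ENNReal.ofReal_ne_top,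
    eLpNorm_eq_lintegral_rpow_enorm_toReal h0 ENNReal.ofReal_ne_top]
  gcongr ?_ ^ _
  simp only [enorm_eq_self]
  rw [← S.lintegral_comp_nuIntAt (φ := fun y => y ^ (ENNReal.ofReal p).toReal) (by fun_prop) s]
  refine lintegral_mono fun ω => ?_
  gcongr
  rw [Real.enorm_eq_ofReal ENNReal.toReal_nonneg]
  exact ENNReal.ofReal_toReal_le

/-- Case of finite moments. -/
theorem deviation_of_moment (hq : 1 < q) (hN : 1 < N₁) (x : Spc d) (ht : 2 ≤ t) {c₁ : ℝ}
    (hc₁ : 0 < c₁) {p C₀ : ℝ} (hp : 2 ≤ p)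
    (h : eLpNorm (nuInt ξ ν) (ENNReal.ofReal p) P < ENNReal.ofReal C₀) :
    Integrable (metric ξ H x t) P ∧ ∀ lam : ℝ, 0 < lam →
      P (devEvent P ξ H x t (lam * t ^ (1 / 2 : ℝ) * slowPhi c₁ q t *
        (‖x‖ ^ q / t ^ q + C₀ * Real.log t))) ≤
      ENNReal.ofReal (2 * rpowTaylorConst p * Real.exp (rpowTaylorConst p) *
        (2 ^ (1 / 2 : ℝ) * 8 / Real.log 2) ^ p / lam ^ p) := by
  have hC₀ : 0 < C₀ := ENNReal.ofReal_pos.1 (zero_le.trans_lt h)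
  have ht0 : 0 < t := by linarith
  have hp1 : 1 ≤ ENNReal.ofReal p := ENNReal.one_le_ofReal.2 (by linarith)
  have hL1 : ∫⁻ ω, nuInt ξ ν ω ∂P ≤ ENNReal.ofReal C₀ := by
    have := eLpNorm_le_eLpNorm_of_exponent_le (μ := P) hp1
      S.measurable_nuInt.aestronglyMeasurable
    rw [eLpNorm_one_eq_lintegral_enorm] at this
    simp only [enorm_eq_self] at this
    exact this.trans h.le
  have hfin : ∫⁻ ω, nuInt ξ ν ω ∂P ≠ ∞ := (hL1.trans_lt ENNReal.ofReal_lt_top).ne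
  have hmean : nuMean P ξ ν ≤ C₀ := by
    rwa [← S.ofReal_nuMean hfin, ENNReal.ofReal_le_ofReal_iff hC₀.le] at hL1
  have hmean0 : 0 ≤ nuMean P ξ ν := zero_le_one.trans (S.one_le_nuMean hfin)
  refine ⟨S.integrable_metric hfin hq hN ht0 x, fun lam hlam => ?_⟩
  obtain ⟨F, Y, hI, hY⟩ := S.exists_incrementControl hfin hq hN ht0 x
  set n := ⌈t⌉₊ + 1
  have hn : 0 < n := Nat.succ_pos _
  have hn2 : (n : ℝ) ≤ 2 * t := ceil_add_one_le ht
  -- The factor `4` counts two unit-time integrals and twice the mean, each at most `C₀`.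
  have hYp : ∀ k, eLpNorm (Y k) (ENNReal.ofReal p) P ≤ ENNReal.ofReal (4 * C₀) := by
    intro k
    have hm : ∀ s, AEStronglyMeasurable (fun ω => (nuIntAt ξ ν s ω).toReal) P := fun s =>
      (S.measurable_nuIntAt s).ennreal_toReal.aestronglyMeasurable
    have hb : ∀ s, eLpNorm (fun ω => (nuIntAt ξ ν s ω).toReal) (ENNReal.ofReal p) P ≤
        ENNReal.ofReal C₀ := fun s => (S.eLpNorm_nuIntAt_le hp s).trans h.le
    have hconst : eLpNorm (fun _ : Ω => 2 * nuMean P ξ ν) (ENNReal.ofReal p) P ≤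
        ENNReal.ofReal (2 * C₀) := by
      rw [eLpNorm_const _ (by simpa using by linarith) (IsProbabilityMeasure.ne_zero P)]
      simp only [measure_univ, ENNReal.one_rpow, mul_one]
      rw [Real.enorm_eq_ofReal (by linarith)]
      exact ENNReal.ofReal_le_ofReal (by linarith)
    calc eLpNorm (Y k) (ENNReal.ofReal p) P
        ≤ eLpNorm ((fun ω => (nuIntAt ξ ν (k - 1) ω).toReal) +
            (fun ω => (nuIntAt ξ ν k ω).toReal) + fun _ => 2 * nuMean P ξ ν)
            (ENNReal.ofReal p) P := by
          refine eLpNorm_mono_ae ?_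
          filter_upwards [hY k] with ω hω
          rw [Real.norm_eq_abs]
          exact hω.trans (le_abs_self _)
      _ ≤ ENNReal.ofReal C₀ + ENNReal.ofReal C₀ + ENNReal.ofReal (2 * C₀) := by
          refine (eLpNorm_add_le ((hm _).add (hm _)) aestronglyMeasurable_const hp1).trans ?_
          gcongr
          refine (eLpNorm_add_le (hm _) (hm _) hp1).trans ?_
          gcongr
          · exact hb _
          · exact hb _
      _ = ENNReal.ofReal (4 * C₀) := by
          rw [← ENNReal.ofReal_add hC₀.le hC₀.le, ← ENNReal.ofReal_add (by linarith) (by linarith)]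
          congr 1; ring
  have hlog2 : 0 < Real.log 2 := Real.log_pos (by norm_num)
  have hlogt : Real.log 2 ≤ Real.log t := Real.log_le_log (by norm_num) ht
  have hφ := one_le_slowPhi (q := q) hc₁.le (show 1 ≤ t by linarith)
  have hx : 0 ≤ ‖x‖ ^ q / t ^ q := by positivity
  -- A smaller threshold suffices: drop `|x|^q / t^q`, bound `φ` below by `1` and `log t` by `log
  -- 2`.
  set A := lam * t ^ (1 / 2 : ℝ) * (C₀ * Real.log 2)
  have hA : 0 < A := by positivity
  have hAle : A ≤ lam * t ^ (1 / 2 : ℝ) * slowPhi c₁ q t * (‖x‖ ^ q / t ^ q + C₀ * Real.log t) := by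
    have h1 : lam * t ^ (1 / 2 : ℝ) ≤ lam * t ^ (1 / 2 : ℝ) * slowPhi c₁ q t :=
      le_mul_of_one_le_right (by positivity) hφ
    have h2 : C₀ * Real.log 2 ≤ ‖x‖ ^ q / t ^ q + C₀ * Real.log t := by nlinarith
    exact mul_le_mul h1 h2 (by positivity) (by positivity)
  refine (measure_mono (devEvent_anti P ξ H x t hAle)).trans ?_
  rw [← ofReal_measureReal]
  refine ENNReal.ofReal_le_ofReal ?_
  refine (hI.measure_ge_le_of_moment hp (by linarith) hYp hn hA).trans ?_
  have hn0 : (0 : ℝ) < n := by exact_mod_cast hn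
  have hC := rpowTaylorConst_pos hp
  have e1 : (n : ℝ) ^ (p / 2) * (2 * (4 * C₀)) ^ p / A ^ p =
      ((n : ℝ) ^ (1 / 2 : ℝ) * (8 * C₀) / A) ^ p := by
    rw [Real.div_rpow (by positivity) hA.le,
      Real.mul_rpow (x := (n : ℝ) ^ (1 / 2 : ℝ)) (by positivity) (by positivity),
      ← Real.rpow_mul hn0.le]
    ring_nf
  have e2 : (n : ℝ) ^ (1 / 2 : ℝ) * (8 * C₀) / A ≤ 2 ^ (1 / 2 : ℝ) * 8 / Real.log 2 / lam := by
    have h1 : (n : ℝ) ^ (1 / 2 : ℝ) ≤ 2 ^ (1 / 2 : ℝ) * t ^ (1 / 2 : ℝ) := by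
      rw [← Real.mul_rpow (by norm_num) ht0.le]
      exact Real.rpow_le_rpow hn0.le hn2 (by norm_num)
    calc (n : ℝ) ^ (1 / 2 : ℝ) * (8 * C₀) / A
        ≤ 2 ^ (1 / 2 : ℝ) * t ^ (1 / 2 : ℝ) * (8 * C₀) / A := by gcongr
      _ = _ := by
          have : 0 < t ^ (1 / 2 : ℝ) := by positivity
          simp only [A]; field_simp
  have e3 : ((n : ℝ) ^ (1 / 2 : ℝ) * (8 * C₀) / A) ^ p ≤
      (2 ^ (1 / 2 : ℝ) * 8 / Real.log 2) ^ p / lam ^ p := by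
    rw [← Real.div_rpow (by positivity) hlam.le]
    exact Real.rpow_le_rpow (by positivity) e2 (by linarith)
  rw [← e1] at e3
  have e4 := mul_le_mul_of_nonneg_left e3
    (show 0 ≤ 2 * rpowTaylorConst p * Real.exp (rpowTaylorConst p) by positivity)
  calc _ = 2 * rpowTaylorConst p * Real.exp (rpowTaylorConst p) *
        ((n : ℝ) ^ (p / 2) * (2 * (4 * C₀)) ^ p / A ^ p) := by ring
    _ ≤ _ := e4
    _ = _ := by ring

/-- Case of an almost sure bound. -/
theorem deviation_of_bounded (hq : 1 < q) (hN : 1 < N₁) (x : Spc d) (ht : 2 ≤ t) {c₁ : ℝ}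
    (hc₁ : 0 < c₁) (hc₁' : c₁ ≤ 1 / 1000) {C₀ : ℝ}
    (h : ∀ᵐ ω ∂P, nuInt ξ ν ω < ENNReal.ofReal C₀) :
    Integrable (metric ξ H x t) P ∧ ∀ lam : ℝ, 0 < lam →
      P (devEvent P ξ H x t (lam * t ^ (1 / 2 : ℝ) * slowPhi c₁ q t *
        (‖x‖ ^ q / t ^ q + C₀ * Real.log t))) ≤
      ENNReal.ofReal (2 * Real.exp (-c₁ * lam ^ 2)) := by
  have hC₀ : 0 < C₀ := by
    obtain ⟨ω, hω⟩ := h.exists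
    exact ENNReal.ofReal_pos.1 (zero_le.trans_lt hω)
  have ht0 : 0 < t := by linarith
  have hL1 : ∫⁻ ω, nuInt ξ ν ω ∂P ≤ ENNReal.ofReal C₀ := by
    refine (lintegral_mono_ae (h.mono fun ω hω => hω.le)).trans ?_
    simp
  have hfin : ∫⁻ ω, nuInt ξ ν ω ∂P ≠ ∞ := (hL1.trans_lt ENNReal.ofReal_lt_top).ne
  have hmean : nuMean P ξ ν ≤ C₀ := by
    rwa [← S.ofReal_nuMean hfin, ENNReal.ofReal_le_ofReal_iff hC₀.le] at hL1
  refine ⟨S.integrable_metric hfin hq hN ht0 x, fun lam hlam => ?_⟩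
  obtain ⟨F, Y, hI, hY⟩ := S.exists_incrementControl hfin hq hN ht0 x
  set n := ⌈t⌉₊ + 1
  have hn : 0 < n := Nat.succ_pos _
  have hn2 : (n : ℝ) ≤ 2 * t := ceil_add_one_le ht
  have hs : ∀ s, ∀ᵐ ω ∂P, (nuIntAt ξ ν s ω).toReal ≤ C₀ := by
    intro s
    have h1 : ∀ᵐ y ∂(P.map (nuIntAt ξ ν s)), y < ENNReal.ofReal C₀ := by
      rw [S.map_nuIntAt]
      exact (ae_map_iff S.measurable_nuInt.aemeasurable measurableSet_Iio).2 h
    filter_upwards [ae_of_ae_map (S.measurable_nuIntAt s).aemeasurable h1] with ω hω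
    exact ENNReal.toReal_le_of_le_ofReal hC₀.le hω.le
  have hYb : ∀ k, ∀ᵐ ω ∂P, |Y k ω| ≤ 4 * C₀ := by
    intro k
    filter_upwards [hY k, hs (k - 1), hs k] with ω h1 h2 h3
    linarith
  have hlog2 : 0 < Real.log 2 := Real.log_pos (by norm_num)
  have hlogt : Real.log 2 ≤ Real.log t := Real.log_le_log (by norm_num) ht
  have hφ := one_le_slowPhi (q := q) hc₁.le (show 1 ≤ t by linarith)
  have hx : 0 ≤ ‖x‖ ^ q / t ^ q := by positivity
  set A := lam * t ^ (1 / 2 : ℝ) * (C₀ * Real.log 2) with hAdef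
  have hA : 0 < A := by positivity
  have hAle : A ≤ lam * t ^ (1 / 2 : ℝ) * slowPhi c₁ q t * (‖x‖ ^ q / t ^ q + C₀ * Real.log t) := by
    have h1 : lam * t ^ (1 / 2 : ℝ) ≤ lam * t ^ (1 / 2 : ℝ) * slowPhi c₁ q t :=
      le_mul_of_one_le_right (by positivity) hφ
    have h2 : C₀ * Real.log 2 ≤ ‖x‖ ^ q / t ^ q + C₀ * Real.log t := by nlinarith
    exact mul_le_mul h1 h2 (by positivity) (by positivity)
  refine (measure_mono (devEvent_anti P ξ H x t hAle)).trans ?_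
  rw [← ofReal_measureReal]
  refine ENNReal.ofReal_le_ofReal ?_
  refine (hI.measure_ge_le_of_bounded (by linarith) hYb hA.le).trans ?_
  have hn0 : (0 : ℝ) < n := by exact_mod_cast hn
  -- With increments at most `8 C₀` and `n ≤ 2 t`, the Azuma exponent is at least `λ² (log 2)² /
  -- 256`, which exceeds `λ² / 1000`.
  gcongr 2 * Real.exp ?_
  rw [neg_div, neg_mul, neg_le_neg_iff, le_div_iff₀ (by positivity)]
  have e1 : A ^ 2 = lam ^ 2 * t * C₀ ^ 2 * Real.log 2 ^ 2 := by
    rw [hAdef, ← Real.sqrt_eq_rpow, mul_pow, mul_pow, mul_pow, Real.sq_sqrt ht0.le]; ring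
  have hl : (0.69 : ℝ) ≤ Real.log 2 := by linarith [Real.log_two_gt_d9]
  have hl2 : (0.47 : ℝ) ≤ Real.log 2 ^ 2 := by nlinarith
  have hpos : 0 ≤ lam ^ 2 * C₀ ^ 2 := by positivity
  calc c₁ * lam ^ 2 * (2 * n * (2 * (4 * C₀)) ^ 2)
      = c₁ * (128 * n) * (lam ^ 2 * C₀ ^ 2) := by ring
    _ ≤ (1 / 1000) * (128 * (2 * t)) * (lam ^ 2 * C₀ ^ 2) := by gcongr
    _ ≤ 0.47 * t * (lam ^ 2 * C₀ ^ 2) := by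
        apply mul_le_mul_of_nonneg_right _ hpos
        linarith
    _ ≤ Real.log 2 ^ 2 * t * (lam ^ 2 * C₀ ^ 2) := by gcongr
    _ = A ^ 2 := by rw [e1]; ring

end StandingAssumptions

end Tails

/-! ### The case of an exponential moment, by truncation. -/

section ExponentialMoments

lemma le_eReal_exp (y : ℝ≥0∞) : y ≤ EReal.exp (y : EReal) := by
  induction y with
  | top => simp
  | coe x =>
    rw [show (((x : ℝ≥0∞)) : EReal) = ((x : ℝ) : EReal) from rfl, EReal.exp_coe,
      ← ENNReal.ofReal_coe_nnreal]
    exact ENNReal.ofReal_le_ofReal (by linarith [Real.add_one_le_exp (x : ℝ)])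

lemma ofReal_exp_toReal_le (y : ℝ≥0∞) :
    ENNReal.ofReal (Real.exp y.toReal) ≤ EReal.exp (y : EReal) := by
  induction y with
  | top => simp
  | coe x =>
    rw [show (((x : ℝ≥0∞)) : EReal) = ((x : ℝ) : EReal) from rfl, EReal.exp_coe]
    simp

/-- On the event `a < y`, an exponential moment of the bounds of `y` controls `y`. -/
lemma le_exp_of_lt {c a y i j m : ℝ} (hc : 0 < c) (ha : a < y) (hy : y ≤ i + j + 2 * m) :
    y ≤ 2 / c * Real.exp (-(c * a) / 4) * Real.exp (c * m) *
      (Real.exp (c * i) + Real.exp (c * j)) := by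
  have h1 : y ≤ 4 / c * Real.exp (c * y / 4) := by
    have h2 : c * y / 4 ≤ Real.exp (c * y / 4) := by linarith [Real.add_one_le_exp (c * y / 4)]
    calc y = 4 / c * (c * y / 4) := by field_simp
      _ ≤ _ := by gcongr
  -- Write `c y / 4 = c y / 2 - c y / 4`; the first term uses the upper bound on `y`, the second
  -- uses `y > a`. The halved exponents let the two integrals be separated by the inequality of
  -- means, without independence.
  have h2 : Real.exp (c * y / 4) ≤ Real.exp (-(c * a) / 4) * Real.exp (c * m) *
      (Real.exp (c * i / 2) * Real.exp (c * j / 2)) := by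
    rw [← Real.exp_add, ← Real.exp_add, ← Real.exp_add, Real.exp_le_exp]
    have h3 := mul_le_mul_of_nonneg_left hy hc.le
    have h4 := mul_lt_mul_of_pos_left ha hc
    linarith
  have h3 : Real.exp (c * i / 2) * Real.exp (c * j / 2) ≤
      (Real.exp (c * i) + Real.exp (c * j)) / 2 := by
    have e1 : Real.exp (c * i) = Real.exp (c * i / 2) ^ 2 := by
      rw [← Real.exp_nat_mul]; congr 1; push_cast; ring
    have e2 : Real.exp (c * j) = Real.exp (c * j / 2) ^ 2 := by
      rw [← Real.exp_nat_mul]; congr 1; push_cast; ring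
    rw [e1, e2]
    linarith [two_mul_le_add_sq (Real.exp (c * i / 2)) (Real.exp (c * j / 2))]
  calc y ≤ 4 / c * Real.exp (c * y / 4) := h1
    _ ≤ 4 / c * (Real.exp (-(c * a) / 4) * Real.exp (c * m) *
        ((Real.exp (c * i) + Real.exp (c * j)) / 2)) := by
        refine mul_le_mul_of_nonneg_left (h2.trans ?_) (by positivity)
        gcongr
    _ = _ := by ring

/-- The tail bound obtained by truncation at level `w / c`, where `w = (λ s)^{2/3}`. -/
lemma truncation_tail_lt {lam lam₀ s c t n D : ℝ} (hlam₀ : 0 < lam₀) (hlam : lam₀ ≤ lam)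
    (hs : 0 < s) (hc : 0 < c) (ht : 0 < t) (hn : 0 < n) (hnt : n ≤ 2 * t) (hD : 0 ≤ D)
    (hr : 1 ≤ s ^ (2 / 3 : ℝ))
    (hT : 2 + 32 * √t * D < Real.exp (lam₀ ^ (2 / 3 : ℝ) * s ^ (2 / 3 : ℝ) / 100)) :
    2 * Real.exp (-(lam * √t * s / c / 2) ^ 2 /
        (2 * n * (2 * ((lam * s) ^ (2 / 3 : ℝ) / c)) ^ 2)) +
      2 / (lam * √t * s / c) *
        (n * (2 * (4 / c * Real.exp (-(lam * s) ^ (2 / 3 : ℝ) / 4) * D))) <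
      Real.exp (-(1 / 1000) * lam ^ (2 / 3 : ℝ)) := by
  have hl : 0 < lam := hlam₀.trans_le hlam
  have hw : (lam * s) ^ (2 / 3 : ℝ) = lam ^ (2 / 3 : ℝ) * s ^ (2 / 3 : ℝ) :=
    Real.mul_rpow hl.le hs.le
  -- Source of the exponent `2/3`: truncating at `w / c` gives a Gaussian exponent of order `(λ s)²
  -- / w²` and a tail exponent of order `w`; they balance when `w³ = (λ s)²`.
  have hwpow : (lam * s) ^ 2 = ((lam * s) ^ (2 / 3 : ℝ)) ^ 3 := by
    rw [← Real.rpow_natCast ((lam * s) ^ (2 / 3 : ℝ)), ← Real.rpow_mul (by positivity)]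
    norm_num
  set w := (lam * s) ^ (2 / 3 : ℝ)
  have hw0 : 0 < w := by positivity
  have hwl : lam ^ (2 / 3 : ℝ) ≤ w := by
    rw [hw]; exact le_mul_of_one_le_right (by positivity) hr
  have hT' : 2 + 32 * √t * D < Real.exp (w / 100) := by
    refine hT.trans_le ?_
    rw [hw]; gcongr
  have hsq : 0 < √t := Real.sqrt_pos.2 ht
  -- If `w < 1` then `exp (w / 100) < 2`, contradicting the scale condition.
  have hw1 : 1 ≤ w := by
    by_contra! hlt
    have h1 : Real.exp (w / 100) < Real.exp (Real.log 2) := by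
      rw [Real.exp_lt_exp]; linarith [Real.log_two_gt_d9]
    rw [Real.exp_log (by norm_num)] at h1
    have : 0 ≤ 32 * √t * D := by positivity
    linarith
  have hls : 1 ≤ lam * s := by
    have : 1 ≤ (lam * s) ^ 2 := by rw [hwpow]; exact one_le_pow₀ hw1
    nlinarith [mul_pos hl hs]
  have h1 : Real.exp (-(lam * √t * s / c / 2) ^ 2 / (2 * n * (2 * (w / c)) ^ 2)) ≤
      Real.exp (-(w / 64)) := by
    rw [Real.exp_le_exp, neg_div, neg_le_neg_iff, le_div_iff₀ (by positivity)]
    have e1 : (lam * √t * s / c / 2) ^ 2 = (lam * s) ^ 2 * t / (4 * c ^ 2) := by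
      rw [← Real.sq_sqrt ht.le, Real.sqrt_sq hsq.le]; ring
    rw [e1, hwpow]
    calc w / 64 * (2 * n * (2 * (w / c)) ^ 2) = w ^ 3 / (8 * c ^ 2) * n := by ring
      _ ≤ w ^ 3 / (8 * c ^ 2) * (2 * t) := by gcongr
      _ = _ := by ring
  have h2 : 2 / (lam * √t * s / c) * (n * (2 * (4 / c * Real.exp (-w / 4) * D))) ≤
      32 * √t * D * Real.exp (-(w / 64)) := by
    have e2 : Real.exp (-w / 4) ≤ Real.exp (-(w / 64)) := by
      rw [Real.exp_le_exp]; linarith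
    calc 2 / (lam * √t * s / c) * (n * (2 * (4 / c * Real.exp (-w / 4) * D)))
        ≤ 2 / (lam * √t * s / c) * (2 * t * (2 * (4 / c * Real.exp (-(w / 64)) * D))) := by
          gcongr
      _ = 32 * (t / √t) * D * Real.exp (-(w / 64)) / (lam * s) := by field_simp; ring
      _ = 32 * √t * D * Real.exp (-(w / 64)) / (lam * s) := by rw [Real.div_sqrt]
      _ ≤ _ := div_le_self (by positivity) hls
  calc _ ≤ 2 * Real.exp (-(w / 64)) + 32 * √t * D * Real.exp (-(w / 64)) := by gcongr
    _ = (2 + 32 * √t * D) * Real.exp (-(w / 64)) := by ring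
    _ < Real.exp (w / 100) * Real.exp (-(w / 64)) := by gcongr
    _ ≤ _ := by
        rw [← Real.exp_add, Real.exp_le_exp]; linarith

variable {Ω₀ Ω : Type*} [MeasurableSpace Ω₀] [mΩ : MeasurableSpace Ω] {d : ℕ}
  {P : Measure Ω} [IsProbabilityMeasure P] {ξ : SpTm d → Ω → Ω₀} {H : Spc d → Ω₀ → ℝ}
  {ν : (Spc d → Ω₀) → ℝ} {q N₁ t : ℝ}

namespace StandingAssumptions

variable (S : StandingAssumptions P ξ H ν q N₁)

include S

lemma integral_exp_nuIntAt_le {c C₀ : ℝ} (hc : 0 < c)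
    (h : ∫⁻ ω, EReal.exp ((ENNReal.ofReal c * nuInt ξ ν ω : ℝ≥0∞) : EReal) ∂P <
      ENNReal.ofReal C₀) (s : ℝ) :
    Integrable (fun ω => Real.exp (c * (nuIntAt ξ ν s ω).toReal)) P ∧
      ∫ ω, Real.exp (c * (nuIntAt ξ ν s ω).toReal) ∂P ≤ C₀ := by
  have hC₀ : 0 < C₀ := ENNReal.ofReal_pos.1 (zero_le.trans_lt h)
  have hle : ∫⁻ ω, ENNReal.ofReal (Real.exp (c * (nuIntAt ξ ν s ω).toReal)) ∂P ≤
      ENNReal.ofReal C₀ := by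
    rw [← S.lintegral_comp_nuIntAt
      (φ := fun y => EReal.exp ((ENNReal.ofReal c * y : ℝ≥0∞) : EReal))
      (EReal.measurable_exp.comp (measurable_coe_ennreal_ereal.comp (by fun_prop))) s] at h
    refine (lintegral_mono fun ω => ?_).trans h.le
    have := ofReal_exp_toReal_le (ENNReal.ofReal c * nuIntAt ξ ν s ω)
    rwa [ENNReal.toReal_mul, ENNReal.toReal_ofReal hc.le] at this
  have hm : Measurable fun ω => Real.exp (c * (nuIntAt ξ ν s ω).toReal) :=
    Real.measurable_exp.comp ((S.measurable_nuIntAt s).ennreal_toReal.const_mul c)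
  have hnn : 0 ≤ᵐ[P] fun ω => Real.exp (c * (nuIntAt ξ ν s ω).toReal) :=
    ae_of_all _ fun ω => (Real.exp_pos _).le
  refine ⟨(lintegral_ofReal_ne_top_iff_integrable hm.aestronglyMeasurable hnn).1
    (hle.trans_lt ENNReal.ofReal_lt_top).ne, ?_⟩
  rw [integral_eq_lintegral_of_nonneg_ae hnn hm.aestronglyMeasurable]
  exact ENNReal.toReal_le_of_le_ofReal hC₀.le hle

/-- Case of an exponential moment. -/
theorem deviation_of_expMoment (hq : 1 < q) (hN : 1 < N₁) (x : Spc d) (ht : 2 ≤ t) {c₁ : ℝ}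
    {c C₀ : ℝ} (hc : 0 < c)
    (h : ∫⁻ ω, EReal.exp ((ENNReal.ofReal c * nuInt ξ ν ω : ℝ≥0∞) : EReal) ∂P <
      ENNReal.ofReal C₀) :
    Integrable (metric ξ H x t) P ∧ ∀ lam₀ : ℝ, 0 < lam₀ →
      1 ≤ (slowPhi c₁ q t * Real.log t) ^ (2 / 3 : ℝ) →
      2 + 32 * √t * (C₀ * Real.exp C₀) < Real.exp (lam₀ ^ (2 / 3 : ℝ) *
        (slowPhi c₁ q t * Real.log t) ^ (2 / 3 : ℝ) / 100) →
      ∀ lam : ℝ, lam₀ ≤ lam →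
      P (devEvent P ξ H x t (lam * t ^ (1 / 2 : ℝ) * slowPhi c₁ q t *
        (‖x‖ ^ q / t ^ q + c⁻¹ * Real.log t))) <
      ENNReal.ofReal (Real.exp (-(1 / 1000) * lam ^ (2 / 3 : ℝ))) := by
  have hC₀ : 0 < C₀ := ENNReal.ofReal_pos.1 (zero_le.trans_lt h)
  have ht0 : 0 < t := by linarith
  -- From `y ≤ exp y`: the exponential moment bounds the mean by `C₀ / c`, whence the factor `exp
  -- C₀` in the tail constant.
  have hL1 : ENNReal.ofReal c * ∫⁻ ω, nuInt ξ ν ω ∂P ≤ ENNReal.ofReal C₀ := by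
    rw [← lintegral_const_mul _ S.measurable_nuInt]
    exact (lintegral_mono fun ω => le_eReal_exp _).trans h.le
  have hfin : ∫⁻ ω, nuInt ξ ν ω ∂P ≠ ∞ := by
    intro htop
    rw [htop, ENNReal.mul_top (by simpa using hc)] at hL1
    exact absurd (hL1.trans_lt ENNReal.ofReal_lt_top) (lt_irrefl _)
  have hmean : c * nuMean P ξ ν ≤ C₀ := by
    rwa [← S.ofReal_nuMean hfin, ← ENNReal.ofReal_mul hc.le,
      ENNReal.ofReal_le_ofReal_iff hC₀.le] at hL1
  refine ⟨S.integrable_metric hfin hq hN ht0 x, fun lam₀ hlam₀ hr hT lam hlam => ?_⟩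
  obtain ⟨F, Y, hI, hY⟩ := S.exists_incrementControl hfin hq hN ht0 x
  set n := ⌈t⌉₊ + 1
  have hn : 0 < n := Nat.succ_pos _
  have hn2 : (n : ℝ) ≤ 2 * t := ceil_add_one_le ht
  have hl : 0 < lam := hlam₀.trans_le hlam
  have hlogt : 0 < Real.log t := Real.log_pos (by linarith)
  have hφ : 0 < slowPhi c₁ q t := Real.exp_pos _
  set s := slowPhi c₁ q t * Real.log t
  have hs : 0 < s := by positivity
  set a := (lam * s) ^ (2 / 3 : ℝ) / c
  have ha : 0 < a := by positivity
  have hδ : ∀ k, ∫ ω, {ω | a < |Y k ω|}.indicator (fun ω => |Y k ω|) ω ∂P ≤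
      4 / c * Real.exp (-(lam * s) ^ (2 / 3 : ℝ) / 4) * (C₀ * Real.exp C₀) := by
    intro k
    obtain ⟨i1, l1⟩ := S.integral_exp_nuIntAt_le hc h (k - 1)
    obtain ⟨i2, l2⟩ := S.integral_exp_nuIntAt_le hc h k
    have hca : c * a = (lam * s) ^ (2 / 3 : ℝ) := by simp only [a]; field_simp
    calc ∫ ω, {ω | a < |Y k ω|}.indicator (fun ω => |Y k ω|) ω ∂P
        ≤ ∫ ω, 2 / c * Real.exp (-(c * a) / 4) * Real.exp C₀ *
            (Real.exp (c * (nuIntAt ξ ν (k - 1) ω).toReal) +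
              Real.exp (c * (nuIntAt ξ ν k ω).toReal)) ∂P := by
          refine integral_mono_of_nonneg
            (ae_of_all _ fun ω => indicator_nonneg (fun _ _ => abs_nonneg _) _)
            ((i1.add i2).const_mul _) ?_
          filter_upwards [hY k] with ω hω
          by_cases hω' : a < |Y k ω|
          · rw [indicator_of_mem (show ω ∈ {ω | a < |Y k ω|} from hω')]
            refine (le_exp_of_lt hc hω' hω).trans ?_
            gcongr
          · rw [indicator_of_notMem (show ω ∉ {ω | a < |Y k ω|} from hω')]
            positivity
      _ = 2 / c * Real.exp (-(c * a) / 4) * Real.exp C₀ *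
            ((∫ ω, Real.exp (c * (nuIntAt ξ ν (k - 1) ω).toReal) ∂P) +
              ∫ ω, Real.exp (c * (nuIntAt ξ ν k ω).toReal) ∂P) := by
          rw [integral_const_mul, integral_add i1 i2]
      _ ≤ 2 / c * Real.exp (-(c * a) / 4) * Real.exp C₀ * (C₀ + C₀) := by gcongr
      _ = _ := by rw [hca]; ring
  set A := lam * √t * s / c
  have hA : 0 < A := by positivity
  have hAle : A ≤ lam * t ^ (1 / 2 : ℝ) * slowPhi c₁ q t *
      (‖x‖ ^ q / t ^ q + c⁻¹ * Real.log t) := by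
    have hx : 0 ≤ ‖x‖ ^ q / t ^ q := by positivity
    calc A = lam * t ^ (1 / 2 : ℝ) * slowPhi c₁ q t * (c⁻¹ * Real.log t) := by
          simp only [A, s, Real.sqrt_eq_rpow]; ring
      _ ≤ _ := by gcongr; linarith
  refine (measure_mono (devEvent_anti P ξ H x t hAle)).trans_lt ?_
  rw [← ofReal_measureReal, ENNReal.ofReal_lt_ofReal_iff (Real.exp_pos _)]
  exact (hI.measure_ge_le_of_truncation ha hδ hA).trans_lt
    (truncation_tail_lt hlam₀ hlam hs hc ht0 (by exact_mod_cast hn) hn2 (by positivity) hr hT)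

end StandingAssumptions

end ExponentialMoments

/-! ### The concentration theorem. -/

theorem theorem3p1 (d : ℕ) (q : ℝ) (hq : 1 < q) :
    ∃ T : ℝ → ℝ → ℝ → ℝ → ℝ, ∀ N₁ : ℝ, 1 < N₁ → ∃ c₁ : ℝ, 0 < c₁ ∧ ∃ K : ℝ → ℝ,
      ∀ (Ω₀ Ω : Type*) [MeasurableSpace Ω₀] [MeasurableSpace Ω]
        (P : Measure Ω) [IsProbabilityMeasure P]
        (ξ : SpTm d → Ω → Ω₀) (H : Spc d → Ω₀ → ℝ) (ν : (Spc d → Ω₀) → ℝ),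
        StandingAssumptions P ξ H ν q N₁ →
        ∀ (x₀ : Spc d) (t₀ : ℝ), 2 ≤ t₀ →
          -- (a)
          (∀ p C₀ : ℝ, 2 ≤ p →
            eLpNorm (nuInt ξ ν) (ENNReal.ofReal p) P < ENNReal.ofReal C₀ →
            Integrable (metric ξ H x₀ t₀) P ∧
            ∀ lam : ℝ, 0 < lam →
              P (devEvent P ξ H x₀ t₀ (lam * t₀ ^ (1 / 2 : ℝ) * slowPhi c₁ q t₀ *
                (‖x₀‖ ^ q / t₀ ^ q + C₀ * Real.log t₀)))
                ≤ ENNReal.ofReal (K p / lam ^ p)) ∧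
          -- (b)
          (∀ c C₀ : ℝ, 0 < c →
            ∫⁻ ω, EReal.exp ((ENNReal.ofReal c * nuInt ξ ν ω : ℝ≥0∞) : EReal) ∂P
              < ENNReal.ofReal C₀ →
            Integrable (metric ξ H x₀ t₀) P ∧
            ∀ lam₀ : ℝ, 0 < lam₀ → T c C₀ (‖x₀‖ / t₀) lam₀ ≤ t₀ →
              ∀ lam : ℝ, lam₀ ≤ lam →
                P (devEvent P ξ H x₀ t₀ (lam * t₀ ^ (1 / 2 : ℝ) * slowPhi c₁ q t₀ *
                  (‖x₀‖ ^ q / t₀ ^ q + c⁻¹ * Real.log t₀)))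
                  < ENNReal.ofReal (Real.exp (-c₁ * lam ^ (2 / 3 : ℝ)))) ∧
          -- (c)
          (∀ C₀ : ℝ,
            (∀ᵐ ω ∂P, nuInt ξ ν ω < ENNReal.ofReal C₀) →
            Integrable (metric ξ H x₀ t₀) P ∧
            ∀ lam : ℝ, 0 < lam →
              P (devEvent P ξ H x₀ t₀ (lam * t₀ ^ (1 / 2 : ℝ) * slowPhi c₁ q t₀ *
                (‖x₀‖ ^ q / t₀ ^ q + C₀ * Real.log t₀)))
                ≤ ENNReal.ofReal (2 * Real.exp (-c₁ * lam ^ 2))) := by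
  -- The value `c₁ = 1 / 1000` serves all `N₁`, so the threshold can be chosen before `N₁`.
  -- Truncation takes place at the scale of `c ν`, so only `C₀` and `λ₀` enter. The absolute value
  -- makes the choice of `T` meaningful for every real `C₀`; the hypothesis of (b) forces `C₀ > 0`.
  have hscale : ∀ C₀ lam₀ : ℝ, 0 < lam₀ → ∃ T : ℝ, ∀ t, T ≤ t →
      1 ≤ (slowPhi (1 / 1000) q t * Real.log t) ^ (2 / 3 : ℝ) ∧
        2 + 32 * √t * (|C₀| * Real.exp C₀) < Real.exp (lam₀ ^ (2 / 3 : ℝ) *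
          (slowPhi (1 / 1000) q t * Real.log t) ^ (2 / 3 : ℝ) / 100) := fun C₀ lam₀ hlam₀ =>
    Filter.eventually_atTop.1 (eventually_truncation_scale (by norm_num) hq
      (Real.rpow_pos_of_pos hlam₀ _) (by positivity))
  choose! T hT using hscale
  refine ⟨fun _ C₀ _ lam₀ => T C₀ lam₀, fun N₁ hN => ⟨1 / 1000, by norm_num,
    fun p => 2 * rpowTaylorConst p * Real.exp (rpowTaylorConst p) *
      (2 ^ (1 / 2 : ℝ) * 8 / Real.log 2) ^ p, ?_⟩⟩
  intro Ω₀ Ω _ _ P _ ξ H ν S x₀ t₀ ht₀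
  refine ⟨fun p C₀ hp h => S.deviation_of_moment hq hN x₀ ht₀ (by norm_num) hp h,
    fun c C₀ hc h => ?_, fun C₀ h =>
      S.deviation_of_bounded hq hN x₀ ht₀ (by norm_num) le_rfl h⟩
  have hC₀ : 0 < C₀ := ENNReal.ofReal_pos.1 (zero_le.trans_lt h)
  obtain ⟨hint, hdev⟩ := S.deviation_of_expMoment (c₁ := 1 / 1000) hq hN x₀ ht₀ hc h
  refine ⟨hint, fun lam₀ hlam₀ hT₀ => ?_⟩
  obtain ⟨h1, h2⟩ := hT C₀ lam₀ hlam₀ t₀ hT₀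
  rw [abs_of_pos hC₀] at h2
  exact hdev lam₀ hlam₀ h1 h2
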